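/- Let $d\ge 2$, $L,B,\sigma\ge 0$, $m\in\{0,1,2,\dots\}$, and let $(\tau_n)$ be nonnegative budgets with $\tau_n=\Theta(n^{1/(d+2)})$. **BSP-Tree process on $[0,1]^d$.** Starting from the block $[0,1]^d$ with time $0$, a block $K$ born at time $t$ receives a cut as follows. For a pair $d_1<d_2$ of coordinates let $\Pi_{d_1,d_2}(K)$ be the projection of $K$ on these coordinates, $L_{d_1,d_2}(K)$ its perimeter, and $\ell_{d_1,d_2}(\theta)$ the segment onto which it projects in the direction $(\cos\theta,\sin\theta)$. Draw a cost $c\sim\mathrm{Exp}\big(\sum_{d_1<d_2}L_{d_1,d_2}(K)\big)$, independently a pair $(d_1,d_2)$ with probability proportional to $L_{d_1,d_2}(K)$, an angle $\theta\in(0,\pi]$ with density proportional to $|\ell_{d_1,d_2}(\theta)|$, and a position $u$ uniform on $\ell_{d_1,d_2}(\theta)$. The hyperplane $x_{d_1}\cos\theta+x_{d_2}\sin\theta=u$ splits $K$ into two blocks born at time $t+c$, which are cut independently by the same rule. With budget $\tau$ only the cuts with $t+c<\tau$ are made. **Forest estimator.** Given $n$ data points $(x_i,y_i)$, let $\widehat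 g_n(x)$ be the average over $M\ge1$ independent BSP-Trees with budget $\tau_n$, independent of the data, in which in addition only blocks that contain more than $m$ data points are cut, of the mean label of the data points in the leaf block containing $x$ (taken to be $0$ if there are none). (For the online BSP-Forest $m=3$; $m=0$ gives the estimator without this restriction.) **Model.** $(x_1,y_1),\dots,(x_n,y_n)$ are i.i.d., $x_i\in[0,1]^d$ has an arbitrary law $\mu$, $\mathbb E[y_i\mid x_i]=g(x_i)$ and $\operatorname{Var}(y_i\mid x_i)\le\sigma^2$, where $g:[0,1]^d\to\mathbb R$ is $L$-Lipschitz for the Euclidean norm and $|g|\le B$; the test point $x\sim\mu$ is independent of the data and the trees. **Theorem.** (a) There are $C$ and $N$, depending only on $d,L,B,\sigma,m$ and $(\tau_n)$, such that for all $n\ge N$, all $M\ge 1$ and all such $g$, $\mu$ and label distributions, $$\mathbb E\big[(g(x)-\widehat g_n(x))^2\big]\le C\,n^{-2/(d+2)}.$$ (b) This is the minimax rate over Lipschitz functions: if $L,B,\sigma>0$, there is $c>0$, depending only on $d,L,B,\sigma$, such that for every $n\ge1$ and every measurable estimator $\varphi_n$ of $n$ data points there is an $L$-Lipschitz $g:[0,1]^d\to\mathbb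 R$ with $|g|\le B$ for which, when $x_i$ and $x$ are uniform on $[0,1]^d$ and $y_i=g(x_i)+\varepsilon_i$ with independent noise $\varepsilon_i\sim N(0,\sigma^2)$, $\mathbb E[(g(x)-\varphi_n(x))^2]\ge c\,n^{-2/(d+2)}$. -/

import Mathlib

open MeasureTheory ProbabilityTheory Set Filter Asymptotics
open scoped NNReal ENNReal

noncomputable section

namespace BSP

/-- Feature vectors, with the Euclidean norm. -/
abbrev Pt (d : ℕ) : Type := EuclideanSpace ℝ (Fin d)

/-- The unit cube `[0,1]^d`. -/
def cube (d : ℕ) : Set (Pt d) := {x | ∀ i, x i ∈ Icc (0 : ℝ) 1}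

/-! ### Generating one cut in a block -/

/-- The two-dimensional pairs `(d₁, d₂)` with `d₁ < d₂`. -/
def pairs (d : ℕ) : Finset (Fin d × Fin d) := Finset.univ.filter fun p => p.1 < p.2

/-- Projection onto the coordinates `(d₁, d₂)`, into the Euclidean plane. -/
def planeProj {d : ℕ} (p : Fin d × Fin d) (x : Pt d) : EuclideanSpace ℝ (Fin 2) :=
  !₂[x p.1, x p.2]

/-- The perimeter of the projection of the block `K` onto the coordinates `(d₁, d₂)`: the length
(one-dimensional Hausdorff measure) of the boundary of the projected polygon. -/
def perimeter {d : ℕ} (K : Set (Pt d)) (p : Fin d × Fin d) : ℝ≥0∞ :=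
  μH[1] (frontier (planeProj p '' K))

/-- The sum of the perimeters over all two-dimensional pairs. -/
def totalPerimeter {d : ℕ} (K : Set (Pt d)) : ℝ≥0∞ := ∑ p ∈ pairs d, perimeter K p

/-- The coordinate of `x` along the direction of angle `θ` in the plane of `(d₁, d₂)`. -/
def along {d : ℕ} (p : Fin d × Fin d) (θ : ℝ) (x : Pt d) : ℝ :=
  x p.1 * Real.cos θ + x p.2 * Real.sin θ

/-- The segment onto which `K` projects in the direction of angle `θ` in the plane of
`(d₁, d₂)`, parametrised by arc length. -/
def segment {d : ℕ} (K : Set (Pt d)) (p : Fin d × Fin d) (θ : ℝ) : Set ℝ := along p θ '' K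

/-- The data of one cut: the cost `c`, the pair `(d₁, d₂)`, the angle `θ` and the position `u` on
the segment of direction `θ`. The cutting hyperplane is `{x | along (d₁, d₂) θ x = u}`. -/
abbrev Draw (d : ℕ) : Type := ℝ × (Fin d × Fin d) × ℝ × ℝ

/-- The expectation of `F` at a random cut of the block `K`, sampled as follows: the cost is
exponential with rate the total perimeter of `K`; independently, the pair is chosen with
probability proportional to the perimeters; given the pair, the angle in `(0, π]` has density
proportional to the length of the segment of `K` in that direction; given the pair and the angle,
the position is uniform on that segment. -/
def cutMean {d : ℕ} (K : Set (Pt d)) (F : Draw d → ℝ≥0∞) : ℝ≥0∞ :=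
  ∫⁻ c, (∑ p ∈ pairs d, perimeter K p / totalPerimeter K *
    ∫⁻ θ in Ioc 0 Real.pi,
      (volume (segment K p θ) / (∫⁻ φ in Ioc 0 Real.pi, volume (segment K p φ))) *
        (⨍⁻ u in segment K p θ, F (c, p, θ, u) ∂volume) ∂volume)
  ∂(expMeasure (totalPerimeter K).toReal)

/-! ### The BSP-Tree process on the cube

A tree attaches a cut to every node. Nodes are words over `Bool`: the root is `[]`, the children of
`w` are `false :: w` and `true :: w`, so the ancestors of a node are its suffixes. All cuts are
present at infinite budget; a finite budget truncates the tree. -/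

/-- A hierarchical partition with unlimited budget: one cut for each node. -/
abbrev Tree (d : ℕ) : Type := List Bool → Draw d

/-- The two sides of a cutting hyperplane. -/
def side {d : ℕ} (c : Draw d) : Bool → Set (Pt d)
  | false => {x | along c.2.1 c.2.2.1 x ≤ c.2.2.2}
  | true => {x | c.2.2.2 < along c.2.1 c.2.2.1 x}

/-- The block of a node. -/
def block {d : ℕ} (T : Tree d) : List Bool → Set (Pt d)
  | [] => cube d
  | b :: w => block T w ∩ side (T w) b

/-- The law of the BSP-Tree process on the cube: given the cuts at all nodes other than `w` and the
descendants of `w`, the cut at `w` is distributed as a random cut of the block of `w`. -/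
structure IsBSPLaw {d : ℕ} (ν : Measure (Tree d)) : Prop where
  isProbabilityMeasure : IsProbabilityMeasure ν
  cut : ∀ (w : List Bool) (f : ({v : List Bool // ¬ w <:+ v} → Draw d) → Draw d → ℝ≥0∞),
    Measurable (Function.uncurry f) →
      ∫⁻ T, f (fun v => T v) (T w) ∂ν = ∫⁻ T, cutMean (block T w) (f fun v => T v) ∂ν

/-- The birth time of a node: the sum of the costs of the cuts at its proper ancestors. -/
def birth {d : ℕ} (T : Tree d) : List Bool → ℝ
  | [] => 0
  | _ :: w => birth T w + (T w).1

/-! ### The estimator -/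

/-- `n` labelled data points. -/
abbrev Data (d n : ℕ) : Type := Fin n → Pt d × ℝ

/-- The nodes that are present with budget `τ` when a block is cut only if it holds more than `m`
data points. -/
def IsNode {d n : ℕ} (T : Tree d) (τ : ℝ) (m : ℕ) (D : Data d n) : List Bool → Prop
  | [] => True
  | b :: w => IsNode T τ m D w ∧ birth T (b :: w) < τ ∧ m < {i | (D i).1 ∈ block T w}.ncard

/-- The leaf block that contains `x`: the intersection of the blocks of all nodes present whose
block contains `x`. -/
def leafBlock {d n : ℕ} (T : Tree d) (τ : ℝ) (m : ℕ) (D : Data d n) (x : Pt d) : Set (Pt d) :=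
  {y | y ∈ cube d ∧ ∀ w, IsNode T τ m D w → x ∈ block T w → y ∈ block T w}

/-- The mean of the labels of the data points in a block (`0` if there is none). -/
def labelMean {d n : ℕ} (D : Data d n) (A : Set (Pt d)) : ℝ :=
  (∑ i, A.indicator (fun _ => (D i).2) (D i).1) / ({i | (D i).1 ∈ A}.ncard : ℝ)

/-- The prediction of a forest of `M` trees at `x`: the average of the predictions of the trees. -/
def forestEstimate {d n M : ℕ} (T : Fin M → Tree d) (τ : ℝ) (m : ℕ) (D : Data d n) (x : Pt d) : ℝ :=
  (∑ k, labelMean D (leafBlock (T k) τ m D x)) / (M : ℝ)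

/-! ### The regression problem -/

/-- Functions that are `L`-Lipschitz on the cube for the Euclidean norm, and bounded there
by `B`. -/
def LipClass (d : ℕ) (L : ℝ≥0) (B : ℝ) : Set (Pt d → ℝ) :=
  {g | LipschitzOnWith L g (cube d) ∧ ∀ x ∈ cube d, |g x| ≤ B}

/-- Features with law `μ` on the cube; given the feature `x`, the label has law `κ x`, with mean
`g x` and variance at most `σ ^ 2`. -/
structure IsRegressionModel {d : ℕ} (μ : Measure (Pt d)) (κ : Kernel (Pt d) ℝ) (g : Pt d → ℝ)
    (σ : ℝ≥0) : Prop where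
  isProbabilityMeasure : IsProbabilityMeasure μ
  isMarkovKernel : IsMarkovKernel κ
  mem_cube : ∀ᵐ x ∂μ, x ∈ cube d
  memLp : ∀ x ∈ cube d, MemLp id 2 (κ x)
  mean : ∀ x ∈ cube d, ∫ y, y ∂(κ x) = g x
  variance_le : ∀ x ∈ cube d, Var[id; κ x] ≤ (σ : ℝ) ^ 2

/-- The mean squared error, as an estimator of `g`, of `φ` computed from `n` independent data points
with law `P`, at an independent test point with the law of the features. -/
def mse {d : ℕ} (P : Measure (Pt d × ℝ)) (g : Pt d → ℝ) (n : ℕ) (φ : Data d n → Pt d → ℝ) :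
    ℝ≥0∞ :=
  ∫⁻ x, (∫⁻ D, ENNReal.ofReal ((g x - φ D x) ^ 2) ∂(Measure.pi fun _ : Fin n => P))
    ∂(P.map Prod.fst)

/-- The law of `(x, g x + ε)` with `x` uniform on the cube and independent noise
`ε ∼ N(0, σ ^ 2)`. -/
def gaussianModel {d : ℕ} (g : Pt d → ℝ) (σ : ℝ≥0) : Measure (Pt d × ℝ) :=
  ((volume.restrict (cube d)).prod (gaussianReal 0 (σ ^ 2))).map fun z => (z.1, g z.1 + z.2)

end BSP

end

noncomputable section

namespace BSP

/-! ### Planar convex geometry -/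

/-! (a) Given the trees and the features, the error at `x` splits into a squared bias, at most `L ^
2` times the squared radius of the cell of `x` (measured over the data points in it), and a variance
of order one over the number of data points in the cell. It is enough that the mean squared radius
is `O(τ ^ (-2))` and the mean inverse count is `O(τ ^ d / n)`; at `τ ≍ n ^ (1 / (d + 2))` both are
of order `n ^ (-2 / (d + 2))`.

Both estimates come from one growth principle. Cuts of a block `K` arrive at rate `totalPerimeter
K`, with positions spread over hyperplanes by the measure behind `cutRate`. If the mean rate at
which splitting changes a set function `G` is at most `l * G`, then the mean of the sum of `G` over
the leaves at time `τ` is at most `exp (l * τ)` times its value on the cube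
(`lintegral_tsum_leafSum_le`). It is applied twice. For `G = touch J` with `J` of coordinate
diameter `δ`, only cuts close to `J` matter and `l` is of order `δ`; covering the cube by about `τ ^
d` cubes of side at most `1 / τ` shows that finitely many points occupy `O(τ ^ d)` cells on average.
For `G = joins x J` with `J` in a cone at distance `r` from `x`, cuts in a fixed range of directions
separate `x` from all of `J` at once, so `l` is negative of order `r`; hence the radius of the cell
has an exponential tail on the scale `1 / τ`, with constants free of the number of points. The
geometric input is that perimeter and integrated width of a planar convex set are comparable
(`perimeter_le_widthIntegral`, `widthIntegral_le`).

The occupied cells control the inverse count by exchangeability: test point and data form `n + 1`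
i.i.d. points, and the sum over these points of one over the population of their cell is the number
of occupied cells (`lintegral_inv_cellCount_le`). No regularity of `μ` enters. Stopping at `m`
points costs only a factor depending on `m`, because a block stopped early holds at most `m` points
(`leafBlock_small_or_sameCell`). A forest is at most as bad as its average tree, by convexity.

(b) Put bumps of height about `1 / k`, with arbitrary signs, on a grid of `k ^ d` cubes with `k ≍ n
^ (1 / (d + 2))`. Changing one sign moves the regression function by `O(k ^ (-(d + 2)))` in squared
`L²` norm, which `n` Gaussian observations cannot detect (`two_point_gaussian_le`). Averaging over
all signs, any estimator errs by the order of the bump height at a typical point (`le_sum_mse`). -/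

/-- A convex set without interior lies in a proper affine subspace, which is closed and so contains
the closure as well. This makes every frontier point a limit of points outside the closure. -/
lemma interior_closure_subset_of_convex {E : Type*} [NormedAddCommGroup E] [NormedSpace ℝ E]
    [FiniteDimensional ℝ E] {P : Set E} (hP : Convex ℝ P) : interior (closure P) ⊆ P := by
  by_cases h : (interior P).Nonempty
  · rw [hP.interior_closure_eq_interior_of_nonempty_interior h]
    exact interior_subset
  · have hs : affineSpan ℝ P ≠ ⊤ := fun h' => h (hP.interior_nonempty_iff_affineSpan_eq_top.2 h')
    have hc : closure P ⊆ (affineSpan ℝ P : Set E) :=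
      closure_minimal (subset_affineSpan ℝ P) (affineSpan ℝ P).closed_of_finiteDimensional
    intro x hx
    exfalso
    apply hs
    have h1 : affineSpan ℝ (closure P) = ⊤ :=
      hP.closure.interior_nonempty_iff_affineSpan_eq_top.1 ⟨x, hx⟩
    rw [eq_top_iff, ← h1]
    exact affineSpan_le.2 hc

/-- The hypotheses are the obtuse-angle conditions at nearest points `p`, `q` of `a`, `b` in a
convex set. Adding them gives `‖p - q‖ ^ 2 ≤ ⟪a - b, p - q⟫`, so nearest-point projection is
1-Lipschitz; the case `a = b` gives uniqueness. -/
lemma inner_le_zero_of_nearest {E : Type*} [NormedAddCommGroup E] [InnerProductSpace ℝ E]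
    {p q a b : E} (h1 : inner ℝ (a - p) (q - p) ≤ 0) (h2 : inner ℝ (b - q) (p - q) ≤ 0) :
    dist p q ≤ dist a b := by
  rw [dist_eq_norm, dist_eq_norm]
  have h3 : ‖p - q‖ * ‖p - q‖ ≤ inner ℝ (a - b) (p - q) := by
    rw [← real_inner_self_eq_norm_mul_norm]
    have e1 : q - p = -(p - q) := by abel
    have e2 : a - p = (a - b) + (b - q) - (p - q) := by abel
    rw [e1, e2, inner_neg_right, inner_sub_left, inner_add_left] at h1
    linarith
  have h4 := h3.trans (real_inner_le_norm _ _)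
  rcases eq_or_lt_of_le (norm_nonneg (p - q)) with h | h
  · rw [← h]; exact norm_nonneg _
  · exact le_of_mul_le_mul_right h4 h

lemma exists_nearest {E : Type*} [NormedAddCommGroup E] [InnerProductSpace ℝ E] [CompleteSpace E]
    {C : Set E} (hc : IsClosed C) (hC : Convex ℝ C) (hne : C.Nonempty) :
    ∃ f : E → E, ∀ a, f a ∈ C ∧ ∀ y ∈ C, inner ℝ (a - f a) (y - f a) ≤ 0 := by
  choose f hf using fun a => exists_norm_eq_iInf_of_complete_convex hne hc.isComplete hC a
  exact ⟨f, fun a => ⟨(hf a).1, (norm_eq_iInf_iff_real_inner_le_zero hC (hf a).1).1 (hf a).2⟩⟩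

/-- The point of the plane at distance `R` from `c` in direction `φ`. -/
def circlePt (c : EuclideanSpace ℝ (Fin 2)) (R φ : ℝ) : EuclideanSpace ℝ (Fin 2) :=
  c + R • !₂[Real.cos φ, Real.sin φ]

lemma dist_circlePt_le (c : EuclideanSpace ℝ (Fin 2)) {R : ℝ} (hR : 0 ≤ R) (φ ψ : ℝ) :
    dist (circlePt c R φ) (circlePt c R ψ) ≤ R * dist φ ψ := by
  rw [circlePt, circlePt, dist_add_left, dist_eq_norm, ← smul_sub, norm_smul, Real.norm_eq_abs,
    abs_of_nonneg hR]
  refine mul_le_mul_of_nonneg_left ?_ hR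
  rw [EuclideanSpace.norm_eq, Real.dist_eq]
  apply Real.sqrt_le_iff.2 ⟨abs_nonneg _, ?_⟩
  rw [sq_abs]
  simp only [Fin.sum_univ_two, PiLp.sub_apply, Real.norm_eq_abs, sq_abs]
  have h1 : (Real.cos φ - Real.cos ψ) ^ 2 + (Real.sin φ - Real.sin ψ) ^ 2
      = 2 - 2 * Real.cos (φ - ψ) := by
    rw [Real.cos_sub]
    nlinarith [Real.sin_sq_add_cos_sq φ, Real.sin_sq_add_cos_sq ψ]
  have h2 := Real.one_sub_sq_div_two_le_cos (x := φ - ψ)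
  simp
  linarith

lemma exists_circlePt {c z : EuclideanSpace ℝ (Fin 2)} {R : ℝ} (h : dist z c = R) :
    ∃ φ ∈ Icc (-Real.pi) Real.pi, circlePt c R φ = z := by
  set w : ℂ := ⟨z 0 - c 0, z 1 - c 1⟩ with hw
  have hn : ‖w‖ = R := by
    rw [← h, EuclideanSpace.dist_eq, Complex.norm_eq_sqrt_sq_add_sq]
    simp [hw, Real.dist_eq]
  refine ⟨w.arg, ⟨(Complex.neg_pi_lt_arg w).le, Complex.arg_le_pi w⟩, ?_⟩
  have h1 := Complex.norm_mul_cos_arg w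
  have h2 := Complex.norm_mul_sin_arg w
  rw [hn] at h1 h2
  ext i
  fin_cases i
  · simp [circlePt, h1]; simp [hw]
  · simp [circlePt, h2]; simp [hw]

/-- Nearest-point projection onto the closure is 1-Lipschitz and maps the surrounding circle onto a
set that covers the frontier, so the frontier is no longer than the circle. -/
lemma hausdorff_frontier_le {P : Set (EuclideanSpace ℝ (Fin 2))} (hP : Convex ℝ P)
    {c : EuclideanSpace ℝ (Fin 2)} {R : ℝ} (hR : 0 ≤ R) (hPR : P ⊆ Metric.closedBall c R) :
    μH[1] (frontier P) ≤ ENNReal.ofReal (2 * Real.pi * R) := by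
  rcases P.eq_empty_or_nonempty with rfl | hne
  · simp
  obtain ⟨f, hf⟩ := exists_nearest isClosed_closure hP.closure hne.closure
  have hlip : ∀ a b, dist (f a) (f b) ≤ dist a b := fun a b =>
    inner_le_zero_of_nearest ((hf a).2 _ (hf b).1) ((hf b).2 _ (hf a).1)
  set F : ℝ → EuclideanSpace ℝ (Fin 2) := fun φ => f (circlePt c R φ) with hF
  have hFL : LipschitzWith R.toNNReal F := LipschitzWith.of_dist_le_mul fun φ ψ => by
    rw [Real.coe_toNNReal _ hR]
    exact (hlip _ _).trans (dist_circlePt_le c hR φ ψ)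
  have hfc : Continuous f := (LipschitzWith.of_dist_le_mul (K := 1) fun a b => by
    simpa using hlip a b).continuous
  have hcompact : IsCompact (F '' Icc (-Real.pi) Real.pi) := isCompact_Icc.image hFL.continuous
  have hout : ∀ z, z ∉ closure P → f z ∈ F '' Icc (-Real.pi) Real.pi := by
    intro z hz
    have hpz : f z ∈ closure P := (hf z).1
    have hne' : z - f z ≠ 0 := fun h => hz (by rw [sub_eq_zero.1 h]; exact hpz)
    have hball : dist (f z) c ≤ R :=
      Metric.mem_closedBall.1 (closure_minimal hPR Metric.isClosed_closedBall hpz)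
    -- All points of the outward ray from `f z` through `z` have nearest point `f z`, and the ray
    -- meets the circle.
    set γ : ℝ → ℝ := fun t => dist (f z + t • (z - f z)) c with hγ
    have hγc : Continuous γ := by fun_prop
    obtain ⟨T, hT0, hT⟩ : ∃ T : ℝ, 0 ≤ T ∧ R ≤ γ T := by
      refine ⟨(R + dist (f z) c) / ‖z - f z‖, by positivity, ?_⟩
      have h1 : dist (f z + ((R + dist (f z) c) / ‖z - f z‖) • (z - f z)) (f z)
          = R + dist (f z) c := by
        rw [dist_eq_norm, add_sub_cancel_left, norm_smul, Real.norm_of_nonneg (by positivity),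
          div_mul_cancel₀ _ (norm_ne_zero_iff.2 hne')]
      have h2 := dist_triangle (f z + ((R + dist (f z) c) / ‖z - f z‖) • (z - f z)) c (f z)
      rw [dist_comm c] at h2
      simp only [hγ]
      linarith
    obtain ⟨t, ht, hγt⟩ := intermediate_value_Icc hT0 hγc.continuousOn
      (show R ∈ Icc (γ 0) (γ T) from ⟨by simpa [hγ] using hball, hT⟩)
    obtain ⟨φ, hφ, hcp⟩ := exists_circlePt hγt
    refine ⟨φ, hφ, ?_⟩
    simp only [hF, hcp]
    set q := f z + t • (z - f z) with hq
    have h1 : inner ℝ (q - f z) (f q - f z) ≤ 0 := by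
      rw [hq, add_sub_cancel_left, real_inner_smul_left]
      exact mul_nonpos_of_nonneg_of_nonpos ht.1 ((hf z).2 _ (hf q).1)
    have h2 := inner_le_zero_of_nearest h1 ((hf q).2 _ (hf z).1) (b := q)
    rw [dist_self] at h2
    exact (dist_le_zero.1 h2).symm
  have hsub : frontier P ⊆ F '' Icc (-Real.pi) Real.pi := by
    intro z hz
    have hz1 : z ∈ closure P := frontier_subset_closure hz
    have hz2 : z ∈ closure (closure P)ᶜ := by
      rw [closure_compl]
      intro hz3
      have h4 : z ∈ interior P :=
        interior_maximal (interior_closure_subset_of_convex hP) isOpen_interior hz3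
      exact hz.2 h4
    have hfz : f z = z := by
      have h1 : inner ℝ (z - z) (f z - z) ≤ (0 : ℝ) := by simp
      have := inner_le_zero_of_nearest h1 ((hf z).2 _ hz1) (b := z)
      rw [dist_self] at this
      exact (dist_le_zero.1 this).symm
    rw [← hfz]
    have hmem : (closure P)ᶜ ⊆ f ⁻¹' (F '' Icc (-Real.pi) Real.pi) := fun y hy => hout y hy
    exact closure_minimal hmem (hcompact.isClosed.preimage hfc) hz2
  calc μH[1] (frontier P) ≤ μH[1] (F '' Icc (-Real.pi) Real.pi) := measure_mono hsub
    _ ≤ (R.toNNReal : ℝ≥0∞) ^ (1 : ℝ) * μH[1] (Icc (-Real.pi) Real.pi) :=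
      hFL.hausdorffMeasure_image_le zero_le_one _
    _ = ENNReal.ofReal (2 * Real.pi * R) := by
      rw [ENNReal.rpow_one, hausdorffMeasure_real, Real.volume_Icc, ← ENNReal.ofReal.eq_1,
        ← ENNReal.ofReal_mul hR]
      congr 1
      ring

/-- The linear functional with unit gradient in direction `θ`. -/
def dirCoord (θ : ℝ) (z : EuclideanSpace ℝ (Fin 2)) : ℝ := z 0 * Real.cos θ + z 1 * Real.sin θ

lemma dirCoord_planeProj {d : ℕ} (p : Fin d × Fin d) (θ : ℝ) (x : Pt d) :
    dirCoord θ (planeProj p x) = along p θ x := by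
  simp [dirCoord, planeProj, along]

lemma lipschitzWith_dirCoord (θ : ℝ) : LipschitzWith 1 (dirCoord θ) := by
  refine LipschitzWith.of_dist_le_mul fun x y => ?_
  rw [NNReal.coe_one, one_mul, Real.dist_eq, EuclideanSpace.dist_eq]
  apply Real.le_sqrt_of_sq_le
  simp only [Fin.sum_univ_two, Real.dist_eq, sq_abs, dirCoord]
  nlinarith [sq_nonneg ((x 0 - y 0) * Real.sin θ - (x 1 - y 1) * Real.cos θ),
    Real.sin_sq_add_cos_sq θ]

/-- The line through a point of `P` perpendicular to direction `θ` must leave the bounded set `P`.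
It crosses the frontier, and `dirCoord θ` is constant along it. -/
lemma dirCoord_image_subset_frontier {P : Set (EuclideanSpace ℝ (Fin 2))}
    (hP : Bornology.IsBounded P) (θ : ℝ) : dirCoord θ '' P ⊆ dirCoord θ '' frontier P := by
  rintro _ ⟨q, hq, rfl⟩
  set e : EuclideanSpace ℝ (Fin 2) := !₂[-Real.sin θ, Real.cos θ] with he
  have hen : ‖e‖ = 1 := by
    rw [EuclideanSpace.norm_eq]
    simp [he]
  set γ : ℝ → EuclideanSpace ℝ (Fin 2) := fun t => q + t • e with hγ
  have hγc : Continuous γ := by fun_prop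
  have hne : γ ⁻¹' P ≠ univ := by
    intro h
    obtain ⟨R, hR⟩ := hP.subset_closedBall q
    have h1 : γ (|R| + 1) ∈ P := by
      have : (|R| + 1) ∈ γ ⁻¹' P := by rw [h]; trivial
      exact this
    have h2 := Metric.mem_closedBall.1 (hR h1)
    rw [hγ, dist_eq_norm, add_sub_cancel_left, norm_smul, hen,
      Real.norm_of_nonneg (by positivity)] at h2
    linarith [le_abs_self R]
  obtain ⟨t, ht⟩ := nonempty_frontier_iff.2 ⟨⟨0, by simpa [hγ] using hq⟩, hne⟩
  refine ⟨γ t, hγc.frontier_preimage_subset _ ht, ?_⟩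
  simp [hγ, dirCoord, he]
  ring

lemma planeProj_isLinearMap {d : ℕ} (p : Fin d × Fin d) :
    IsLinearMap ℝ (planeProj p : Pt d → EuclideanSpace ℝ (Fin 2)) := by
  constructor
  · intro x y; ext i; fin_cases i <;> simp [planeProj]
  · intro c x; ext i; fin_cases i <;> simp [planeProj]

lemma segment_eq {d : ℕ} (K : Set (Pt d)) (p : Fin d × Fin d) (θ : ℝ) :
    segment K p θ = dirCoord θ '' (planeProj p '' K) := by
  rw [segment, image_image]
  exact image_congr fun x _ => (dirCoord_planeProj p θ x).symm

lemma planeProj_mem_closedBall {d : ℕ} {p : Fin d × Fin d} {x : Pt d} (hx : x ∈ cube d) :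
    planeProj p x ∈ Metric.closedBall (0 : EuclideanSpace ℝ (Fin 2)) 2 := by
  rw [mem_closedBall_zero_iff, EuclideanSpace.norm_eq]
  apply Real.sqrt_le_iff.2 ⟨by norm_num, ?_⟩
  have h1 := hx p.1
  have h2 := hx p.2
  simp [planeProj]
  nlinarith [h1.1, h1.2, h2.1, h2.2]

lemma volume_segment_le_perimeter {d : ℕ} {K : Set (Pt d)} (hK : K ⊆ cube d) (p : Fin d × Fin d)
    (θ : ℝ) : volume (segment K p θ) ≤ perimeter K p := by
  have hb : Bornology.IsBounded (planeProj p '' K) :=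
    Metric.isBounded_closedBall.subset
      (image_subset_iff.2 fun x hx => planeProj_mem_closedBall (hK hx))
  rw [segment_eq, perimeter, ← hausdorffMeasure_real]
  refine (measure_mono (dirCoord_image_subset_frontier hb θ)).trans ?_
  simpa using (lipschitzWith_dirCoord θ).hausdorffMeasure_image_le zero_le_one
    (frontier (planeProj p '' K))

/-- The integral of the lengths of the segments of `K` over all directions. -/
def widthIntegral {d : ℕ} (K : Set (Pt d)) (p : Fin d × Fin d) : ℝ≥0∞ :=
  ∫⁻ φ in Ioc 0 Real.pi, volume (segment K p φ)

lemma perimeter_le_const {d : ℕ} {K : Set (Pt d)} (hK : K ⊆ cube d) (hc : Convex ℝ K)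
    (p : Fin d × Fin d) : perimeter K p ≤ ENNReal.ofReal (4 * Real.pi) := by
  have h := hausdorff_frontier_le (hc.is_linear_image (planeProj_isLinearMap p)) (c := 0) (R := 2)
    (by norm_num) (image_subset_iff.2 fun x hx => planeProj_mem_closedBall (hK hx))
  refine h.trans (le_of_eq ?_)
  congr 1; ring

lemma widthIntegral_le {d : ℕ} {K : Set (Pt d)} (hK : K ⊆ cube d) (p : Fin d × Fin d) :
    widthIntegral K p ≤ ENNReal.ofReal Real.pi * perimeter K p := by
  calc widthIntegral K p ≤ ∫⁻ _ in Ioc 0 Real.pi, perimeter K p :=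
        lintegral_mono fun θ => volume_segment_le_perimeter hK p θ
    _ = ENNReal.ofReal Real.pi * perimeter K p := by
      rw [setLIntegral_const, Real.volume_Ioc, sub_zero, mul_comm]

lemma along_isLinearMap {d : ℕ} (p : Fin d × Fin d) (θ : ℝ) :
    IsLinearMap ℝ (along p θ : Pt d → ℝ) := by
  constructor
  · intro x y; simp [along]; ring
  · intro c x; simp [along]; ring

lemma ordConnected_segment {d : ℕ} {K : Set (Pt d)} (hc : Convex ℝ K) (p : Fin d × Fin d)
    (θ : ℝ) : (segment K p θ).OrdConnected :=
  (hc.is_linear_image (along_isLinearMap p θ)).ordConnected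

lemma ofReal_abs_along_sub_le {d : ℕ} {K : Set (Pt d)} (hc : Convex ℝ K) {x y : Pt d} (hx : x ∈ K)
    (hy : y ∈ K) (p : Fin d × Fin d) (θ : ℝ) :
    ENNReal.ofReal |along p θ x - along p θ y| ≤ volume (segment K p θ) := by
  have := (ordConnected_segment hc p θ).uIcc_subset (mem_image_of_mem (along p θ) hy)
    (mem_image_of_mem (along p θ) hx)
  refine le_trans (le_of_eq ?_) (measure_mono this)
  rw [uIcc, Real.volume_Icc, max_sub_min_eq_abs]

lemma integral_sq_cos_sin (a b : ℝ) :
    ∫ θ in (0 : ℝ)..Real.pi, (a * Real.cos θ + b * Real.sin θ) ^ 2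
      = (a ^ 2 + b ^ 2) * (Real.pi / 2) := by
  have h : ∀ θ : ℝ, (a * Real.cos θ + b * Real.sin θ) ^ 2
      = a ^ 2 * Real.cos θ ^ 2 + 2 * a * b * (Real.sin θ * Real.cos θ)
        + b ^ 2 * Real.sin θ ^ 2 := fun θ => by ring
  simp_rw [h]
  rw [intervalIntegral.integral_add, intervalIntegral.integral_add,
    intervalIntegral.integral_const_mul, intervalIntegral.integral_const_mul,
    intervalIntegral.integral_const_mul, integral_cos_sq, integral_sin_sq, integral_sin_mul_cos₁]
  · simp; ring
  all_goals exact Continuous.intervalIntegrable (by fun_prop) _ _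

/-- The shadow of the segment between the two projected points has length at most `r`, so it is at
least its square divided by `r`. The square is a trigonometric polynomial with integral `r ^ 2 * π /
2`. -/
lemma dist_planeProj_le_widthIntegral {d : ℕ} {K : Set (Pt d)} (hc : Convex ℝ K) {x y : Pt d}
    (hx : x ∈ K) (hy : y ∈ K) (p : Fin d × Fin d) :
    ENNReal.ofReal (Real.pi / 2 * dist (planeProj p x) (planeProj p y)) ≤ widthIntegral K p := by
  set a := x p.1 - y p.1 with ha
  set b := x p.2 - y p.2 with hb
  set r := dist (planeProj p x) (planeProj p y) with hr
  have hr2 : r ^ 2 = a ^ 2 + b ^ 2 := by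
    rw [hr, EuclideanSpace.dist_eq, Real.sq_sqrt (by positivity)]
    simp [planeProj, Real.dist_eq, ha, hb]
  rcases eq_or_lt_of_le (show 0 ≤ r from dist_nonneg) with h0 | h0
  · rw [← h0]; simp
  have key : ∀ θ, (a * Real.cos θ + b * Real.sin θ) ^ 2 / r ≤ |along p θ x - along p θ y| := by
    intro θ
    have e : along p θ x - along p θ y = a * Real.cos θ + b * Real.sin θ := by
      simp only [along, ha, hb]; ring
    rw [e, div_le_iff₀ h0, ← sq_abs, sq]
    refine mul_le_mul_of_nonneg_left ?_ (abs_nonneg _)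
    apply abs_le_of_sq_le_sq _ h0.le
    rw [hr2]
    nlinarith [sq_nonneg (a * Real.sin θ - b * Real.cos θ), Real.sin_sq_add_cos_sq θ]
  calc ENNReal.ofReal (Real.pi / 2 * r)
      = ENNReal.ofReal (∫ θ in Ioc 0 Real.pi, (a * Real.cos θ + b * Real.sin θ) ^ 2 / r) := by
        rw [← intervalIntegral.integral_of_le Real.pi_pos.le, intervalIntegral.integral_div,
          integral_sq_cos_sin, ← hr2]
        congr 1; field_simp
    _ = ∫⁻ θ in Ioc 0 Real.pi, ENNReal.ofReal ((a * Real.cos θ + b * Real.sin θ) ^ 2 / r) := by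
        rw [ofReal_integral_eq_lintegral_ofReal]
        · exact (Continuous.integrableOn_Icc (by fun_prop)).mono_set Ioc_subset_Icc_self
        · exact Eventually.of_forall fun θ => by positivity
    _ ≤ widthIntegral K p := lintegral_mono fun θ =>
        (ENNReal.ofReal_le_ofReal (key θ)).trans (ofReal_abs_along_sub_le hc hx hy p θ)

/-- The projection lies in a disc of radius `2 / π * W` around any of its points, and the
circumference of that disc is `4 * W`. -/
lemma perimeter_le_widthIntegral {d : ℕ} {K : Set (Pt d)} (hc : Convex ℝ K) (p : Fin d × Fin d) :
    perimeter K p ≤ 4 * widthIntegral K p := by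
  by_cases hW : widthIntegral K p = ∞
  · rw [hW]; simp
  rcases K.eq_empty_or_nonempty with rfl | ⟨x, hx⟩
  · simp [perimeter]
  set W := (widthIntegral K p).toReal with hWdef
  have hsub : planeProj p '' K ⊆ Metric.closedBall (planeProj p x) (2 / Real.pi * W) := by
    rintro _ ⟨y, hy, rfl⟩
    have h1 := dist_planeProj_le_widthIntegral hc hy hx p
    rw [← ENNReal.ofReal_toReal hW, ENNReal.ofReal_le_ofReal_iff ENNReal.toReal_nonneg,
      ← hWdef] at h1
    rw [Metric.mem_closedBall]
    have := Real.pi_pos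
    calc dist (planeProj p y) (planeProj p x)
        = 2 / Real.pi * (Real.pi / 2 * dist (planeProj p y) (planeProj p x)) := by field_simp
      _ ≤ _ := by gcongr
  have h := hausdorff_frontier_le (hc.is_linear_image (planeProj_isLinearMap p))
    (by positivity) hsub
  refine h.trans (le_of_eq ?_)
  have e : 2 * Real.pi * (2 / Real.pi * W) = 4 * W := by field_simp; ring
  rw [e, ENNReal.ofReal_mul (by norm_num), hWdef, ENNReal.ofReal_toReal hW]
  norm_num

end BSP

end

noncomputable section

namespace BSP

/-! ### Bounds on the mean over one cut -/

/-- Integral of `H` against the unnormalised law of the position of a cut of `K`. -/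
def cutRate {d : ℕ} (K : Set (Pt d)) (H : (Fin d × Fin d) × ℝ × ℝ → ℝ≥0∞) : ℝ≥0∞ :=
  ∑ p ∈ pairs d, perimeter K p * ((widthIntegral K p)⁻¹ *
    ∫⁻ θ in Ioc 0 Real.pi, ∫⁻ u in segment K p θ, H (p, θ, u))

/-- The sum of `G` over the two parts into which a cut divides `K`. -/
def splitSum {d : ℕ} (G : Set (Pt d) → ℝ≥0∞) (K : Set (Pt d))
    (q : (Fin d × Fin d) × ℝ × ℝ) : ℝ≥0∞ :=
  G (K ∩ side (0, q) false) + G (K ∩ side (0, q) true)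

lemma side_eq {d : ℕ} (c : Draw d) (b : Bool) : side c b = side (0, c.2) b := by
  cases b <;> rfl

lemma splitSum_eq {d : ℕ} (G : Set (Pt d) → ℝ≥0∞) (K : Set (Pt d)) (c : Draw d) :
    splitSum G K c.2 = G (K ∩ side c false) + G (K ∩ side c true) := by
  rw [splitSum, side_eq c, side_eq c]

/-- An upper bound for the total perimeter of a block. -/
def maxRate (d : ℕ) : ℝ := (pairs d).card * (4 * Real.pi)

lemma maxRate_nonneg (d : ℕ) : 0 ≤ maxRate d := by
  have := Real.pi_pos
  unfold maxRate; positivity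

lemma totalPerimeter_le {d : ℕ} {K : Set (Pt d)} (hK : K ⊆ cube d) (hc : Convex ℝ K) :
    totalPerimeter K ≤ ENNReal.ofReal (maxRate d) := by
  calc totalPerimeter K ≤ ∑ _p ∈ pairs d, ENNReal.ofReal (4 * Real.pi) :=
        Finset.sum_le_sum fun p _ => perimeter_le_const hK hc p
    _ = _ := by
        rw [Finset.sum_const, nsmul_eq_mul, maxRate, ENNReal.ofReal_mul (by positivity)]
        simp

lemma totalPerimeter_ne_top {d : ℕ} {K : Set (Pt d)} (hK : K ⊆ cube d) (hc : Convex ℝ K) :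
    totalPerimeter K ≠ ∞ := ((totalPerimeter_le hK hc).trans_lt ENNReal.ofReal_lt_top).ne

/-- The length of the segment cancels between the density of the angle and the uniform law of the
position, which leaves the flat measure `dθ du`. There is only an inequality because the length may
be `0` or `∞`. When the integrated width vanishes so does the perimeter, which disposes of the
division by zero. -/
lemma perimeter_mul_cut_integral_le {d : ℕ} {K : Set (Pt d)} (hc : Convex ℝ K)
    (p : Fin d × Fin d) (F : ℝ → ℝ → ℝ≥0∞) :
    perimeter K p * ∫⁻ θ in Ioc 0 Real.pi, (volume (segment K p θ) / widthIntegral K p) *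
        (⨍⁻ u in segment K p θ, F θ u ∂volume)
      ≤ perimeter K p * ((widthIntegral K p)⁻¹ *
          ∫⁻ θ in Ioc 0 Real.pi, ∫⁻ u in segment K p θ, F θ u) := by
  by_cases hW : widthIntegral K p = 0
  · have : perimeter K p = 0 := by simpa [hW] using perimeter_le_widthIntegral hc p
    simp [this]
  · gcongr
    rw [← lintegral_const_mul' _ _ (ENNReal.inv_ne_top.2 hW)]
    refine lintegral_mono fun θ => ?_
    simp only
    rw [setLAverage_eq, div_eq_mul_inv, div_eq_mul_inv]
    calc volume (segment K p θ) * (widthIntegral K p)⁻¹ *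
          ((∫⁻ u in segment K p θ, F θ u) * (volume (segment K p θ))⁻¹)
        = (volume (segment K p θ) * (volume (segment K p θ))⁻¹) *
          ((widthIntegral K p)⁻¹ * ∫⁻ u in segment K p θ, F θ u) := by ring
      _ ≤ 1 * ((widthIntegral K p)⁻¹ * ∫⁻ u in segment K p θ, F θ u) := by
          gcongr
          exact ENNReal.mul_inv_le_one _
      _ = _ := one_mul _

lemma cutMean_mul_le {d : ℕ} {K : Set (Pt d)} (hc : Convex ℝ K) (F : Draw d → ℝ≥0∞)
    (a : ℝ → ℝ≥0∞) (ha : ∀ c, a c ≠ ∞) (H : ℝ → (Fin d × Fin d) × ℝ × ℝ → ℝ≥0∞)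
    (hF : ∀ c q, F (c, q) = a c * H c q) :
    cutMean K F ≤ ∫⁻ c, a c * (cutRate K (H c) / totalPerimeter K)
      ∂(expMeasure (totalPerimeter K).toReal) := by
  refine lintegral_mono fun c => ?_
  simp only
  calc _ = ∑ p ∈ pairs d, (totalPerimeter K)⁻¹ * (perimeter K p *
          ∫⁻ θ in Ioc 0 Real.pi, (volume (segment K p θ) / widthIntegral K p) *
        (⨍⁻ u in segment K p θ, F (c, p, θ, u) ∂volume)) :=
        Finset.sum_congr rfl fun p _ => by rw [div_eq_mul_inv, widthIntegral]; ring
    _ ≤ ∑ p ∈ pairs d, (totalPerimeter K)⁻¹ * (perimeter K p * ((widthIntegral K p)⁻¹ *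
          ∫⁻ θ in Ioc 0 Real.pi, ∫⁻ u in segment K p θ, F (c, p, θ, u))) :=
        Finset.sum_le_sum fun p _ => by
          exact mul_le_mul_right (perimeter_mul_cut_integral_le hc p fun θ u => F (c, p, θ, u)) _
    _ = _ := by
        rw [cutRate, div_eq_mul_inv, Finset.sum_mul, Finset.mul_sum]
        refine Finset.sum_congr rfl fun p _ => ?_
        simp_rw [hF, lintegral_const_mul' _ _ (ha c)]
        ring

lemma cutRate_const_le {d : ℕ} (K : Set (Pt d)) (a : ℝ≥0∞) :
    cutRate K (fun _ => a) ≤ a * totalPerimeter K := by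
  rw [cutRate, totalPerimeter, Finset.mul_sum]
  refine Finset.sum_le_sum fun p _ => ?_
  simp_rw [setLIntegral_const]
  by_cases ha : a = ∞
  · by_cases hL : perimeter K p = 0
    · simp [hL]
    · rw [ha, ENNReal.top_mul hL]; exact le_top
  · rw [lintegral_const_mul' _ _ ha]
    calc perimeter K p * ((widthIntegral K p)⁻¹ * (a * widthIntegral K p))
        = a * perimeter K p * (widthIntegral K p * (widthIntegral K p)⁻¹) := by ring
      _ ≤ a * perimeter K p * 1 := by gcongr; exact ENNReal.mul_inv_le_one _
      _ = _ := mul_one _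

lemma cutRate_mono {d : ℕ} {K : Set (Pt d)} {H H' : (Fin d × Fin d) × ℝ × ℝ → ℝ≥0∞}
    (h : ∀ q, H q ≤ H' q) : cutRate K H ≤ cutRate K H' := by
  unfold cutRate
  gcongr with p _ θ u
  exact h _

lemma lintegral_expMeasure_le (r : ℝ) {f : ℝ → ℝ≥0∞} (hf : Measurable f) :
    ∫⁻ c, f c ∂(expMeasure r) = ∫⁻ c, exponentialPDF r c * f c :=
  lintegral_withDensity_eq_lintegral_mul _
    (measurable_exponentialPDFReal r).ennreal_ofReal hf

lemma lintegral_exponentialPDF_Iio_le {r s : ℝ} (hr : 0 < r) (hs : 0 ≤ s) :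
    ∫⁻ c in Iio s, exponentialPDF r c ≤ ENNReal.ofReal (1 - Real.exp (-(r * s))) := by
  refine (lintegral_mono_set Iio_subset_Iic_self).trans ?_
  rw [lintegral_exponentialPDF_eq_antiDeriv hr, if_pos hs]

lemma lintegral_exponentialPDF_Ici {r s : ℝ} (hr : 0 < r) (hs : 0 ≤ s) :
    ∫⁻ c in Ici s, exponentialPDF r c = ENNReal.ofReal (Real.exp (-(r * s))) := by
  rw [← setLIntegral_congr Ioi_ae_eq_Ici]
  have h1 := lintegral_add_compl (exponentialPDF r) (measurableSet_Iic (a := s)) (μ := volume)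
  rw [lintegral_exponentialPDF_eq_one hr, lintegral_exponentialPDF_eq_antiDeriv hr, if_pos hs,
    compl_Iic] at h1
  have h2 : Real.exp (-(r * s)) ≤ 1 := Real.exp_le_one_iff.2 (by nlinarith)
  have h3 : (1 : ℝ≥0∞) = ENNReal.ofReal (1 - Real.exp (-(r * s)))
      + ENNReal.ofReal (Real.exp (-(r * s))) := by
    rw [← ENNReal.ofReal_add (by linarith) (Real.exp_pos _).le]; simp
  exact (ENNReal.add_right_inj ENNReal.ofReal_ne_top).1 (h1.trans h3)

/-- For a block of total perimeter `0` the measure `expMeasure 0` is zero, so this degenerate case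
drops out of the bounds. -/
lemma exponentialPDF_zero (c : ℝ) : exponentialPDF 0 c = 0 := by
  rw [exponentialPDF_eq]; simp

/-- The weight `exp (l * (s - c))` tilts the exponential law of rate `r` into `exp (l * s)` times
that of rate `r + l`. The survival term `exp (-(r * s))` is `exp (l * s)` times the survival
probability at rate `r + l`, so the two parts add up to `exp (l * s)`. -/
lemma lintegral_exp_tilt_le {r l s : ℝ} (hr : 0 ≤ r) (hs : 0 ≤ s) (hrl0 : 0 ≤ r + l) :
    (∫⁻ c in Iio s, exponentialPDF r c *
        (ENNReal.ofReal (Real.exp (l * (s - c))) * (ENNReal.ofReal (r + l) / ENNReal.ofReal r)))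
      + ∫⁻ c in Ici s, exponentialPDF r c ≤ ENNReal.ofReal (Real.exp (l * s)) := by
  rcases hr.eq_or_lt with rfl | hr
  · simp [exponentialPDF_zero]
  rw [lintegral_exponentialPDF_Ici hr hs]
  -- With `hrl0` this is the case `r + l = 0`: the first integral vanishes and the survival term
  -- alone is `exp (l * s)`.
  by_cases hrl : r + l ≤ 0
  · rw [ENNReal.ofReal_of_nonpos hrl]
    simp only [ENNReal.zero_div, mul_zero, lintegral_zero, zero_add]
    apply ENNReal.ofReal_le_ofReal
    apply Real.exp_le_exp.2
    nlinarith
  push Not at hrl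
  have h1 : ∀ c, exponentialPDF r c *
      (ENNReal.ofReal (Real.exp (l * (s - c))) * (ENNReal.ofReal (r + l) / ENNReal.ofReal r))
      = ENNReal.ofReal (Real.exp (l * s)) * exponentialPDF (r + l) c := by
    intro c
    rw [← ENNReal.ofReal_div_of_pos hr, ← ENNReal.ofReal_mul (Real.exp_pos _).le]
    rcases lt_or_ge c 0 with hc | hc
    · rw [exponentialPDF_of_neg hc, exponentialPDF_of_neg hc]; simp
    · rw [exponentialPDF_of_nonneg hc, exponentialPDF_of_nonneg hc,
        ← ENNReal.ofReal_mul (by positivity), ← ENNReal.ofReal_mul (by positivity)]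
      congr 1
      have e : Real.exp (-(r * c)) * Real.exp (l * (s - c))
          = Real.exp (l * s) * Real.exp (-((r + l) * c)) := by
        rw [← Real.exp_add, ← Real.exp_add]; ring_nf
      have e' : r * Real.exp (-(r * c)) * (Real.exp (l * (s - c)) * ((r + l) / r))
          = (r + l) * (Real.exp (-(r * c)) * Real.exp (l * (s - c))) := by field_simp
      rw [e', e]; ring
  simp_rw [h1]
  rw [lintegral_const_mul' _ _ ENNReal.ofReal_ne_top]
  calc _ ≤ ENNReal.ofReal (Real.exp (l * s)) * ENNReal.ofReal (1 - Real.exp (-((r + l) * s)))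
        + ENNReal.ofReal (Real.exp (-(r * s))) := by
        gcongr; exact lintegral_exponentialPDF_Iio_le hrl hs
    _ = _ := by
        have h2 : Real.exp (-((r + l) * s)) ≤ 1 := Real.exp_le_one_iff.2 (by nlinarith)
        rw [← ENNReal.ofReal_mul (Real.exp_pos _).le, ← ENNReal.ofReal_add
          (mul_nonneg (Real.exp_pos _).le (by linarith)) (Real.exp_pos _).le]
        congr 1
        have e : Real.exp (l * s) * Real.exp (-((r + l) * s)) = Real.exp (-(r * s)) := by
          rw [← Real.exp_add]; ring_nf
        linear_combination -e

/-- If the rate at which `G` changes by splitting is at most `l * G`, then splitting before the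
time `s` raises `G` by a factor of at most `exp (l * s)` on average. -/
lemma cutMean_growth_le {d : ℕ} {K : Set (Pt d)} (hK : K ⊆ cube d) (hc : Convex ℝ K)
    {G : Set (Pt d) → ℝ≥0∞} (hG : G K ≠ ∞) {l s : ℝ} (hs : 0 ≤ s)
    (hl : G K ≠ 0 → 0 ≤ (totalPerimeter K).toReal + l)
    (h : cutRate K (splitSum G K) ≤ ENNReal.ofReal ((totalPerimeter K).toReal + l) * G K) :
    cutMean K (fun c => if s ≤ c.1 then G K else
        ENNReal.ofReal (Real.exp (l * (s - c.1))) * splitSum G K c.2)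
      ≤ ENNReal.ofReal (Real.exp (l * s)) * G K := by
  classical
  set r := (totalPerimeter K).toReal with hr
  have hr0 : 0 ≤ r := ENNReal.toReal_nonneg
  have hΛ : totalPerimeter K = ENNReal.ofReal r :=
    (ENNReal.ofReal_toReal (totalPerimeter_ne_top hK hc)).symm
  refine (cutMean_mul_le hc _ (fun c => if s ≤ c then G K else
    ENNReal.ofReal (Real.exp (l * (s - c)))) (fun c => by split_ifs <;> simp [hG])
    (fun c q => if s ≤ c then 1 else splitSum G K q)
    (fun c q => by split_ifs <;> simp)).trans ?_
  rw [← hr, hΛ]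
  clear_value r
  set f : ℝ → ℝ≥0∞ := fun c => (if s ≤ c then 1 else ENNReal.ofReal (Real.exp (l * (s - c)))
    * (ENNReal.ofReal (r + l) / ENNReal.ofReal r)) * G K with hf
  have hfm : Measurable f := by
    refine Measurable.mul_const (Measurable.ite measurableSet_Ici measurable_const ?_) _
    fun_prop
  calc _ ≤ ∫⁻ c, f c ∂expMeasure r := by
        refine lintegral_mono fun c => ?_
        simp only [hf]
        split_ifs with hsc
        · rw [one_mul]
          calc G K * (cutRate K (fun _ => 1) / ENNReal.ofReal r) ≤ G K * 1 := by
                gcongr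
                apply ENNReal.div_le_of_le_mul
                rw [← hΛ]
                exact cutRate_const_le K 1
            _ = G K := mul_one _
        · calc ENNReal.ofReal (Real.exp (l * (s - c))) * (cutRate K (splitSum G K)
                / ENNReal.ofReal r) ≤ ENNReal.ofReal (Real.exp (l * (s - c))) *
                  (ENNReal.ofReal (r + l) * G K / ENNReal.ofReal r) := by gcongr
            _ = _ := by rw [div_eq_mul_inv, div_eq_mul_inv]; ring
    _ = ∫⁻ c, exponentialPDF r c * f c := lintegral_expMeasure_le r hfm
    _ = (∫⁻ c in Iio s, exponentialPDF r c * f c) + ∫⁻ c in Ici s, exponentialPDF r c * f c := by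
        rw [← compl_Iio, lintegral_add_compl _ measurableSet_Iio]
    _ = ((∫⁻ c in Iio s, exponentialPDF r c * (ENNReal.ofReal (Real.exp (l * (s - c))) *
          (ENNReal.ofReal (r + l) / ENNReal.ofReal r)))
          + ∫⁻ c in Ici s, exponentialPDF r c) * G K := by
        rw [add_mul, ← lintegral_mul_const' _ _ hG, ← lintegral_mul_const' _ _ hG]
        congr 1
        · refine setLIntegral_congr_fun measurableSet_Iio fun c hc' => ?_
          simp only [hf]
          rw [if_neg (not_le.2 hc'), mul_assoc, mul_assoc, mul_assoc]
        · refine setLIntegral_congr_fun measurableSet_Ici fun c hc' => ?_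
          simp only [hf]
          rw [if_pos (mem_Ici.1 hc'), one_mul]
    _ ≤ _ := by
        by_cases h0 : G K = 0
        · simp [h0]
        gcongr
        exact lintegral_exp_tilt_le hr0 hs (hl h0)

/-- The factor by which `exp (-time)` shrinks at each cut, on average. -/
def shrink (d : ℕ) : ℝ := maxRate d / (maxRate d + 1)

lemma shrink_nonneg (d : ℕ) : 0 ≤ shrink d := by
  have := maxRate_nonneg d
  unfold shrink; positivity

lemma shrink_lt_one (d : ℕ) : shrink d < 1 := by
  have := maxRate_nonneg d
  rw [shrink, div_lt_one (by linarith)]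
  linarith

/-- An exponential cost of rate `r` satisfies `E[exp (-c)] = r / (r + 1)`, which increases with `r`,
and `r ≤ maxRate d`. This gives geometric decay in the depth, hence termination. -/
lemma cutMean_shrink_le {d : ℕ} {K : Set (Pt d)} (hK : K ⊆ cube d) (hc : Convex ℝ K)
    {G : Set (Pt d) → ℝ≥0∞} (hG : G K ≠ ∞) {s : ℝ}
    (h : ∀ q, splitSum G K q ≤ G K) :
    cutMean K (fun c => ENNReal.ofReal (Real.exp (s - c.1)) * splitSum G K c.2)
      ≤ ENNReal.ofReal (shrink d) * (ENNReal.ofReal (Real.exp s) * G K) := by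
  set r := (totalPerimeter K).toReal with hr
  have hr0 : 0 ≤ r := ENNReal.toReal_nonneg
  have hΛ : totalPerimeter K = ENNReal.ofReal r :=
    (ENNReal.ofReal_toReal (totalPerimeter_ne_top hK hc)).symm
  refine (cutMean_mul_le hc _ (fun c => ENNReal.ofReal (Real.exp (s - c)))
    (fun c => ENNReal.ofReal_ne_top) (fun _ q => splitSum G K q) (fun c q => rfl)).trans ?_
  have h1 : cutRate K (splitSum G K) / totalPerimeter K ≤ G K := by
    apply ENNReal.div_le_of_le_mul
    exact (cutRate_mono h).trans (cutRate_const_le K _)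
  have hrm : r ≤ maxRate d := by
    have := totalPerimeter_le hK hc
    rwa [hΛ, ENNReal.ofReal_le_ofReal_iff (maxRate_nonneg d)] at this
  have h2 : ∀ c, exponentialPDF r c * (ENNReal.ofReal (Real.exp (s - c)) * G K)
      = ENNReal.ofReal (r / (r + 1) * Real.exp s) * G K * exponentialPDF (r + 1) c := by
    intro c
    rcases lt_or_ge c 0 with hc | hc
    · rw [exponentialPDF_of_neg hc, exponentialPDF_of_neg hc]; simp
    · rw [exponentialPDF_of_nonneg hc, exponentialPDF_of_nonneg hc, mul_right_comm _ (G K),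
        ← ENNReal.ofReal_mul (by positivity), ← mul_assoc, ← ENNReal.ofReal_mul (by positivity)]
      congr 2
      have e : Real.exp (-(r * c)) * Real.exp (s - c)
          = Real.exp s * Real.exp (-((r + 1) * c)) := by
        rw [← Real.exp_add, ← Real.exp_add]; ring_nf
      have e' : r * Real.exp (-(r * c)) * Real.exp (s - c)
          = r * (Real.exp (-(r * c)) * Real.exp (s - c)) := by ring
      rw [e', e]; field_simp
  calc _ ≤ ∫⁻ c, ENNReal.ofReal (Real.exp (s - c)) * G K ∂expMeasure r := by
        refine lintegral_mono fun c => ?_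
        simp only
        gcongr
    _ = ENNReal.ofReal (r / (r + 1) * Real.exp s) * G K := by
        rw [lintegral_expMeasure_le r (by fun_prop)]
        simp_rw [h2]
        rw [lintegral_const_mul' _ _ (ENNReal.mul_ne_top ENNReal.ofReal_ne_top hG),
          lintegral_exponentialPDF_eq_one (by linarith), mul_one]
    _ ≤ _ := by
        rw [← mul_assoc, ← ENNReal.ofReal_mul (shrink_nonneg d)]
        gcongr
        rw [shrink, div_le_div_iff₀ (by linarith) (by linarith)]
        nlinarith

end BSP

end

noncomputable section

namespace BSP

/-! ### Blocks: convexity and measurability -/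

lemma convex_cube (d : ℕ) : Convex ℝ (cube d) := by
  intro x hx y hy a b ha hb hab i
  exact (convex_Icc (0 : ℝ) 1) (hx i) (hy i) ha hb hab

lemma convex_side {d : ℕ} (c : Draw d) (b : Bool) : Convex ℝ (side c b) := by
  cases b
  · exact convex_halfSpace_le (along_isLinearMap _ _) _
  · exact convex_halfSpace_gt (along_isLinearMap _ _) _

lemma block_subset_cube {d : ℕ} (T : Tree d) : ∀ w, block T w ⊆ cube d
  | [] => Subset.rfl
  | _ :: w => inter_subset_left.trans (block_subset_cube T w)

lemma convex_block {d : ℕ} (T : Tree d) : ∀ w, Convex ℝ (block T w)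
  | [] => convex_cube d
  | b :: w => (convex_block T w).inter (convex_side (T w) b)

lemma mem_side_or {d : ℕ} (c : Draw d) (x : Pt d) : x ∈ side c false ∨ x ∈ side c true := by
  simp only [side, mem_ofPred_eq]
  exact le_or_gt _ _

lemma not_mem_side_both {d : ℕ} {c : Draw d} {x : Pt d} (h : x ∈ side c false) :
    x ∉ side c true := by
  simp only [side, mem_ofPred_eq] at h ⊢
  exact not_lt.2 h

lemma measurable_apply_uncurry (d : ℕ) : Measurable fun q : Fin d × Pt d => q.2 q.1 :=
  measurable_from_prod_countable_right fun i => by dsimp only; fun_prop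

lemma measurable_along (d : ℕ) :
    Measurable fun z : Draw d × Pt d => along z.1.2.1 z.1.2.2.1 z.2 := by
  unfold along
  have h1 : Measurable fun z : Draw d × Pt d => z.2 z.1.2.1.1 :=
    (measurable_apply_uncurry d).comp (by fun_prop :
      Measurable fun z : Draw d × Pt d => (z.1.2.1.1, z.2))
  have h2 : Measurable fun z : Draw d × Pt d => z.2 z.1.2.1.2 :=
    (measurable_apply_uncurry d).comp (by fun_prop :
      Measurable fun z : Draw d × Pt d => (z.1.2.1.2, z.2))
  have h3 : Measurable fun z : Draw d × Pt d => z.1.2.2.1 := by fun_prop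
  exact (h1.mul (Real.measurable_cos.comp h3)).add (h2.mul (Real.measurable_sin.comp h3))

lemma measurableSet_side (d : ℕ) (b : Bool) :
    MeasurableSet {z : Draw d × Pt d | z.2 ∈ side z.1 b} := by
  cases b
  · exact measurableSet_le (measurable_along d) (by fun_prop)
  · exact measurableSet_lt (by fun_prop) (measurable_along d)

lemma measurableSet_cube (d : ℕ) : MeasurableSet (cube d) := by
  have : cube d = ⋂ i, (fun x : Pt d => x i) ⁻¹' Icc 0 1 := by
    ext; simp [cube]
  rw [this]
  exact MeasurableSet.iInter fun i => measurableSet_Icc.preimage (by fun_prop)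

lemma measurableSet_block {d : ℕ} :
    ∀ w, MeasurableSet {z : Tree d × Pt d | z.2 ∈ block z.1 w}
  | [] => (measurableSet_cube d).preimage measurable_snd
  | b :: w => (measurableSet_block w).inter ((measurableSet_side d b).preimage
      (by fun_prop : Measurable fun z : Tree d × Pt d => (z.1 w, z.2)))

lemma measurableSet_mem_block {d : ℕ} (w : List Bool) (x : Pt d) :
    MeasurableSet {T : Tree d | x ∈ block T w} :=
  (measurableSet_block w).preimage (by fun_prop : Measurable fun T : Tree d => (T, x))

lemma measurableSet_block_right {d : ℕ} (T : Tree d) (w : List Bool) :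
    MeasurableSet (block T w) :=
  (measurableSet_block w).preimage (by fun_prop : Measurable fun x : Pt d => (T, x))

lemma measurable_birth {d : ℕ} : ∀ w, Measurable fun T : Tree d => birth T w
  | [] => measurable_const
  | _ :: w => (measurable_birth w).add (by fun_prop)

/-! ### Levels, nodes present at a budget, and leaves -/

/-- The nodes of depth `n`. -/
def level : ℕ → Finset (List Bool)
  | 0 => {[]}
  | n + 1 => (level n).image (List.cons false) ∪ (level n).image (List.cons true)

lemma sum_level_succ {M : Type*} [AddCommMonoid M] (n : ℕ) (f : List Bool → M) :
    ∑ w ∈ level (n + 1), f w = ∑ w ∈ level n, (f (false :: w) + f (true :: w)) := by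
  rw [level, Finset.sum_union, Finset.sum_image, Finset.sum_image, Finset.sum_add_distrib]
  · intro a _ b _ h; simpa using h
  · intro a _ b _ h; simpa using h
  · rw [Finset.disjoint_left]
    intro a ha hb
    obtain ⟨u, -, rfl⟩ := Finset.mem_image.1 ha
    obtain ⟨v, -, hv⟩ := Finset.mem_image.1 hb
    simp at hv

lemma mem_level : ∀ {n : ℕ} {w : List Bool}, w ∈ level n ↔ w.length = n
  | 0, w => by simp [level]
  | n + 1, [] => by simp [level]
  | n + 1, b :: w => by
    have := mem_level (n := n) (w := w)
    cases b <;> simp [level, this]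

/-- The nodes present with budget `τ`. -/
def Alive {d : ℕ} (T : Tree d) (τ : ℝ) : List Bool → Prop
  | [] => True
  | _ :: w => Alive T τ w ∧ birth T w + (T w).1 < τ

/-- The nodes present with budget `τ` that are not cut. -/
def Leaf {d : ℕ} (T : Tree d) (τ : ℝ) (w : List Bool) : Prop :=
  Alive T τ w ∧ τ ≤ birth T w + (T w).1

lemma Alive.birth_le {d : ℕ} {T : Tree d} {τ : ℝ} (hτ : 0 ≤ τ) :
    ∀ {w}, Alive T τ w → birth T w ≤ τ
  | [], _ => hτ
  | _ :: _, h => h.2.le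

lemma measurableSet_alive {d : ℕ} (τ : ℝ) : ∀ w, MeasurableSet {T : Tree d | Alive T τ w}
  | [] => by simp [Alive]
  | _ :: w => (measurableSet_alive τ w).inter
      (measurableSet_lt ((measurable_birth w).add (by fun_prop)) measurable_const)

lemma measurableSet_leaf {d : ℕ} (τ : ℝ) (w : List Bool) :
    MeasurableSet {T : Tree d | Leaf T τ w} :=
  (measurableSet_alive τ w).inter
    (measurableSet_le measurable_const ((measurable_birth w).add (by fun_prop)))

section Congr

variable {d : ℕ} {T T' : Tree d}

lemma block_congr : ∀ {w : List Bool}, (∀ v, v <:+ w → v ≠ w → T v = T' v) →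
    block T w = block T' w
  | [], _ => rfl
  | b :: w, h => by
    have h1 : T w = T' w := h w (List.suffix_cons b w) (by simp)
    have h2 : block T w = block T' w := block_congr fun v hv _ =>
      h v (hv.trans (List.suffix_cons b w)) fun e => by
        have := hv.length_le; rw [e] at this; simp at this
    rw [block, block, h1, h2]

lemma birth_congr : ∀ {w : List Bool}, (∀ v, v <:+ w → v ≠ w → T v = T' v) →
    birth T w = birth T' w
  | [], _ => rfl
  | b :: w, h => by
    have h1 : T w = T' w := h w (List.suffix_cons b w) (by simp)
    have h2 : birth T w = birth T' w := birth_congr fun v hv _ =>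
      h v (hv.trans (List.suffix_cons b w)) fun e => by
        have := hv.length_le; rw [e] at this; simp at this
    rw [birth, birth, h1, h2]

lemma alive_congr {τ : ℝ} : ∀ {w : List Bool}, (∀ v, v <:+ w → v ≠ w → T v = T' v) →
    (Alive T τ w ↔ Alive T' τ w)
  | [], _ => Iff.rfl
  | b :: w, h => by
    have h1 : T w = T' w := h w (List.suffix_cons b w) (by simp)
    have h3 : ∀ v, v <:+ w → v ≠ w → T v = T' v := fun v hv _ =>
      h v (hv.trans (List.suffix_cons b w)) fun e => by
        have := hv.length_le; rw [e] at this; simp at this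
    rw [Alive, Alive, h1, birth_congr h3, alive_congr h3]

end Congr

/-- Integration of a function of the cuts at a node and its ancestors. -/
lemma IsBSPLaw.lintegral_le {d : ℕ} {ν : Measure (Tree d)} (hν : IsBSPLaw ν) (w : List Bool)
    {Ψ bnd : Tree d → ℝ≥0∞} (hΨ : Measurable Ψ)
    (hdep : ∀ T T', (∀ v, v <:+ w → T v = T' v) → Ψ T = Ψ T')
    (h : ∀ T, cutMean (block T w) (fun c => Ψ (Function.update T w c)) ≤ bnd T) :
    ∫⁻ T, Ψ T ∂ν ≤ ∫⁻ T, bnd T ∂ν := by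
  classical
  -- The same cut `c` is placed at `w` and at all its descendants. This is harmless, because `Ψ`
  -- sees only suffixes of `w`.
  set ext : ({v : List Bool // ¬ w <:+ v} → Draw d) → Draw d → Tree d :=
    fun g c v => if hv : ¬ w <:+ v then g ⟨v, hv⟩ else c with hext
  have hm : Measurable (Function.uncurry fun g c => Ψ (ext g c)) := by
    refine hΨ.comp (measurable_pi_lambda _ fun v => ?_)
    by_cases hv : w <:+ v
    · simp only [hext, hv, not_true_eq_false, dite_false]; fun_prop
    · simp only [hext, hv, not_false_eq_true, dite_true]; fun_prop
  have hkey := hν.cut w (fun g c => Ψ (ext g c)) hm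
  have e1 : ∀ T : Tree d, Ψ (ext (fun v => T v) (T w)) = Ψ T := fun T => hdep _ _ fun v hv => by
    by_cases hv' : w <:+ v
    · have : v = w := hv.eq_of_length (le_antisymm hv.length_le hv'.length_le)
      subst this; simp [hext]
    · simp [hext, hv']
  have e2 : ∀ (T : Tree d) c, Ψ (ext (fun v => T v) c) = Ψ (Function.update T w c) :=
    fun T c => hdep _ _ fun v hv => by
      by_cases hv' : w <:+ v
      · have : v = w := hv.eq_of_length (le_antisymm hv.length_le hv'.length_le)
        subst this; simp [hext]
      · have hne : v ≠ w := fun e => hv' (e ▸ List.suffix_rfl)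
        simp [hext, hv', Function.update_of_ne hne]
  simp_rw [e1, e2] at hkey
  rw [hkey]
  exact lintegral_mono h

/-- The sum of `G` over the leaves of depth `n`. -/
def leafSum {d : ℕ} (G : Set (Pt d) → ℝ≥0∞) (τ : ℝ) (n : ℕ) (T : Tree d) : ℝ≥0∞ :=
  ∑ w ∈ level n, {T | Leaf T τ w}.indicator (fun T => G (block T w)) T

/-- The sum of `G`, weighted by `exp (l * remaining budget)`, over the nodes of depth `n` that are
present with budget `τ`. -/
def aliveSum {d : ℕ} (G : Set (Pt d) → ℝ≥0∞) (l τ : ℝ) (n : ℕ) (T : Tree d) : ℝ≥0∞ :=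
  ∑ w ∈ level n, {T | Alive T τ w}.indicator
    (fun T => ENNReal.ofReal (Real.exp (l * (τ - birth T w))) * G (block T w)) T

lemma measurable_leafSum {d : ℕ} {G : Set (Pt d) → ℝ≥0∞}
    (hG : ∀ w, Measurable fun T : Tree d => G (block T w)) (τ : ℝ) (n : ℕ) :
    Measurable (leafSum G τ n) :=
  Finset.measurable_fun_sum _ fun w _ => (hG w).indicator (measurableSet_leaf τ w)

lemma measurable_exp_birth {d : ℕ} (l τ : ℝ) (w : List Bool) :
    Measurable fun T : Tree d => ENNReal.ofReal (Real.exp (l * (τ - birth T w))) :=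
  (Real.measurable_exp.comp (measurable_const.mul
    (measurable_const.sub (measurable_birth w)))).ennreal_ofReal

lemma measurable_aliveSum {d : ℕ} {G : Set (Pt d) → ℝ≥0∞}
    (hG : ∀ w, Measurable fun T : Tree d => G (block T w)) (l τ : ℝ) (n : ℕ) :
    Measurable (aliveSum G l τ n) := by
  refine Finset.measurable_fun_sum _ fun w _ =>
    Measurable.indicator ?_ (measurableSet_alive τ w)
  exact (measurable_exp_birth l τ w).mul (hG w)

/-- One step of the recursion over the depth. -/
lemma lintegral_level_step {d : ℕ} {ν : Measure (Tree d)} (hν : IsBSPLaw ν)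
    {G : Set (Pt d) → ℝ≥0∞} (hG : ∀ w, Measurable fun T : Tree d => G (block T w))
    {l τ : ℝ} (hτ : 0 ≤ τ) {a ρ : ℝ≥0∞} (ha : a ≤ 1)
    (hcut : ∀ (T : Tree d) (w : List Bool) (s : ℝ), 0 ≤ s →
      cutMean (block T w) (fun c => if s ≤ c.1 then a * G (block T w) else
        ENNReal.ofReal (Real.exp (l * (s - c.1))) * splitSum G (block T w) c.2)
      ≤ ρ * (ENNReal.ofReal (Real.exp (l * s)) * G (block T w))) (n : ℕ) :
    a * ∫⁻ T, leafSum G τ n T ∂ν + ∫⁻ T, aliveSum G l τ (n + 1) T ∂ν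
      ≤ ρ * ∫⁻ T, aliveSum G l τ n T ∂ν := by
  classical
  -- `Ψ w` is what node `w` passes on: `a` times its own value if it is a leaf, otherwise the
  -- weighted values of its two children. It depends only on the cuts at `w` and its ancestors. The
  -- choice `a = 1` keeps account of the leaves, `a = 0` discards them.
  set Ψ : List Bool → Tree d → ℝ≥0∞ := fun w => {T | Alive T τ w}.indicator fun T =>
    if τ ≤ birth T w + (T w).1 then a * G (block T w) else
      ENNReal.ofReal (Real.exp (l * (τ - (birth T w + (T w).1)))) *
        (G (block T (false :: w)) + G (block T (true :: w))) with hΨ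
  have hΨm : ∀ w, Measurable (Ψ w) := fun w => by
    have h1 : Measurable fun T : Tree d => birth T w + (T w).1 :=
      (measurable_birth w).add (by fun_prop)
    exact Measurable.indicator (Measurable.ite (measurableSet_le measurable_const h1)
      (measurable_const.mul (hG w)) ((Real.measurable_exp.comp (measurable_const.mul
        (measurable_const.sub h1))).ennreal_ofReal.mul ((hG _).add (hG _))))
      (measurableSet_alive τ w)
  have hΨdep : ∀ w T T', (∀ v, v <:+ w → T v = T' v) → Ψ w T = Ψ w T' := by
    intro w T T' h
    have h0 : ∀ v, v <:+ w → v ≠ w → T v = T' v := fun v hv _ => h v hv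
    simp only [hΨ, indicator, mem_ofPred_eq, block, alive_congr (τ := τ) h0, birth_congr h0,
      block_congr h0, h w List.suffix_rfl]
  have hstep : ∀ w, ∫⁻ T, Ψ w T ∂ν ≤ ∫⁻ T, ρ * {T | Alive T τ w}.indicator
      (fun T => ENNReal.ofReal (Real.exp (l * (τ - birth T w))) * G (block T w)) T ∂ν := by
    intro w
    refine hν.lintegral_le w (hΨm w) (hΨdep w) fun T => ?_
    have h0 : ∀ c, ∀ v, v <:+ w → v ≠ w → Function.update T w c v = T v := fun c v _ hv =>
      Function.update_of_ne hv _ _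
    by_cases hA : Alive T τ w
    · rw [indicator_of_mem (show T ∈ {T | Alive T τ w} from hA)]
      convert hcut T w (τ - birth T w) (sub_nonneg.2 (hA.birth_le hτ)) using 2
      funext c
      have hA' : Function.update T w c ∈ {T | Alive T τ w} := (alive_congr (h0 c)).2 hA
      simp only [hΨ]
      rw [indicator_of_mem hA']
      simp only [block, birth_congr (h0 c), block_congr (h0 c), Function.update_self,
        splitSum_eq, tsub_le_iff_left, sub_sub]
    · have : ∀ c, Ψ w (Function.update T w c) = 0 := fun c =>
        indicator_of_notMem (s := {T | Alive T τ w})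
          (fun h => hA ((alive_congr (h0 c)).1 h)) _
      simp only [this]
      simp [cutMean]
  have hsum : ∀ T, a * leafSum G τ n T + aliveSum G l τ (n + 1) T ≤ ∑ w ∈ level n, Ψ w T := by
    intro T
    rw [leafSum, aliveSum, sum_level_succ, Finset.mul_sum, ← Finset.sum_add_distrib]
    refine Finset.sum_le_sum fun w _ => ?_
    simp only [hΨ, indicator, mem_ofPred_eq, Leaf, Alive, birth]
    by_cases hA : Alive T τ w
    · by_cases hc : τ ≤ birth T w + (T w).1
      · simp [hA, hc, not_lt.2 hc]
      · simp [hA, hc, not_le.1 hc, mul_add]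
    · simp [hA]
  calc a * ∫⁻ T, leafSum G τ n T ∂ν + ∫⁻ T, aliveSum G l τ (n + 1) T ∂ν
      = ∫⁻ T, (a * leafSum G τ n T + aliveSum G l τ (n + 1) T) ∂ν := by
        rw [lintegral_add_right _ (measurable_aliveSum hG l τ _),
          lintegral_const_mul' _ _ (ha.trans_lt ENNReal.one_lt_top).ne]
    _ ≤ ∫⁻ T, ∑ w ∈ level n, Ψ w T ∂ν := lintegral_mono hsum
    _ = ∑ w ∈ level n, ∫⁻ T, Ψ w T ∂ν := lintegral_finsetSum _ fun w _ => hΨm w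
    _ ≤ ∑ w ∈ level n, ∫⁻ T, ρ * {T | Alive T τ w}.indicator
      (fun T => ENNReal.ofReal (Real.exp (l * (τ - birth T w))) * G (block T w)) T ∂ν :=
        Finset.sum_le_sum fun w _ => hstep w
    _ = ρ * ∫⁻ T, aliveSum G l τ n T ∂ν := by
        have hm : ∀ w, Measurable ({T | Alive T τ w}.indicator (fun T : Tree d =>
            ENNReal.ofReal (Real.exp (l * (τ - birth T w))) * G (block T w))) := fun w => by
          exact ((measurable_exp_birth l τ w).mul (hG w)).indicator (measurableSet_alive τ w)
        simp only [aliveSum]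
        rw [lintegral_finsetSum _ fun w _ => hm w, Finset.mul_sum]
        exact Finset.sum_congr rfl fun w _ => lintegral_const_mul _ (hm w)

lemma lintegral_aliveSum_zero {d : ℕ} {ν : Measure (Tree d)} (hν : IsBSPLaw ν)
    (G : Set (Pt d) → ℝ≥0∞) (l τ : ℝ) :
    ∫⁻ T, aliveSum G l τ 0 T ∂ν = ENNReal.ofReal (Real.exp (l * τ)) * G (cube d) := by
  have := hν.isProbabilityMeasure
  simp [aliveSum, level, Alive, block, birth]

/-- The mean of the sum of `G` over the leaves, when splitting a block raises `G` at a rate of at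
most `l`. -/
theorem lintegral_tsum_leafSum_le {d : ℕ} {ν : Measure (Tree d)} (hν : IsBSPLaw ν)
    {G : Set (Pt d) → ℝ≥0∞} (hG : ∀ w, Measurable fun T : Tree d => G (block T w))
    (hG1 : ∀ K, G K ≠ ∞) {l τ : ℝ} (hτ : 0 ≤ τ)
    (hl : ∀ K ⊆ cube d, Convex ℝ K → G K ≠ 0 → 0 ≤ (totalPerimeter K).toReal + l)
    (h : ∀ K ⊆ cube d, Convex ℝ K →
      cutRate K (splitSum G K) ≤ ENNReal.ofReal ((totalPerimeter K).toReal + l) * G K) :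
    ∫⁻ T, ∑' n, leafSum G τ n T ∂ν ≤ ENNReal.ofReal (Real.exp (l * τ)) * G (cube d) := by
  rw [lintegral_tsum fun n => (measurable_leafSum hG τ n).aemeasurable]
  have hstep : ∀ n, ∫⁻ T, leafSum G τ n T ∂ν + ∫⁻ T, aliveSum G l τ (n + 1) T ∂ν
      ≤ ∫⁻ T, aliveSum G l τ n T ∂ν := fun n => by
    have := lintegral_level_step hν hG hτ (l := l) (a := 1) (ρ := 1) le_rfl (fun T w s hs => by
      rw [one_mul, one_mul]
      exact cutMean_growth_le (block_subset_cube T w) (convex_block T w) (hG1 _) hs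
        (hl _ (block_subset_cube T w) (convex_block T w))
        (h _ (block_subset_cube T w) (convex_block T w))) n
    simpa using this
  have hpart : ∀ n, ∑ k ∈ Finset.range n, ∫⁻ T, leafSum G τ k T ∂ν
      + ∫⁻ T, aliveSum G l τ n T ∂ν ≤ ∫⁻ T, aliveSum G l τ 0 T ∂ν := by
    intro n
    induction n with
    | zero => simp
    | succ n ih =>
      rw [Finset.sum_range_succ, add_assoc]
      exact (add_le_add le_rfl (hstep n)).trans ih
  rw [ENNReal.tsum_eq_iSup_nat, ← lintegral_aliveSum_zero hν]
  exact iSup_le fun n => le_self_add.trans (hpart n)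

lemma splitSum_mem_indicator_le {d : ℕ} (x : Pt d) (K : Set (Pt d))
    (q : (Fin d × Fin d) × ℝ × ℝ) :
    splitSum (fun K => K.indicator 1 x) K q ≤ K.indicator 1 x := by
  classical
  by_cases hx : x ∈ K
  · by_cases h : x ∈ side (0, q) false
    · simp [splitSum, indicator, hx, h, not_mem_side_both h]
    · simp only [splitSum, indicator, mem_inter_iff, hx, h]
      simp
      split_ifs <;> simp
  · simp [splitSum, indicator, hx]

/-- Almost surely, a given point of the cube lies in a leaf block. -/
theorem ae_exists_leaf {d : ℕ} {ν : Measure (Tree d)} (hν : IsBSPLaw ν) {τ : ℝ} (hτ : 0 ≤ τ)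
    {x : Pt d} (hx : x ∈ cube d) : ∀ᵐ T ∂ν, ∃ w, Leaf T τ w ∧ x ∈ block T w := by
  classical
  set G : Set (Pt d) → ℝ≥0∞ := fun K => K.indicator 1 x with hGdef
  have hG : ∀ w, Measurable fun T : Tree d => G (block T w) := fun w =>
    (measurable_const (a := (1 : ℝ≥0∞))).indicator (measurableSet_mem_block w x)
  have hG1 : ∀ K, G K ≠ ∞ := fun K => by
    simp only [hGdef, indicator]; split_ifs <;> simp
  -- With `l = 1` the weight is the exponential of the remaining budget. It is at least `1` on nodes
  -- that are present, yet its mean contracts by `shrink d` at each depth.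
  have hdecay : ∀ n, ∫⁻ T, aliveSum G 1 τ n T ∂ν
      ≤ ENNReal.ofReal (shrink d) ^ n * ENNReal.ofReal (Real.exp τ) := by
    intro n
    induction n with
    | zero =>
      rw [lintegral_aliveSum_zero hν, one_mul, pow_zero, one_mul]
      simp [hGdef, hx]
    | succ n ih =>
      have := lintegral_level_step hν hG hτ (l := 1) (a := 0) (ρ := ENNReal.ofReal (shrink d))
        (by simp) (fun T w s hs => by
          simp only [one_mul, zero_mul]
          refine le_trans ?_ (cutMean_shrink_le (block_subset_cube T w) (convex_block T w)
            (hG1 _) (s := s) (splitSum_mem_indicator_le x _))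
          refine lintegral_mono fun c => Finset.sum_le_sum fun p _ => ?_
          refine mul_le_mul_right (lintegral_mono fun θ => mul_le_mul_right ?_ _) _
          refine lintegral_mono fun u => ?_
          dsimp only
          split_ifs
          · exact zero_le
          · exact le_rfl) n
      rw [zero_mul, zero_add] at this
      calc _ ≤ _ := this
        _ ≤ _ := mul_le_mul_right ih _
        _ = _ := by rw [pow_succ]; ring
  set A : Set (Tree d) := {T | ∀ n, ∃ w ∈ level n, Alive T τ w ∧ x ∈ block T w} with hA
  have hA0 : ν A = 0 := by
    have hle : ∀ n, ν A ≤ ENNReal.ofReal (shrink d) ^ n * ENNReal.ofReal (Real.exp τ) := by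
      intro n
      refine le_trans ?_ (hdecay n)
      have h1 := mul_meas_ge_le_lintegral (μ := ν) (measurable_aliveSum hG 1 τ n) 1
      rw [one_mul] at h1
      refine (measure_mono fun T hT => ?_).trans h1
      obtain ⟨w, hw, hal, hxw⟩ := hT n
      rw [mem_ofPred_eq]
      refine le_trans ?_ (Finset.single_le_sum (fun _ _ => zero_le) hw)
      rw [indicator_of_mem (show T ∈ {T | Alive T τ w} from hal)]
      simp only [hGdef, indicator_of_mem hxw, Pi.one_apply, mul_one, one_mul]
      rw [← ENNReal.ofReal_one]
      apply ENNReal.ofReal_le_ofReal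
      apply Real.one_le_exp
      have := hal.birth_le hτ
      linarith
    have hlim : Tendsto (fun n : ℕ => ENNReal.ofReal (shrink d) ^ n
        * ENNReal.ofReal (Real.exp τ)) atTop (nhds 0) := by
      have := ENNReal.Tendsto.mul_const (b := ENNReal.ofReal (Real.exp τ))
        (ENNReal.tendsto_pow_atTop_nhds_zero_of_lt_one (r := ENNReal.ofReal (shrink d)) (by
          rw [← ENNReal.ofReal_one]
          exact ENNReal.ofReal_lt_ofReal_iff_of_nonneg (shrink_nonneg d) |>.2 (shrink_lt_one d)))
        (Or.inr ENNReal.ofReal_ne_top)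
      simpa using this
    exact le_antisymm (ge_of_tendsto' hlim hle) zero_le
  have : ∀ᵐ T ∂ν, T ∉ A := measure_eq_zero_iff_ae_notMem.1 hA0
  filter_upwards [this] with T hT
  -- At the first depth where no present block contains `x`, the node one level up that contains `x`
  -- was not cut, so it is a leaf.
  have hne : ∃ n, ¬ ∃ w ∈ level n, Alive T τ w ∧ x ∈ block T w := by
    by_contra! h
    exact hT fun n => h n
  have hn := Nat.find_spec hne
  have h0 : Nat.find hne ≠ 0 := fun h => by
    rw [h] at hn
    exact hn ⟨[], by simp [level], trivial, hx⟩
  obtain ⟨k, hk⟩ := Nat.exists_eq_succ_of_ne_zero h0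
  have hmin := Nat.find_min hne (show k < Nat.find hne by omega)
  rw [not_not] at hmin
  obtain ⟨w, hw, hal, hxw⟩ := hmin
  refine ⟨w, ⟨hal, ?_⟩, hxw⟩
  by_contra! hlt
  rw [hk] at hn
  apply hn
  rcases mem_side_or (T w) x with hs | hs
  · exact ⟨false :: w, mem_level.2 (by simpa using mem_level.1 hw), ⟨hal, hlt⟩, hxw, hs⟩
  · exact ⟨true :: w, mem_level.2 (by simpa using mem_level.1 hw), ⟨hal, hlt⟩, hxw, hs⟩

end BSP

end

noncomputable section

namespace BSP

/-! ### Blocks that meet a set of small diameter -/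

open Classical in
/-- Indicator of the blocks that meet `J`. -/
def touch {d : ℕ} (J : Set (Pt d)) (K : Set (Pt d)) : ℝ≥0∞ := if ∃ y ∈ J, y ∈ K then 1 else 0

open Classical in
/-- Indicator of the blocks that contain `x` and meet `J`. -/
def joins {d : ℕ} (x : Pt d) (J : Set (Pt d)) (K : Set (Pt d)) : ℝ≥0∞ :=
  if x ∈ K ∧ ∃ y ∈ J, y ∈ K then 1 else 0

lemma touch_le_one {d : ℕ} (J K : Set (Pt d)) : touch J K ≤ 1 := by
  unfold touch; split_ifs <;> simp

lemma joins_le_one {d : ℕ} (x : Pt d) (J K : Set (Pt d)) : joins x J K ≤ 1 := by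
  unfold joins; split_ifs <;> simp

lemma measurableSet_touch {d : ℕ} {J : Set (Pt d)} (hJ : J.Finite) (w : List Bool) :
    MeasurableSet {T : Tree d | ∃ y ∈ J, y ∈ block T w} := by
  have : {T : Tree d | ∃ y ∈ J, y ∈ block T w} = ⋃ y ∈ J, {T | y ∈ block T w} := by
    ext; simp
  rw [this]
  exact hJ.measurableSet_biUnion fun y _ => measurableSet_mem_block w y

lemma measurable_touch {d : ℕ} {J : Set (Pt d)} (hJ : J.Finite) (w : List Bool) :
    Measurable fun T : Tree d => touch J (block T w) :=
  Measurable.ite (measurableSet_touch hJ w) measurable_const measurable_const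

lemma measurable_joins {d : ℕ} (x : Pt d) {J : Set (Pt d)} (hJ : J.Finite) (w : List Bool) :
    Measurable fun T : Tree d => joins x J (block T w) :=
  Measurable.ite ((measurableSet_mem_block w x).inter (measurableSet_touch hJ w))
    measurable_const measurable_const

lemma perimeter_mul_inv_le {d : ℕ} {K : Set (Pt d)} (hc : Convex ℝ K) (p : Fin d × Fin d) :
    perimeter K p * (widthIntegral K p)⁻¹ ≤ 4 := by
  rw [← div_eq_mul_inv]
  exact ENNReal.div_le_of_le_mul (perimeter_le_widthIntegral hc p)

lemma mem_side_false {d : ℕ} {p : Fin d × Fin d} {θ u : ℝ} {x : Pt d} :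
    x ∈ side ((0, p, θ, u) : Draw d) false ↔ along p θ x ≤ u := Iff.rfl

lemma mem_side_true {d : ℕ} {p : Fin d × Fin d} {θ u : ℝ} {x : Pt d} :
    x ∈ side ((0, p, θ, u) : Draw d) true ↔ u < along p θ x := Iff.rfl

lemma abs_along_sub_le {d : ℕ} (p : Fin d × Fin d) (θ : ℝ) {x y : Pt d} {δ : ℝ}
    (h : ∀ i, |x i - y i| ≤ δ) : |along p θ x - along p θ y| ≤ 2 * δ := by
  have e : along p θ x - along p θ y
      = (x p.1 - y p.1) * Real.cos θ + (x p.2 - y p.2) * Real.sin θ := by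
    simp only [along]; ring
  rw [e]
  refine (abs_add_le _ _).trans ?_
  rw [abs_mul, abs_mul]
  nlinarith [h p.1, h p.2, Real.abs_cos_le_one θ, Real.abs_sin_le_one θ, abs_nonneg (x p.1 - y p.1),
    abs_nonneg (x p.2 - y p.2)]

/-- Every point of `J` projects to within `2 * δ` of `y₀`, so a cut at a position outside this
window leaves all of `J` on one side. -/
lemma splitSum_touch_le {d : ℕ} {K J : Set (Pt d)} {δ : ℝ} {y₀ : Pt d}
    (hJ : ∀ y ∈ J, ∀ i, |y i - y₀ i| ≤ δ) (p : Fin d × Fin d) (θ u : ℝ) :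
    splitSum (touch J) K (p, θ, u) ≤ 1 + (Icc (along p θ y₀ - 2 * δ)
      (along p θ y₀ + 2 * δ)).indicator 1 u := by
  by_cases hu : u ∈ Icc (along p θ y₀ - 2 * δ) (along p θ y₀ + 2 * δ)
  · rw [indicator_of_mem hu]
    exact add_le_add (touch_le_one _ _) (touch_le_one _ _)
  · rw [indicator_of_notMem hu, add_zero]
    rw [mem_Icc, not_and_or, not_le, not_le] at hu
    rcases hu with hu | hu
    · have h0 : touch J (K ∩ side (0, p, θ, u) false) = 0 := if_neg fun ⟨y, hy, _, hy'⟩ => by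
        rw [mem_side_false] at hy'
        have := abs_le.1 (abs_along_sub_le p θ (hJ y hy))
        linarith [this.1]
      rw [splitSum, h0, zero_add]
      exact touch_le_one _ _
    · have h0 : touch J (K ∩ side (0, p, θ, u) true) = 0 := if_neg fun ⟨y, hy, _, hy'⟩ => by
        rw [mem_side_true] at hy'
        have := abs_le.1 (abs_along_sub_le p θ (hJ y hy))
        linarith [this.2]
      rw [splitSum, h0, add_zero]
      exact touch_le_one _ _

/-- An upper bound for the rate of the cuts that meet a set of coordinate diameter `1`. -/
def hitRate (d : ℕ) : ℝ := (pairs d).card * (16 * Real.pi)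

lemma hitRate_nonneg (d : ℕ) : 0 ≤ hitRate d := by
  have := Real.pi_pos
  unfold hitRate; positivity

lemma cutRate_eq_zero {d : ℕ} {K : Set (Pt d)} {H : (Fin d × Fin d) × ℝ × ℝ → ℝ≥0∞}
    (h : ∀ q, H q = 0) : cutRate K H = 0 := by
  have := (cutRate_mono (K := K) (H' := fun _ => 0) fun q => (h q).le).trans (cutRate_const_le K 0)
  simpa using this

/-- Only cuts that hit `J` can increase the count. For each pair the window has length `4 * δ`, the
angles have total measure `π`, and perimeter over integrated width is at most `4`, which makes `16 *
π * δ`. -/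
lemma cutRate_touch_le {d : ℕ} {K J : Set (Pt d)} (hK : K ⊆ cube d) (hc : Convex ℝ K) {δ : ℝ}
    (hδ : 0 ≤ δ) (hJ : ∀ y ∈ J, ∀ y' ∈ J, ∀ i, |y i - y' i| ≤ δ) :
    cutRate K (splitSum (touch J) K)
      ≤ ENNReal.ofReal ((totalPerimeter K).toReal + hitRate d * δ) * touch J K := by
  have hpi := Real.pi_pos
  by_cases h : ∃ y ∈ J, y ∈ K
  swap
  · rw [cutRate_eq_zero]
    · exact zero_le
    · intro q
      have h1 : ∀ b, touch J (K ∩ side (0, q) b) = 0 := fun b =>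
        if_neg fun ⟨y, hy, hy', _⟩ => h ⟨y, hy, hy'⟩
      rw [splitSum, h1, h1, add_zero]
  have h1 : touch J K = 1 := if_pos h
  obtain ⟨y₀, hy₀, -⟩ := h
  rw [h1, mul_one, ENNReal.ofReal_add ENNReal.toReal_nonneg (mul_nonneg (hitRate_nonneg d) hδ),
    ENNReal.ofReal_toReal (totalPerimeter_ne_top hK hc)]
  have hp : ∀ p, perimeter K p * ((widthIntegral K p)⁻¹ * ∫⁻ θ in Ioc 0 Real.pi,
      ∫⁻ u in segment K p θ, splitSum (touch J) K (p, θ, u))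
      ≤ perimeter K p + ENNReal.ofReal (16 * Real.pi * δ) := by
    intro p
    have hin : ∀ θ, ∫⁻ u in segment K p θ, splitSum (touch J) K (p, θ, u)
        ≤ volume (segment K p θ) + ENNReal.ofReal (4 * δ) := by
      intro θ
      calc _ ≤ ∫⁻ u in segment K p θ, (1 + (Icc (along p θ y₀ - 2 * δ)
            (along p θ y₀ + 2 * δ)).indicator 1 u) :=
            lintegral_mono fun u => splitSum_touch_le (fun y hy => hJ y hy y₀ hy₀) p θ u
        _ = volume (segment K p θ) + ∫⁻ u in segment K p θ, (Icc (along p θ y₀ - 2 * δ)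
            (along p θ y₀ + 2 * δ)).indicator 1 u := by
            rw [lintegral_add_left measurable_const, setLIntegral_one]
        _ ≤ volume (segment K p θ) + ∫⁻ u, (Icc (along p θ y₀ - 2 * δ)
            (along p θ y₀ + 2 * δ)).indicator 1 u := by
            gcongr; exact Measure.restrict_le_self
        _ = _ := by
            rw [lintegral_indicator_one measurableSet_Icc, Real.volume_Icc]
            congr 2; ring
    have hth : ∫⁻ θ in Ioc 0 Real.pi, ∫⁻ u in segment K p θ, splitSum (touch J) K (p, θ, u)
        ≤ widthIntegral K p + ENNReal.ofReal (4 * Real.pi * δ) := by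
      calc _ ≤ ∫⁻ θ in Ioc 0 Real.pi, (volume (segment K p θ) + ENNReal.ofReal (4 * δ)) :=
            lintegral_mono fun θ => hin θ
        _ = _ := by
            rw [lintegral_add_right _ measurable_const, setLIntegral_const, Real.volume_Ioc,
              ← ENNReal.ofReal_mul (by positivity), widthIntegral]
            congr 2; ring
    calc _ ≤ perimeter K p * ((widthIntegral K p)⁻¹ *
            (widthIntegral K p + ENNReal.ofReal (4 * Real.pi * δ))) := by gcongr
      _ = perimeter K p * (widthIntegral K p * (widthIntegral K p)⁻¹) +
            perimeter K p * (widthIntegral K p)⁻¹ * ENNReal.ofReal (4 * Real.pi * δ) := by ring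
      _ ≤ perimeter K p * 1 + 4 * ENNReal.ofReal (4 * Real.pi * δ) := by
          gcongr
          · exact ENNReal.mul_inv_le_one _
          · exact perimeter_mul_inv_le hc p
      _ = _ := by
          rw [mul_one, show (4 : ℝ≥0∞) = ENNReal.ofReal 4 by simp,
            ← ENNReal.ofReal_mul (by norm_num)]
          congr 2; ring
  calc cutRate K (splitSum (touch J) K)
      ≤ ∑ p ∈ pairs d, (perimeter K p + ENNReal.ofReal (16 * Real.pi * δ)) :=
        Finset.sum_le_sum fun p _ => hp p
    _ = _ := by
        rw [Finset.sum_add_distrib, totalPerimeter, Finset.sum_const, nsmul_eq_mul, hitRate,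
          ← ENNReal.ofReal_natCast, ← ENNReal.ofReal_mul (by positivity), mul_assoc _ _ δ]
        ring_nf

/-! ### Blocks that contain a point and meet a distant set -/

lemma splitSum_joins_le {d : ℕ} (x : Pt d) (J K : Set (Pt d)) (q : (Fin d × Fin d) × ℝ × ℝ) :
    splitSum (joins x J) K q ≤ joins x J K := by
  have hmono : ∀ b, joins x J (K ∩ side (0, q) b) ≤ joins x J K := fun b => by
    unfold joins
    split_ifs with h1 h2
    · exact le_rfl
    · exact absurd ⟨h1.1.1, h1.2.imp fun y hy => ⟨hy.1, hy.2.1⟩⟩ h2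
    all_goals exact zero_le
  by_cases hx : x ∈ side (0, q) false
  · have h0 : joins x J (K ∩ side (0, q) true) = 0 :=
      if_neg fun h => not_mem_side_both hx h.1.2
    rw [splitSum, h0, add_zero]; exact hmono _
  · have h0 : joins x J (K ∩ side (0, q) false) = 0 := if_neg fun h => hx h.1.2
    rw [splitSum, h0, zero_add]; exact hmono _

/-- The plane contains axis `i` and the angles lie within `1 / 4` of that axis. There the dominant
coordinate enters with factor at least `31 / 32` and the other with factor at most `1 / 4`, which
leaves more than half. The sign `s` treats both orientations of the axis; coordinate `0` is the
partner axis unless `i` is `0` itself, so that the pair is increasing. -/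
lemma exists_separating_directions {d : ℕ} (hd : 2 ≤ d) (i : Fin d) :
    ∃ p ∈ pairs d, ∃ a : ℝ, 0 ≤ a ∧ a + 1 / 4 ≤ Real.pi ∧ ∀ θ ∈ Ioc a (a + 1 / 4),
      ∀ (v : Pt d) (s : ℝ), |s| = 1 → (∀ j, |v j| ≤ s * v i) → s * v i / 2 ≤ s * along p θ v := by
  have hpi := Real.pi_gt_three
  have key : ∀ t : ℝ, 0 ≤ t → t ≤ 1 / 4 → ∀ D e s : ℝ, |s| = 1 → |e| ≤ s * D →
      s * D / 2 ≤ s * (D * Real.cos t + e * Real.sin t) := by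
    intro t h0 h1 D e s hs he
    have hc : 31 / 32 ≤ Real.cos t := by
      have := Real.one_sub_sq_div_two_le_cos (x := t); nlinarith
    have hs1 : Real.sin t ≤ 1 / 4 := (Real.sin_le h0).trans h1
    have hs0 : 0 ≤ Real.sin t := Real.sin_nonneg_of_nonneg_of_le_pi h0 (by linarith)
    have hD : 0 ≤ s * D := (abs_nonneg _).trans he
    have h2 : -(s * D) ≤ s * e := by
      have : |s * e| ≤ s * D := by rw [abs_mul, hs, one_mul]; exact he
      linarith [(abs_le.1 this).1]
    nlinarith
  by_cases hi : i = ⟨0, by omega⟩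
  · refine ⟨(⟨0, by omega⟩, ⟨1, by omega⟩),
      Finset.mem_filter.2 ⟨Finset.mem_univ _, Fin.lt_def.2 zero_lt_one⟩, 0, le_rfl, by linarith, ?_⟩
    intro θ hθ v s hs hv
    subst hi
    exact key θ hθ.1.le (by linarith [hθ.2]) _ _ s hs (hv _)
  · have hpos : 0 < i.val := Nat.pos_of_ne_zero fun h => hi (Fin.ext h)
    refine ⟨(⟨0, by omega⟩, i), Finset.mem_filter.2 ⟨Finset.mem_univ _, Fin.lt_def.2 hpos⟩,
      Real.pi / 2 - 1 / 4,
      by linarith, by linarith, ?_⟩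
    intro θ hθ v s hs hv
    have := key (Real.pi / 2 - θ) (by linarith [hθ.2]) (by linarith [hθ.1]) (v i)
      (v ⟨0, by omega⟩) s hs (hv _)
    rw [Real.cos_pi_div_two_sub, Real.sin_pi_div_two_sub] at this
    simp only [along]
    linarith

/-- A lower bound for the rate at which a point is cut off from a set at distance `1` from it, in
the cone around a coordinate direction. -/
def sepRate : ℝ := 1 / (8 * Real.pi)

lemma sepRate_pos : 0 < sepRate := by
  have := Real.pi_pos
  unfold sepRate; positivity

/-- Cut positions in an interval of length `r` next to the projection of `x` separate `x` from all
of `J` simultaneously, so they contribute nothing; all others contribute at most `1`. The interval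
lies in the segment because `K` contains both `x` and a point of `J`, and its half-open form matches
the closed `false` side. The additive form avoids truncated subtraction. -/
lemma lintegral_splitSum_joins_add_le {d : ℕ} {K J : Set (Pt d)} (hc : Convex ℝ K)
    {x y₀ : Pt d} (hx : x ∈ K) (hy₀ : y₀ ∈ K) (hyJ : y₀ ∈ J) {p : Fin d × Fin d} {θ s r : ℝ}
    (hs : s = 1 ∨ s = -1)
    (h : ∀ y ∈ J, r ≤ s * (along p θ y - along p θ x)) :
    (∫⁻ u in segment K p θ, splitSum (joins x J) K (p, θ, u)) + ENNReal.ofReal r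
      ≤ volume (segment K p θ) := by
  have hox := mem_image_of_mem (along p θ) hx
  have hoy := mem_image_of_mem (along p θ) hy₀
  have hoc := ordConnected_segment hc p θ
  obtain ⟨A, hAm, hAv, hAs, hA0⟩ : ∃ A : Set ℝ, MeasurableSet A ∧ volume A = ENNReal.ofReal r ∧
      A ⊆ segment K p θ ∧ ∀ u ∈ A, splitSum (joins x J) K (p, θ, u) = 0 := by
    rcases hs with rfl | rfl
    · refine ⟨Ico (along p θ x) (along p θ x + r), measurableSet_Ico, by simp, ?_, ?_⟩
      · intro u hu
        exact hoc.out hox hoy ⟨hu.1, by linarith [hu.2, h y₀ hyJ]⟩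
      · intro u hu
        have h0 : joins x J (K ∩ side (0, p, θ, u) false) = 0 := if_neg fun ⟨_, y, hy, hy'⟩ => by
          have := mem_side_false.1 hy'.2
          linarith [hu.2, h y hy]
        have h1 : joins x J (K ∩ side (0, p, θ, u) true) = 0 := if_neg fun ⟨hx', _⟩ => by
          have := mem_side_true.1 hx'.2
          linarith [hu.1]
        rw [splitSum, h0, h1, add_zero]
    · refine ⟨Ico (along p θ x - r) (along p θ x), measurableSet_Ico, by simp, ?_, ?_⟩
      · intro u hu
        exact hoc.out hoy hox ⟨by linarith [hu.1, h y₀ hyJ], hu.2.le⟩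
      · intro u hu
        have h0 : joins x J (K ∩ side (0, p, θ, u) false) = 0 := if_neg fun ⟨hx', _⟩ => by
          have := mem_side_false.1 hx'.2
          linarith [hu.2]
        have h1 : joins x J (K ∩ side (0, p, θ, u) true) = 0 := if_neg fun ⟨_, y, hy, hy'⟩ => by
          have := mem_side_true.1 hy'.2
          linarith [hu.1, h y hy]
        rw [splitSum, h0, h1, add_zero]
  calc _ = (∫⁻ u in segment K p θ, splitSum (joins x J) K (p, θ, u))
        + ∫⁻ u in segment K p θ, A.indicator 1 u := by
        rw [lintegral_indicator_one hAm, Measure.restrict_apply hAm,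
          inter_eq_self_of_subset_left hAs, hAv]
    _ = ∫⁻ u in segment K p θ, (splitSum (joins x J) K (p, θ, u) + A.indicator 1 u) := by
        rw [lintegral_add_right _ (measurable_one.indicator hAm)]
    _ ≤ ∫⁻ u in segment K p θ, 1 := by
        refine lintegral_mono fun u => ?_
        dsimp only
        by_cases hu : u ∈ A
        · rw [hA0 u hu, indicator_of_mem hu, zero_add]; rfl
        · rw [indicator_of_notMem hu, add_zero]
          exact (splitSum_joins_le x J K _).trans (joins_le_one _ _ _)
    _ = _ := setLIntegral_one _

/-- Separating directions fill an angle of `1 / 4` and each offers positions of length `r / 2`,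
together `r / 8`. Perimeter over integrated width is at least `1 / π`, whence the rate `r / (8 *
π)`. -/
lemma cutRate_joins_add_le {d : ℕ} (hd : 2 ≤ d) {K J : Set (Pt d)} (hK : K ⊆ cube d)
    (hc : Convex ℝ K) {x : Pt d} {i : Fin d} {s r : ℝ} (hs : s = 1 ∨ s = -1) (hr : 0 < r)
    (hJ : ∀ y ∈ J, r ≤ s * (y i - x i) ∧ ∀ j, |y j - x j| ≤ s * (y i - x i))
    (hxK : x ∈ K) (hJK : ∃ y ∈ J, y ∈ K) :
    cutRate K (splitSum (joins x J) K) + ENNReal.ofReal (sepRate * r) ≤ totalPerimeter K := by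
  have hpi := Real.pi_pos
  obtain ⟨y₀, hyJ, hyK⟩ := hJK
  obtain ⟨p₀, hp₀, a, ha0, ha1, hsep⟩ := exists_separating_directions hd i
  have hin : ∀ θ ∈ Ioc a (a + 1 / 4),
      (∫⁻ u in segment K p₀ θ, splitSum (joins x J) K (p₀, θ, u)) + ENNReal.ofReal (r / 2)
        ≤ volume (segment K p₀ θ) := by
    intro θ hθ
    refine lintegral_splitSum_joins_add_le hc hxK hyK hyJ hs fun y hy => ?_
    have h1 := hsep θ hθ (y - x) s (by rcases hs with rfl | rfl <;> simp)
      (by simpa using (hJ y hy).2)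
    have e := (along_isLinearMap p₀ θ).map_sub y x
    rw [e] at h1
    have h2 := (hJ y hy).1
    simp only [PiLp.sub_apply] at h1
    linarith
  have hle : ∀ p θ, ∫⁻ u in segment K p θ, splitSum (joins x J) K (p, θ, u)
      ≤ volume (segment K p θ) := fun p θ => by
    rw [← setLIntegral_one]
    exact lintegral_mono fun u => (splitSum_joins_le x J K _).trans (joins_le_one _ _ _)
  have hX : (∫⁻ θ in Ioc 0 Real.pi, ∫⁻ u in segment K p₀ θ, splitSum (joins x J) K (p₀, θ, u))
      + ENNReal.ofReal (r / 8) ≤ widthIntegral K p₀ := by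
    have hsub : Ioc a (a + 1 / 4) ⊆ Ioc 0 Real.pi := Ioc_subset_Ioc ha0 ha1
    calc _ = (∫⁻ θ in Ioc 0 Real.pi, ∫⁻ u in segment K p₀ θ, splitSum (joins x J) K (p₀, θ, u))
          + ∫⁻ θ in Ioc 0 Real.pi,
            (Ioc a (a + 1 / 4)).indicator (fun _ => ENNReal.ofReal (r / 2)) θ := by
          rw [lintegral_indicator measurableSet_Ioc, setLIntegral_const,
            Measure.restrict_apply measurableSet_Ioc, inter_eq_self_of_subset_left hsub,
            Real.volume_Ioc, ← ENNReal.ofReal_mul (by linarith)]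
          congr 2; ring
      _ = ∫⁻ θ in Ioc 0 Real.pi, ((∫⁻ u in segment K p₀ θ, splitSum (joins x J) K (p₀, θ, u))
            + (Ioc a (a + 1 / 4)).indicator (fun _ => ENNReal.ofReal (r / 2)) θ) := by
          rw [lintegral_add_right _ (measurable_const.indicator measurableSet_Ioc)]
      _ ≤ _ := by
          refine lintegral_mono fun θ => ?_
          dsimp only
          by_cases hθ : θ ∈ Ioc a (a + 1 / 4)
          · rw [indicator_of_mem hθ]; exact hin θ hθ
          · rw [indicator_of_notMem hθ, add_zero]; exact hle p₀ θ
  have hW0 : widthIntegral K p₀ ≠ 0 := fun h0 => by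
    rw [h0] at hX
    have := le_add_self.trans hX
    simp at this
    linarith
  have hL0 : perimeter K p₀ ≠ 0 := fun h0 => by
    have := widthIntegral_le hK p₀
    rw [h0, mul_zero] at this
    exact hW0 (le_antisymm this zero_le)
  have hLt : perimeter K p₀ ≠ ∞ :=
    ((perimeter_le_const hK hc p₀).trans_lt ENNReal.ofReal_lt_top).ne
  have hWt : widthIntegral K p₀ ≠ ∞ := ((widthIntegral_le hK p₀).trans_lt
    (ENNReal.mul_lt_top ENNReal.ofReal_lt_top hLt.lt_top)).ne
  have hratio : ENNReal.ofReal (1 / Real.pi) ≤ perimeter K p₀ * (widthIntegral K p₀)⁻¹ := by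
    rw [← div_eq_mul_inv, ENNReal.le_div_iff_mul_le (Or.inl hW0) (Or.inl hWt)]
    calc _ ≤ ENNReal.ofReal (1 / Real.pi) * (ENNReal.ofReal Real.pi * perimeter K p₀) := by
          gcongr; exact widthIntegral_le hK p₀
      _ = _ := by
          rw [← mul_assoc, ← ENNReal.ofReal_mul (by positivity), one_div_mul_cancel hpi.ne']
          simp
  have hp : perimeter K p₀ * ((widthIntegral K p₀)⁻¹ * ∫⁻ θ in Ioc 0 Real.pi,
      ∫⁻ u in segment K p₀ θ, splitSum (joins x J) K (p₀, θ, u))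
      + ENNReal.ofReal (sepRate * r) ≤ perimeter K p₀ := by
    calc _ ≤ perimeter K p₀ * ((widthIntegral K p₀)⁻¹ * ∫⁻ θ in Ioc 0 Real.pi,
          ∫⁻ u in segment K p₀ θ, splitSum (joins x J) K (p₀, θ, u))
          + perimeter K p₀ * (widthIntegral K p₀)⁻¹ * ENNReal.ofReal (r / 8) := by
          gcongr
          rw [show sepRate * r = 1 / Real.pi * (r / 8) by unfold sepRate; field_simp,
            ENNReal.ofReal_mul (by positivity)]
          gcongr
      _ = perimeter K p₀ * (widthIntegral K p₀)⁻¹ * ((∫⁻ θ in Ioc 0 Real.pi,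
          ∫⁻ u in segment K p₀ θ, splitSum (joins x J) K (p₀, θ, u))
          + ENNReal.ofReal (r / 8)) := by ring
      _ ≤ perimeter K p₀ * (widthIntegral K p₀)⁻¹ * widthIntegral K p₀ := by gcongr
      _ = perimeter K p₀ := by
          rw [mul_assoc, ENNReal.inv_mul_cancel hW0 hWt, mul_one]
  have hrest : ∀ p, perimeter K p * ((widthIntegral K p)⁻¹ * ∫⁻ θ in Ioc 0 Real.pi,
      ∫⁻ u in segment K p θ, splitSum (joins x J) K (p, θ, u)) ≤ perimeter K p := by
    intro p
    calc _ ≤ perimeter K p * ((widthIntegral K p)⁻¹ * widthIntegral K p) := by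
          gcongr
          exact lintegral_mono fun θ => hle p θ
      _ ≤ perimeter K p * 1 := by gcongr; exact ENNReal.inv_mul_le_one _
      _ = _ := mul_one _
  rw [cutRate, totalPerimeter, ← Finset.add_sum_erase _ _ hp₀, ← Finset.add_sum_erase _ _ hp₀,
    add_right_comm]
  exact add_le_add hp (Finset.sum_le_sum fun p _ => hrest p)

/-- A point stays in the same leaf as some point of a distant set with exponentially small
probability. -/
lemma lintegral_tsum_leafSum_joins_le {d : ℕ} (hd : 2 ≤ d) {ν : Measure (Tree d)}
    (hν : IsBSPLaw ν) {τ : ℝ} (hτ : 0 ≤ τ) {J : Set (Pt d)} (hJf : J.Finite) {x : Pt d}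
    {i : Fin d} {s r : ℝ} (hs : s = 1 ∨ s = -1) (hr : 0 ≤ r)
    (hJ : ∀ y ∈ J, r ≤ s * (y i - x i) ∧ ∀ j, |y j - x j| ≤ s * (y i - x i)) :
    ∫⁻ T, ∑' n, leafSum (joins x J) τ n T ∂ν ≤ ENNReal.ofReal (Real.exp (-(sepRate * r * τ))) := by
  have hadd : ∀ K ⊆ cube d, Convex ℝ K → joins x J K ≠ 0 →
      cutRate K (splitSum (joins x J) K) + ENNReal.ofReal (sepRate * r) ≤ totalPerimeter K := by
    intro K hK hc h0
    have h1 : x ∈ K ∧ ∃ y ∈ J, y ∈ K := by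
      by_contra h; exact h0 (if_neg h)
    rcases hr.eq_or_lt with rfl | hr
    · rw [mul_zero, ENNReal.ofReal_zero, add_zero]
      calc _ ≤ cutRate K (fun _ => 1) :=
            cutRate_mono fun q => (splitSum_joins_le x J K q).trans (joins_le_one _ _ _)
        _ ≤ _ := (cutRate_const_le K 1).trans (by rw [one_mul])
    · exact cutRate_joins_add_le hd hK hc hs hr hJ h1.1 h1.2
  have hsr : 0 ≤ sepRate * r := mul_nonneg sepRate_pos.le hr
  have hle : ∀ K ⊆ cube d, Convex ℝ K → joins x J K ≠ 0 →
      0 ≤ (totalPerimeter K).toReal + -(sepRate * r) := fun K hK hc h0 => by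
    have h2 := le_add_self.trans (hadd K hK hc h0)
    rw [← ENNReal.ofReal_toReal (totalPerimeter_ne_top hK hc),
      ENNReal.ofReal_le_ofReal_iff ENNReal.toReal_nonneg] at h2
    linarith
  refine (lintegral_tsum_leafSum_le hν (measurable_joins x hJf)
    (fun K => ((joins_le_one x J K).trans_lt ENNReal.one_lt_top).ne) hτ (l := -(sepRate * r))
    hle fun K hK hc => ?_).trans ?_
  · by_cases h0 : joins x J K = 0
    · rw [cutRate_eq_zero]
      · exact zero_le
      · intro q
        exact le_antisymm ((splitSum_joins_le x J K q).trans h0.le) zero_le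
    · have h1 : joins x J K = 1 := by
        unfold joins at h0 ⊢
        split_ifs at h0 ⊢
        · rfl
        · exact absurd rfl h0
      have h2 := hadd K hK hc h0
      rw [h1, mul_one, ← sub_eq_add_neg, ENNReal.ofReal_sub _ hsr,
        ENNReal.ofReal_toReal (totalPerimeter_ne_top hK hc)]
      exact ENNReal.le_sub_of_add_le_right ENNReal.ofReal_ne_top h2
  · calc _ ≤ ENNReal.ofReal (Real.exp (-(sepRate * r) * τ)) * 1 := by
          gcongr; exact joins_le_one _ _ _
      _ = _ := by rw [mul_one]; congr 2; ring

/-- The mean number of leaves that meet a set of small diameter. -/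
lemma lintegral_tsum_leafSum_touch_le {d : ℕ} {ν : Measure (Tree d)}
    (hν : IsBSPLaw ν) {τ : ℝ} (hτ : 0 ≤ τ) {J : Set (Pt d)} (hJf : J.Finite) {δ : ℝ}
    (hδ : 0 ≤ δ) (hJ : ∀ y ∈ J, ∀ y' ∈ J, ∀ i, |y i - y' i| ≤ δ) :
    ∫⁻ T, ∑' n, leafSum (touch J) τ n T ∂ν
      ≤ ENNReal.ofReal (Real.exp (hitRate d * δ * τ)) := by
  refine (lintegral_tsum_leafSum_le hν (measurable_touch hJf)
    (fun K => ((touch_le_one J K).trans_lt ENNReal.one_lt_top).ne) hτ (l := hitRate d * δ)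
    (fun K _ _ _ => add_nonneg ENNReal.toReal_nonneg (mul_nonneg (hitRate_nonneg d) hδ))
    fun K hK hc => cutRate_touch_le hK hc hδ hJ).trans ?_
  calc _ ≤ ENNReal.ofReal (Real.exp (hitRate d * δ * τ)) * 1 := by
        gcongr; exact touch_le_one _ _
    _ = _ := mul_one _

end BSP

end

noncomputable section

namespace BSP

/-! ### The cells of the partition at a given budget -/

/-- `y` lies in all the blocks present with budget `τ` that contain `x`. -/
def SameCell {d : ℕ} (T : Tree d) (τ : ℝ) (x y : Pt d) : Prop :=
  ∀ w, Alive T τ w → x ∈ block T w → y ∈ block T w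

lemma sameCell_refl {d : ℕ} (T : Tree d) (τ : ℝ) (x : Pt d) : SameCell T τ x x :=
  fun _ _ h => h

lemma block_antitone {d : ℕ} (T : Tree d) {v : List Bool} :
    ∀ {w : List Bool}, v <:+ w → block T w ⊆ block T v
  | [], h => by rw [List.suffix_nil.1 h]
  | b :: w, h => by
    rcases List.suffix_cons_iff.1 h with rfl | h
    · exact Subset.rfl
    · exact inter_subset_left.trans (block_antitone T h)

lemma Alive.of_suffix {d : ℕ} {T : Tree d} {τ : ℝ} {v : List Bool} :
    ∀ {w : List Bool}, Alive T τ w → v <:+ w → Alive T τ v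
  | [], hw, h => by rwa [List.suffix_nil.1 h]
  | b :: w, hw, h => by
    rcases List.suffix_cons_iff.1 h with rfl | h
    · exact hw
    · exact Alive.of_suffix hw.1 h

lemma eq_of_mem_block {d : ℕ} {T : Tree d} {x : Pt d} :
    ∀ {v w : List Bool}, v.length = w.length → x ∈ block T v → x ∈ block T w → v = w
  | [], [], _, _, _ => rfl
  | [], _ :: _, h, _, _ => by simp at h
  | _ :: _, [], h, _, _ => by simp at h
  | a :: v, b :: w, h, hv, hw => by
    have e : v = w := eq_of_mem_block (by simpa using h) hv.1 hw.1
    subst e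
    cases a <;> cases b
    · rfl
    · exact absurd hw.2 (not_mem_side_both hv.2)
    · exact absurd hv.2 (not_mem_side_both hw.2)
    · rfl

lemma suffix_of_mem_block {d : ℕ} {T : Tree d} {x : Pt d} {v w : List Bool}
    (h : v.length ≤ w.length) (hv : x ∈ block T v) (hw : x ∈ block T w) : v <:+ w := by
  have h1 : w.drop (w.length - v.length) <:+ w := List.drop_suffix _ _
  have h2 : v = w.drop (w.length - v.length) :=
    eq_of_mem_block (by rw [List.length_drop]; omega) hv (block_antitone T h1 hw)
  rwa [h2]

/-- The nodes whose blocks contain `x` form a chain under the suffix order. A present node strictly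
below `w` in this chain would require the cut at `w` to fit the budget. -/
lemma Leaf.suffix {d : ℕ} {T : Tree d} {τ : ℝ} {x : Pt d} {v w : List Bool} (hw : Leaf T τ w)
    (hxw : x ∈ block T w) (hv : Alive T τ v) (hxv : x ∈ block T v) : v <:+ w := by
  rcases le_or_gt v.length w.length with h | h
  · exact suffix_of_mem_block h hxv hxw
  · exfalso
    obtain ⟨t, ht⟩ := suffix_of_mem_block h.le hxw hxv
    rcases t.eq_nil_or_concat with rfl | ⟨t', b, rfl⟩
    · simp at ht; subst ht; exact lt_irrefl _ h
    · have h2 : b :: w <:+ v := ⟨t', by rw [← ht]; simp⟩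
      exact absurd (hv.of_suffix h2).2 (not_lt.2 hw.2)

lemma Leaf.sameCell_iff {d : ℕ} {T : Tree d} {τ : ℝ} {x y : Pt d} {w : List Bool}
    (hw : Leaf T τ w) (hx : x ∈ block T w) : SameCell T τ x y ↔ y ∈ block T w :=
  ⟨fun h => h w hw.1 hx, fun h _ hv hxv => block_antitone T (hw.suffix hx hv hxv) h⟩

lemma Leaf.eq_of_mem {d : ℕ} {T : Tree d} {τ : ℝ} {x : Pt d} {v w : List Bool}
    (hw : Leaf T τ w) (hv : Leaf T τ v) (hxw : x ∈ block T w) (hxv : x ∈ block T v) : v = w :=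
  (hw.suffix hxw hv.1 hxv).eq_of_length_le (hv.suffix hxv hw.1 hxw).length_le

lemma measurableSet_sameCell {d : ℕ} (τ : ℝ) :
    MeasurableSet {z : Tree d × Pt d × Pt d | SameCell z.1 τ z.2.1 z.2.2} := by
  have : {z : Tree d × Pt d × Pt d | SameCell z.1 τ z.2.1 z.2.2}
      = ⋂ w, ({z | Alive z.1 τ w}ᶜ ∪ ({z | z.2.1 ∈ block z.1 w}ᶜ ∪
        {z | z.2.2 ∈ block z.1 w})) := by
    ext z
    simp only [SameCell, mem_ofPred_eq, mem_iInter, mem_union, mem_compl_iff, imp_iff_not_or]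
  rw [this]
  refine MeasurableSet.iInter fun w => ?_
  refine (((measurableSet_alive τ w).preimage measurable_fst).compl).union (MeasurableSet.union
    (MeasurableSet.compl ?_) ?_)
  · exact (measurableSet_block w).preimage
      (by fun_prop : Measurable fun z : Tree d × Pt d × Pt d => (z.1, z.2.1))
  · exact (measurableSet_block w).preimage
      (by fun_prop : Measurable fun z : Tree d × Pt d × Pt d => (z.1, z.2.2))

/-- The sum of `f` over a finite set of nodes is at most its sum over all levels. -/
lemma sum_le_tsum_level (f : List Bool → ℝ≥0∞) (W : Finset (List Bool)) :
    ∑ w ∈ W, f w ≤ ∑' n, ∑ w ∈ level n, f w := by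
  classical
  rw [← Finset.sum_fiberwise_of_maps_to (t := W.image List.length) (g := List.length)
    (fun w hw => Finset.mem_image_of_mem _ hw)]
  refine le_trans (Finset.sum_le_sum fun n _ => ?_) (ENNReal.sum_le_tsum (W.image List.length))
  refine Finset.sum_le_sum_of_subset fun w hw => ?_
  exact mem_level.2 (Finset.mem_filter.1 hw).2

lemma measurable_tsum_leafSum {d : ℕ} {G : Set (Pt d) → ℝ≥0∞}
    (hG : ∀ w, Measurable fun T : Tree d => G (block T w)) (τ : ℝ) :
    Measurable fun T => ∑' n, leafSum G τ n T :=
  Measurable.tsum fun n => measurable_leafSum hG τ n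

/-- Markov's inequality: almost surely `x` lies in a leaf, and on the event that leaf contains `x`
and meets `J`, so the sum over leaves is at least `1`. -/
lemma measure_sameCell_cone_le {d : ℕ} (hd : 2 ≤ d) {ν : Measure (Tree d)} (hν : IsBSPLaw ν)
    {τ : ℝ} (hτ : 0 ≤ τ) {J : Set (Pt d)} (hJf : J.Finite) {x : Pt d} (hx : x ∈ cube d)
    {i : Fin d} {s r : ℝ} (hs : s = 1 ∨ s = -1) (hr : 0 ≤ r)
    (hJ : ∀ y ∈ J, r ≤ s * (y i - x i) ∧ ∀ j, |y j - x j| ≤ s * (y i - x i)) :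
    ν {T | ∃ y ∈ J, SameCell T τ x y} ≤ ENNReal.ofReal (Real.exp (-(sepRate * r * τ))) := by
  have h1 := mul_meas_ge_le_lintegral (μ := ν)
    (measurable_tsum_leafSum (measurable_joins x hJf) τ) 1
  rw [one_mul] at h1
  refine le_trans (measure_mono_ae ?_)
    (h1.trans (lintegral_tsum_leafSum_joins_le hd hν hτ hJf hs hr hJ))
  filter_upwards [ae_exists_leaf hν hτ hx] with T hT hmem
  obtain ⟨y, hy, hxy⟩ := hmem
  obtain ⟨w, hw, hxw⟩ := hT
  refine le_trans ?_ (sum_le_tsum_level _ {w})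
  rw [Finset.sum_singleton, indicator_of_mem (show T ∈ {T | Leaf T τ w} from hw), joins,
    if_pos ⟨hxw, y, hy, hxy w hw.1 hxw⟩]

/-- The largest difference of the coordinates. -/
def supDist {d : ℕ} (x y : Pt d) : ℝ := dist (WithLp.ofLp x) (WithLp.ofLp y)

/-- It is exponentially unlikely that some point at distance `r` is in the cell of `x`. -/
lemma measure_sameCell_far_le {d : ℕ} (hd : 2 ≤ d) {ν : Measure (Tree d)} (hν : IsBSPLaw ν)
    {τ : ℝ} (hτ : 0 ≤ τ) {n : ℕ} (z : Fin n → Pt d) {x : Pt d} (hx : x ∈ cube d) {r : ℝ}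
    (hr : 0 ≤ r) :
    ν {T | ∃ i, SameCell T τ x (z i) ∧ r ≤ supDist x (z i)}
      ≤ 2 * d * ENNReal.ofReal (Real.exp (-(sepRate * r * τ))) := by
  have : Nonempty (Fin d) := ⟨⟨0, by omega⟩⟩
  set S : Bool → ℝ := fun b => if b then 1 else -1 with hS
  have hS1 : ∀ b, S b = 1 ∨ S b = -1 := fun b => by cases b <;> simp [hS]
  -- The points are sorted by the signed coordinate axis along which they differ most from `x`. The
  -- union bound runs over these `2 * d` cones and not over the points, so the constant does not
  -- depend on `n`.
  set J : Fin d × Bool → Set (Pt d) := fun q => range z ∩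
    {y | r ≤ S q.2 * (y q.1 - x q.1) ∧ ∀ j, |y j - x j| ≤ S q.2 * (y q.1 - x q.1)} with hJ
  calc _ ≤ ν (⋃ q : Fin d × Bool, {T | ∃ y ∈ J q, SameCell T τ x y}) := by
        refine measure_mono ?_
        rintro T ⟨i, hi, hri⟩
        obtain ⟨j, hj⟩ := Finite.exists_max fun j => |z i j - x j|
        have hrj : r ≤ |z i j - x j| := hri.trans ((dist_pi_le_iff (abs_nonneg _)).2 fun l => by
          rw [Real.dist_eq, abs_sub_comm]; exact hj l)
        rw [mem_iUnion]
        rcases le_total 0 (z i j - x j) with h0 | h0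
        · refine ⟨(j, true), z i, ⟨mem_range_self i, ?_⟩, hi⟩
          rw [abs_of_nonneg h0] at hj hrj
          simpa [hS] using ⟨hrj, hj⟩
        · refine ⟨(j, false), z i, ⟨mem_range_self i, ?_⟩, hi⟩
          rw [abs_of_nonpos h0] at hj hrj
          have e : S false = -1 := by simp [hS]
          refine ⟨?_, fun l => ?_⟩
          · rw [e]; linarith
          · rw [e]; linarith [hj l]
    _ ≤ ∑ q : Fin d × Bool, ν {T | ∃ y ∈ J q, SameCell T τ x y} := measure_iUnion_fintype_le _ _
    _ ≤ ∑ _q : Fin d × Bool, ENNReal.ofReal (Real.exp (-(sepRate * r * τ))) :=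
        Finset.sum_le_sum fun q _ => measure_sameCell_cone_le hd hν hτ
          ((finite_range z).inter_of_left _) hx (hS1 q.2) hr fun y hy => hy.2
    _ = _ := by
        rw [Finset.sum_const, Finset.card_univ, Fintype.card_prod, Fintype.card_fin,
          Fintype.card_bool, nsmul_eq_mul]
        push_cast; ring

/-- The number of the points `z i`, `i ∈ I`, in the cell of `x`. -/
def cellCount {d : ℕ} {ι : Type*} (T : Tree d) (τ : ℝ) (I : Finset ι) (z : ι → Pt d) (x : Pt d) :
    ℝ≥0∞ := ∑ j ∈ I, {y | SameCell T τ x y}.indicator 1 (z j)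

/-- The members of each nonempty fibre contribute `1` in total. -/
lemma sum_inv_card_fiber {ι κ : Type*} [DecidableEq κ] (I : Finset ι) (f : ι → κ) :
    ∑ i ∈ I, ((I.filter fun j => f j = f i).card : ℝ≥0∞)⁻¹ = (I.image f).card := by
  rw [← Finset.sum_fiberwise_of_maps_to (t := I.image f) (g := f)
    (fun i hi => Finset.mem_image_of_mem _ hi), Finset.card_eq_sum_ones, Nat.cast_sum]
  refine Finset.sum_congr rfl fun w hw => ?_
  obtain ⟨i, hi, rfl⟩ := Finset.mem_image.1 hw
  have h0 : (I.filter fun j => f j = f i).card ≠ 0 :=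
    Finset.card_ne_zero.2 ⟨i, Finset.mem_filter.2 ⟨hi, rfl⟩⟩
  calc _ = ∑ _j ∈ I.filter fun j => f j = f i,
        ((I.filter fun j => f j = f i).card : ℝ≥0∞)⁻¹ := by
        refine Finset.sum_congr rfl fun j hj => ?_
        rw [(Finset.mem_filter.1 hj).2]
    _ = _ := by
        rw [Finset.sum_const, nsmul_eq_mul, ENNReal.mul_inv_cancel (by exact_mod_cast h0)
          (ENNReal.natCast_ne_top _), Nat.cast_one]

/-- The mean number of cells occupied by finitely many points in a set of small diameter. -/
lemma lintegral_sum_inv_cellCount_le_of_close {d : ℕ} {ν : Measure (Tree d)} (hν : IsBSPLaw ν)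
    {τ : ℝ} (hτ : 0 ≤ τ) {ι : Type*} (I : Finset ι) {z : ι → Pt d} (hz : ∀ i ∈ I, z i ∈ cube d)
    {δ : ℝ} (hδ : 0 ≤ δ) (hclose : ∀ i ∈ I, ∀ j ∈ I, ∀ l, |z i l - z j l| ≤ δ) :
    ∫⁻ T, ∑ i ∈ I, (cellCount T τ I z (z i))⁻¹ ∂ν
      ≤ ENNReal.ofReal (Real.exp (hitRate d * δ * τ)) := by
  classical
  refine le_trans (lintegral_mono_ae ?_) (lintegral_tsum_leafSum_touch_le hν hτ
    (J := z '' I) (I.finite_toSet.image z) hδ ?_)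
  · have hall : ∀ᵐ T ∂ν, ∀ i ∈ I, ∃ w, Leaf T τ w ∧ z i ∈ block T w :=
      (ae_ball_iff I.countable_toSet).2 fun i hi => ae_exists_leaf hν hτ (hz i hi)
    filter_upwards [hall] with T hT
    choose! f hf hzf using hT
    have hcount : ∀ i ∈ I, cellCount T τ I z (z i) = (I.filter fun j => f j = f i).card := by
      intro i hi
      rw [cellCount, Finset.card_filter, Nat.cast_sum]
      refine Finset.sum_congr rfl fun j hj => ?_
      by_cases hji : f j = f i
      · rw [if_pos hji, indicator_of_mem]
        · simp
        · exact ((hf i hi).sameCell_iff (hzf i hi)).2 (hji ▸ hzf j hj)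
      · rw [if_neg hji, indicator_of_notMem]
        · simp
        · intro h
          exact hji ((hf i hi).eq_of_mem (hf j hj)
            (((hf i hi).sameCell_iff (hzf i hi)).1 h) (hzf j hj))
    calc ∑ i ∈ I, (cellCount T τ I z (z i))⁻¹
        = ∑ i ∈ I, ((I.filter fun j => f j = f i).card : ℝ≥0∞)⁻¹ :=
          Finset.sum_congr rfl fun i hi => by rw [hcount i hi]
      _ = ∑ w ∈ I.image f, 1 := by rw [sum_inv_card_fiber]; simp
      _ ≤ ∑ w ∈ I.image f,
          {T | Leaf T τ w}.indicator (fun T => touch (z '' I) (block T w)) T := by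
          refine Finset.sum_le_sum fun w hw => ?_
          obtain ⟨i, hi, rfl⟩ := Finset.mem_image.1 hw
          rw [indicator_of_mem (show T ∈ {T | Leaf T τ (f i)} from hf i hi), touch,
            if_pos ⟨z i, mem_image_of_mem z hi, hzf i hi⟩]
      _ ≤ _ := sum_le_tsum_level _ _
  · rintro _ ⟨i, hi, rfl⟩ _ ⟨j, hj, rfl⟩ l
    exact hclose i hi j hj l

lemma cellCount_mono {d : ℕ} {ι : Type*} (T : Tree d) (τ : ℝ) {I J : Finset ι} (h : I ⊆ J)
    (z : ι → Pt d) (x : Pt d) : cellCount T τ I z x ≤ cellCount T τ J z x :=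
  Finset.sum_le_sum_of_subset h

/-- The minimum with `k - 1` puts the endpoint `1` into the last of the `k` intervals. -/
lemma abs_sub_le_of_floor_eq {k : ℕ} (hk : 0 < k) {s t : ℝ} (hs : s ∈ Icc (0 : ℝ) 1)
    (ht : t ∈ Icc (0 : ℝ) 1) (h : min ⌊k * s⌋₊ (k - 1) = min ⌊k * t⌋₊ (k - 1)) :
    |s - t| ≤ 1 / k := by
  have hk' : (0 : ℝ) < k := by exact_mod_cast hk
  have key : ∀ t ∈ Icc (0 : ℝ) 1, ((min ⌊k * t⌋₊ (k - 1) : ℕ) : ℝ) ≤ k * t ∧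
      k * t ≤ (min ⌊k * t⌋₊ (k - 1) : ℕ) + 1 := by
    intro t ht
    have h0 : (0 : ℝ) ≤ k * t := mul_nonneg hk'.le ht.1
    constructor
    · refine le_trans ?_ (Nat.floor_le h0)
      exact_mod_cast min_le_left _ _
    · rcases le_total ⌊k * t⌋₊ (k - 1) with h1 | h1
      · rw [min_eq_left h1]; exact (Nat.lt_floor_add_one _).le
      · rw [min_eq_right h1, Nat.cast_sub hk, Nat.cast_one, sub_add_cancel]
        nlinarith [ht.2]
  obtain ⟨h1, h2⟩ := key s hs
  obtain ⟨h3, h4⟩ := key t ht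
  rw [h] at h1 h2
  rw [abs_le, le_div_iff₀ hk', neg_le, le_div_iff₀ hk']
  constructor <;> linarith

/-- The mean number of cells occupied by finitely many points. -/
lemma lintegral_sum_inv_cellCount_le {d : ℕ} {ν : Measure (Tree d)} (hν : IsBSPLaw ν)
    {τ : ℝ} (hτ : 0 ≤ τ) {ι : Type*} [Fintype ι] {z : ι → Pt d} (hz : ∀ i, z i ∈ cube d)
    {k : ℕ} (hk : 0 < k) (hτk : τ ≤ k) :
    ∫⁻ T, ∑ i, (cellCount T τ Finset.univ z (z i))⁻¹ ∂ν
      ≤ k ^ d * ENNReal.ofReal (Real.exp (hitRate d)) := by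
  classical
  -- The cube is divided into `k ^ d` cubes of side `1 / k ≤ 1 / τ`, so that `δ * τ ≤ 1` and each
  -- contributes at most `exp (hitRate d)`.
  set q : ι → Fin d → Fin k := fun i l => ⟨min ⌊k * z i l⌋₊ (k - 1), by omega⟩ with hq
  set J : (Fin d → Fin k) → Set (Pt d) := fun Q => z '' {i | q i = Q} with hJ
  have hk' : (0 : ℝ) < k := by exact_mod_cast hk
  have hcell : ∀ x y : Pt d, MeasurableSet {T : Tree d | SameCell T τ x y} := fun x y =>
    (measurableSet_sameCell τ).preimage (by fun_prop : Measurable fun T : Tree d => (T, x, y))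
  have hm : ∀ (I : Finset ι) (x : Pt d), Measurable fun T => cellCount T τ I z x := fun I x => by
    refine Finset.measurable_fun_sum _ fun j _ => ?_
    exact (measurable_const (a := (1 : ℝ≥0∞))).indicator (hcell x (z j))
  calc _ ≤ ∫⁻ T, ∑ Q : Fin d → Fin k, ∑ i ∈ Finset.univ.filter fun i => q i = Q,
        (cellCount T τ (Finset.univ.filter fun i => q i = Q) z (z i))⁻¹ ∂ν := by
        refine lintegral_mono fun T => ?_
        dsimp only
        rw [← Finset.sum_fiberwise (s := Finset.univ) (g := q)]
        refine Finset.sum_le_sum fun Q _ => Finset.sum_le_sum fun i _ => ?_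
        -- Counting only the points of the same small cube lowers the count and raises its inverse.
        exact ENNReal.inv_le_inv.2 (cellCount_mono T τ (Finset.filter_subset _ _) z _)
    _ = ∑ Q : Fin d → Fin k, ∫⁻ T, ∑ i ∈ Finset.univ.filter fun i => q i = Q,
        (cellCount T τ (Finset.univ.filter fun i => q i = Q) z (z i))⁻¹ ∂ν :=
        lintegral_finsetSum _ fun Q _ => Finset.measurable_fun_sum _ fun i _ => (hm _ _).inv
    _ ≤ ∑ _Q : Fin d → Fin k, ENNReal.ofReal (Real.exp (hitRate d)) := by
        refine Finset.sum_le_sum fun Q _ => ?_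
        refine (lintegral_sum_inv_cellCount_le_of_close hν hτ _ (fun i _ => hz i)
          (δ := 1 / k) (by positivity) ?_).trans ?_
        · intro i hi j hj l
          refine abs_sub_le_of_floor_eq hk (hz i l) (hz j l) ?_
          have h1 := (Finset.mem_filter.1 hi).2.trans (Finset.mem_filter.1 hj).2.symm
          have h2 := congrArg Fin.val (congrFun h1 l)
          simpa [hq] using h2
        · apply ENNReal.ofReal_le_ofReal
          apply Real.exp_le_exp.2
          rw [mul_assoc]
          refine mul_le_of_le_one_right (hitRate_nonneg d) ?_
          rw [one_div, inv_mul_le_iff₀ hk', mul_one]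
          exact hτk
    _ = _ := by
        rw [Finset.sum_const, Finset.card_univ, Fintype.card_fun, Fintype.card_fin,
          Fintype.card_fin, nsmul_eq_mul]
        push_cast; rfl

/-! ### The leaf blocks of the estimator -/

lemma IsNode.alive {d n : ℕ} {T : Tree d} {τ : ℝ} {m : ℕ} {D : Data d n} :
    ∀ {w}, IsNode T τ m D w → Alive T τ w
  | [], _ => trivial
  | _ :: _, h => ⟨h.1.alive, h.2.1⟩

lemma mem_leafBlock_of_sameCell {d n : ℕ} {T : Tree d} {τ : ℝ} {m : ℕ} {D : Data d n}
    {x y : Pt d} (hy : y ∈ cube d) (h : SameCell T τ x y) : y ∈ leafBlock T τ m D x :=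
  ⟨hy, fun w hw hx => h w hw.alive hx⟩

/-- The leaf block either holds at most `m` points or is a cell of the unrestricted partition. -/
lemma leafBlock_small_or_sameCell {d n : ℕ} (T : Tree d) (τ : ℝ) (m : ℕ) (D : Data d n)
    (x : Pt d) : {i | (D i).1 ∈ leafBlock T τ m D x}.ncard ≤ m ∨
      ∀ y ∈ leafBlock T τ m D x, SameCell T τ x y := by
  by_cases h : ∀ w, Alive T τ w → x ∈ block T w → IsNode T τ m D w
  · exact Or.inr fun y hy w hw hx => hy.2 w (h w hw hx) hx
  · left
    push Not at h
    obtain ⟨w, hw, hx, hn⟩ := h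
    induction w with
    | nil => exact absurd trivial hn
    | cons b v ih =>
      -- Going up from `w`, some missing node has a parent that is present. As the budget allows the
      -- cut of this parent, it was refused because the parent holds at most `m` points.
      by_cases hv : IsNode T τ m D v
      · have hm : {i | (D i).1 ∈ block T v}.ncard ≤ m := by
          by_contra! hlt
          exact hn ⟨hv, hw.2, hlt⟩
        refine le_trans (ncard_le_ncard (fun i hi => ?_) (toFinite _)) hm
        exact hi.2 v hv hx.1
      · exact ih hw.1 hx.1 hv

end BSP

end

noncomputable section

namespace BSP

/-! ### Conditioning on the features -/

lemma lintegral_pi_prod {ι : Type*} [Fintype ι] {Ω : Type*} [MeasurableSpace Ω]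
    (μ : Measure Ω) [IsProbabilityMeasure μ] (f : ι → Ω → ℝ≥0∞) (hf : ∀ i, Measurable (f i)) :
    ∫⁻ X : ι → Ω, ∏ i, f i (X i) ∂(Measure.pi fun _ => μ) = ∏ i, ∫⁻ x, f i x ∂μ := by
  rw [lintegral_prod_eq_prod_lintegral_of_indepFun Finset.univ (fun i (X : ι → Ω) => f i (X i))
    (iIndepFun_pi fun i => (hf i).aemeasurable) fun i => (hf i).comp (measurable_pi_apply i)]
  refine Finset.prod_congr rfl fun i _ => ?_
  exact (measurePreserving_eval (fun _ : ι => μ) i).lintegral_comp (hf i)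

section Labels

variable {Ω : Type*} [MeasurableSpace Ω] {n : ℕ}

/-- The law of the labelled data given the features. -/
def dataLaw (κ : Kernel Ω ℝ) (X : Fin n → Ω) : Measure (Fin n → Ω × ℝ) :=
  (Measure.pi fun i => κ (X i)).map fun Y i => (X i, Y i)

lemma measurable_zip (X : Fin n → Ω) : Measurable fun (Y : Fin n → ℝ) i => (X i, Y i) :=
  measurable_pi_lambda _ fun i => by fun_prop

lemma dataLaw_pi (κ : Kernel Ω ℝ) [IsMarkovKernel κ] (X : Fin n → Ω) {s : Fin n → Set (Ω × ℝ)}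
    (hs : ∀ i, MeasurableSet (s i)) :
    dataLaw κ X (univ.pi s) = ∏ i, κ (X i) (Prod.mk (X i) ⁻¹' s i) := by
  rw [dataLaw, Measure.map_apply (measurable_zip X) (MeasurableSet.univ_pi hs), ← Measure.pi_pi]
  congr 1

lemma measurable_dataLaw (κ : Kernel Ω ℝ) [IsMarkovKernel κ] :
    Measurable (dataLaw κ : (Fin n → Ω) → Measure (Fin n → Ω × ℝ)) := by
  have : ∀ X : Fin n → Ω, IsProbabilityMeasure (dataLaw κ X) := fun X =>
    Measure.isProbabilityMeasure_map (measurable_zip X).aemeasurable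
  refine Measurable.measure_of_isPiSystem_of_isProbabilityMeasure generateFrom_pi.symm
    isPiSystem_pi ?_
  rintro _ ⟨s, hs, rfl⟩
  have hs' : ∀ i, MeasurableSet (s i) := fun i => hs i (mem_univ i)
  simp_rw [dataLaw_pi κ _ hs']
  exact Finset.measurable_fun_prod _ fun i _ =>
    (Kernel.measurable_kernel_prodMk_left (hs' i)).comp (measurable_pi_apply i)

/-- I.i.d. labelled data can be drawn by taking all features first and then independent labels; the
two laws agree on boxes. -/
lemma lintegral_pi_compProd (μ : Measure Ω) [IsProbabilityMeasure μ] (κ : Kernel Ω ℝ)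
    [IsMarkovKernel κ] {F : (Fin n → Ω × ℝ) → ℝ≥0∞} (hF : Measurable F) :
    ∫⁻ D, F D ∂(Measure.pi fun _ => μ.compProd κ)
      = ∫⁻ X, ∫⁻ Y, F (fun i => (X i, Y i)) ∂(Measure.pi fun i => κ (X i))
        ∂(Measure.pi fun _ => μ) := by
  have e : (Measure.pi fun _ : Fin n => μ.compProd κ)
      = (Measure.pi fun _ => μ).bind (dataLaw κ) := by
    refine Measure.pi_eq fun s hs => ?_
    rw [Measure.bind_apply (MeasurableSet.univ_pi hs) (measurable_dataLaw κ).aemeasurable]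
    simp_rw [dataLaw_pi κ _ hs]
    rw [lintegral_pi_prod μ (fun i x => κ x (Prod.mk x ⁻¹' s i))
      fun i => Kernel.measurable_kernel_prodMk_left (hs i)]
    exact Finset.prod_congr rfl fun i _ => (Measure.compProd_apply (hs i)).symm
  rw [e, Measure.lintegral_bind (measurable_dataLaw κ).aemeasurable hF.aemeasurable]
  refine lintegral_congr fun X => ?_
  rw [dataLaw, lintegral_map hF (measurable_zip X)]

end Labels

/-- Bias and variance of a weighted sum of independent labels. -/
lemma lintegral_sq_sub_weighted_sum_le {n : ℕ} (ρ : Fin n → Measure ℝ)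
    [∀ i, IsProbabilityMeasure (ρ i)] (h2 : ∀ i, MemLp id 2 (ρ i)) {a : Fin n → ℝ}
    (hmean : ∀ i, ∫ y, y ∂(ρ i) = a i) {v : ℝ} (hvar : ∀ i, Var[id; ρ i] ≤ v) (c : ℝ)
    (W : Fin n → ℝ) :
    ∫⁻ Y, ENNReal.ofReal ((c - ∑ i, W i * Y i) ^ 2) ∂(Measure.pi ρ)
      ≤ ENNReal.ofReal ((c - ∑ i, W i * a i) ^ 2 + v * ∑ i, W i ^ 2) := by
  set S : (Fin n → ℝ) → ℝ := fun Y => ∑ i, W i * Y i with hS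
  have hmp : ∀ i, MeasurePreserving (Function.eval i) (Measure.pi ρ) (ρ i) :=
    fun i => measurePreserving_eval ρ i
  have hY : ∀ i, MemLp (fun Y : Fin n → ℝ => W i * Y i) 2 (Measure.pi ρ) := fun i =>
    ((h2 i).comp_measurePreserving (hmp i)).const_mul (W i)
  have hSL : MemLp S 2 (Measure.pi ρ) := memLp_finsetSum _ fun i _ => hY i
  have hES : ∫ Y, S Y ∂(Measure.pi ρ) = ∑ i, W i * a i := by
    rw [hS, integral_finsetSum _ fun i _ => (hY i).integrable one_le_two]
    refine Finset.sum_congr rfl fun i _ => ?_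
    rw [integral_const_mul]
    congr 1
    rw [← hmean i]
    exact integral_comp_eval (X := fun _ => ℝ) (f := fun y : ℝ => y)
      aestronglyMeasurable_id
  have hVS : Var[S; Measure.pi ρ] ≤ v * ∑ i, W i ^ 2 := by
    have h1 := variance_sum_pi (μ := ρ) (X := fun i y => W i * y)
      (fun i => (h2 i).const_mul (W i))
    have e : S = ∑ i, fun ω : Fin n → ℝ => W i * ω i := by
      ext Y; simp [hS]
    rw [e, h1, Finset.mul_sum]
    refine Finset.sum_le_sum fun i _ => ?_
    rw [variance_const_mul, mul_comm v]
    exact mul_le_mul_of_nonneg_left (hvar i) (sq_nonneg _)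
  have hcS : MemLp (fun Y => c - S Y) 2 (Measure.pi ρ) := (memLp_const c).sub hSL
  have hsq : ∫ Y, (c - S Y) ^ 2 ∂(Measure.pi ρ)
      = Var[S; Measure.pi ρ] + (c - ∑ i, W i * a i) ^ 2 := by
    have h1 := variance_eq_sub hcS
    rw [variance_const_sub hSL.aestronglyMeasurable] at h1
    have h3 : ∫ Y, (c - S Y) ∂(Measure.pi ρ) = c - ∑ i, W i * a i := by
      rw [integral_sub (integrable_const c) (hSL.integrable one_le_two), hES]
      simp
    rw [h3] at h1
    simp only [Pi.pow_apply] at h1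
    linarith
  rw [← ofReal_integral_eq_lintegral_ofReal hcS.integrable_sq
    (Eventually.of_forall fun Y => sq_nonneg _), hsq]
  apply ENNReal.ofReal_le_ofReal
  linarith

end BSP

end

noncomputable section

namespace BSP

/-! ### The error given the partition and the features -/

lemma sq_dist_le {d : ℕ} (x y : Pt d) : dist x y ^ 2 ≤ d * supDist x y ^ 2 := by
  rw [EuclideanSpace.dist_eq, Real.sq_sqrt (by positivity)]
  calc ∑ i, dist (x i) (y i) ^ 2 ≤ ∑ _i : Fin d, supDist x y ^ 2 := by
        refine Finset.sum_le_sum fun i _ => ?_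
        exact pow_le_pow_left₀ dist_nonneg (dist_le_pi_dist (WithLp.ofLp x) (WithLp.ofLp y) i) 2
    _ = _ := by simp

/-- Some point of the cell of `x` is at distance at least `r` from `x`. -/
def FarInCell {d n : ℕ} (T : Tree d) (τ : ℝ) (x : Pt d) (X : Fin n → Pt d) (r : ℝ) : Prop :=
  ∃ i, SameCell T τ x (X i) ∧ r ≤ supDist x (X i)

open Classical in
/-- Indicator of `FarInCell`. -/
def farInd {d n : ℕ} (T : Tree d) (τ : ℝ) (x : Pt d) (X : Fin n → Pt d) (r : ℝ) : ℝ≥0∞ :=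
  if FarInCell T τ x X r then 1 else 0

/-- An upper bound for `τ ^ 2` times the squared radius of the cell of `x`. -/
def radiusBound {d n : ℕ} (T : Tree d) (τ : ℝ) (x : Pt d) (X : Fin n → Pt d) : ℝ≥0∞ :=
  ∑' k : ℕ, (2 * k + 1) * farInd T τ x X (k / τ)

lemma sum_odd (k : ℕ) : ∑ j ∈ Finset.range k, (2 * (j : ℝ≥0∞) + 1) = (k : ℝ≥0∞) ^ 2 := by
  induction k with
  | zero => simp
  | succ k ih => rw [Finset.sum_range_succ, ih]; push_cast; ring

/-- A discrete layer-cake sum: `k ^ 2` is the sum of the first `k` odd numbers, and the point `X i`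
exceeds every threshold `j / τ` with `j ≤ τ * supDist x (X i)`. -/
lemma sq_supDist_le_radiusBound {d n : ℕ} {T : Tree d} {τ : ℝ} (hτ : 0 < τ) {x : Pt d}
    {X : Fin n → Pt d} {i : Fin n} (h : SameCell T τ x (X i)) :
    ENNReal.ofReal ((τ * supDist x (X i)) ^ 2) ≤ radiusBound T τ x X := by
  set S := supDist x (X i) with hS
  have hS0 : 0 ≤ S := dist_nonneg
  set k := ⌊τ * S⌋₊ + 1 with hk
  have h0 : 0 ≤ τ * S := by positivity
  calc ENNReal.ofReal ((τ * S) ^ 2) ≤ ENNReal.ofReal ((k : ℝ) ^ 2) := by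
        apply ENNReal.ofReal_le_ofReal
        refine pow_le_pow_left₀ h0 ?_ 2
        rw [hk]; push_cast
        exact (Nat.lt_floor_add_one _).le
    _ = (k : ℝ≥0∞) ^ 2 := by rw [ENNReal.ofReal_pow (by positivity), ENNReal.ofReal_natCast]
    _ = ∑ j ∈ Finset.range k, (2 * (j : ℝ≥0∞) + 1) := (sum_odd k).symm
    _ = ∑ j ∈ Finset.range k, (2 * (j : ℝ≥0∞) + 1) * farInd T τ x X (j / τ) := by
        refine Finset.sum_congr rfl fun j hj => ?_
        have hj' : j ≤ ⌊τ * S⌋₊ := Nat.lt_succ_iff.1 (Finset.mem_range.1 hj)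
        have : FarInCell T τ x X (j / τ) := by
          refine ⟨i, h, ?_⟩
          rw [div_le_iff₀ hτ, mul_comm]
          exact (Nat.cast_le.2 hj').trans (Nat.floor_le h0)
        rw [farInd, if_pos this, mul_one]
    _ ≤ _ := ENNReal.sum_le_tsum _

/-- The weights of the labels in the mean over a block. -/
def blockWeight {d n : ℕ} (X : Fin n → Pt d) (A : Set (Pt d)) (i : Fin n) : ℝ :=
  A.indicator 1 (X i) / ({i | X i ∈ A}.ncard : ℝ)

lemma labelMean_eq {d n : ℕ} (X : Fin n → Pt d) (Y : Fin n → ℝ) (A : Set (Pt d)) :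
    labelMean (fun i => (X i, Y i)) A = ∑ i, blockWeight X A i * Y i := by
  rw [labelMean, Finset.sum_div]
  refine Finset.sum_congr rfl fun i _ => ?_
  by_cases h : X i ∈ A
  · simp [blockWeight, h]; ring
  · simp [blockWeight, h]

section Weights

variable {d n : ℕ} (X : Fin n → Pt d) (A : Set (Pt d))

lemma blockWeight_nonneg (i : Fin n) : 0 ≤ blockWeight X A i :=
  div_nonneg (indicator_nonneg (fun _ _ => zero_le_one) _) (Nat.cast_nonneg _)

lemma sum_indicator_eq_ncard :
    ∑ i, A.indicator (1 : Pt d → ℝ) (X i) = ({i | X i ∈ A}.ncard : ℝ) := by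
  classical
  have : {i | X i ∈ A} = (Finset.univ.filter fun i => X i ∈ A : Finset (Fin n)) := by
    ext; simp
  rw [this, ncard_coe_finset, Finset.card_filter, Nat.cast_sum]
  refine Finset.sum_congr rfl fun i _ => ?_
  by_cases h : X i ∈ A <;> simp [h]

variable {X A}

lemma sum_blockWeight (h : {i | X i ∈ A}.ncard ≠ 0) : ∑ i, blockWeight X A i = 1 := by
  simp only [blockWeight]
  rw [← Finset.sum_div, sum_indicator_eq_ncard, div_self (by exact_mod_cast h)]

lemma sum_sq_blockWeight (h : {i | X i ∈ A}.ncard ≠ 0) :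
    ∑ i, blockWeight X A i ^ 2 = 1 / ({i | X i ∈ A}.ncard : ℝ) := by
  have h' : ({i | X i ∈ A}.ncard : ℝ) ≠ 0 := by exact_mod_cast h
  have e : ∀ i, blockWeight X A i ^ 2
      = A.indicator (1 : Pt d → ℝ) (X i) / ({i | X i ∈ A}.ncard : ℝ) ^ 2 := fun i => by
    by_cases hi : X i ∈ A <;> simp [blockWeight, hi]
  simp_rw [e]
  rw [← Finset.sum_div, sum_indicator_eq_ncard]
  field_simp

lemma sq_sub_weighted_le (h : {i | X i ∈ A}.ncard ≠ 0) {a : Fin n → ℝ} {c R : ℝ}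
    (hR : ∀ i, X i ∈ A → |c - a i| ≤ R) : (c - ∑ i, blockWeight X A i * a i) ^ 2 ≤ R ^ 2 := by
  have e : c - ∑ i, blockWeight X A i * a i = ∑ i, blockWeight X A i * (c - a i) := by
    simp_rw [mul_sub]
    rw [Finset.sum_sub_distrib, ← Finset.sum_mul, sum_blockWeight h, one_mul]
  rw [e]
  apply sq_le_sq'
  · rw [← neg_le_neg_iff, neg_neg, ← Finset.sum_neg_distrib, ← one_mul R, ← sum_blockWeight h,
      Finset.sum_mul]
    refine Finset.sum_le_sum fun i _ => ?_
    by_cases hi : X i ∈ A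
    · nlinarith [blockWeight_nonneg X A i, (abs_le.1 (hR i hi)).1]
    · simp [blockWeight, hi]
  · rw [← one_mul R, ← sum_blockWeight h, Finset.sum_mul]
    refine Finset.sum_le_sum fun i _ => ?_
    by_cases hi : X i ∈ A
    · nlinarith [blockWeight_nonneg X A i, (abs_le.1 (hR i hi)).2]
    · simp [blockWeight, hi]

end Weights

/-- A bound for the mean squared error at `x` given the tree and the features. -/
def errorBound {d n : ℕ} (L : ℝ≥0) (B : ℝ) (σ : ℝ≥0) (m : ℕ) (T : Tree d) (τ : ℝ) (x : Pt d)
    (X : Fin n → Pt d) : ℝ≥0∞ :=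
  ENNReal.ofReal (L ^ 2 * d / τ ^ 2) * radiusBound T τ x X +
    ENNReal.ofReal ((4 * B ^ 2 + σ ^ 2) * (m + 2)) *
      (cellCount T τ Finset.univ X x + 1)⁻¹

lemma cellCount_le_ncard {d n : ℕ} {T : Tree d} {τ : ℝ} {x : Pt d} {X : Fin n → Pt d}
    {A : Set (Pt d)} (h : ∀ i, SameCell T τ x (X i) → X i ∈ A) :
    cellCount T τ Finset.univ X x ≤ ({i | X i ∈ A}.ncard : ℝ≥0∞) := by
  classical
  have : {i | X i ∈ A} = (Finset.univ.filter fun i => X i ∈ A : Finset (Fin n)) := by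
    ext; simp
  rw [this, ncard_coe_finset, Finset.card_filter, Nat.cast_sum, cellCount]
  refine Finset.sum_le_sum fun i _ => ?_
  by_cases hi : SameCell T τ x (X i)
  · rw [if_pos (h i hi)]
    exact (indicator_le_self' (fun _ _ => zero_le) _).trans (by simp)
  · rw [indicator_of_notMem (show X i ∉ {y | SameCell T τ x y} from hi)]
    exact zero_le

/-- The factor `m + 2` serves every case: `N + 1 ≤ m + 1` for blocks with at most `m` points, and
`(N + 1) / N ≤ 2` for other nonempty ones. Using `c + 1` keeps empty cells finite and is the form
that exchangeability requires. -/
lemma variance_part_le {N m : ℕ} {c : ℝ≥0∞} (hc : c ≤ N) {K V : ℝ} (hK : 0 ≤ K)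
    (hV : V * (N + 1) ≤ K * (m + 2)) :
    ENNReal.ofReal V ≤ ENNReal.ofReal (K * (m + 2)) * (c + 1)⁻¹ := by
  have hN : (0 : ℝ) < N + 1 := by positivity
  calc ENNReal.ofReal V ≤ ENNReal.ofReal (K * (m + 2) * ((N : ℝ) + 1)⁻¹) := by
        apply ENNReal.ofReal_le_ofReal
        rwa [← div_eq_mul_inv, le_div_iff₀ hN]
    _ = ENNReal.ofReal (K * (m + 2)) * ((N : ℝ≥0∞) + 1)⁻¹ := by
        rw [ENNReal.ofReal_mul (by positivity), ENNReal.ofReal_inv_of_pos hN,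
          ENNReal.ofReal_add (by positivity) zero_le_one]
        simp
    _ ≤ _ := by gcongr

/-- An empty block predicts `0`, with squared error at most `B ^ 2`. A block with at most `m` points
has the crude bound `4 * B ^ 2 + σ ^ 2`. Both are charged to the inverse-count term. Otherwise the
block is contained in the unrestricted cell, where the farthest data point controls the bias and the
variance is at most `σ ^ 2 / N`. -/
lemma bias_variance_le_errorBound {d n : ℕ} {L : ℝ≥0} {B : ℝ} {σ : ℝ≥0} {m : ℕ} {T : Tree d}
    {τ : ℝ} (hτ : 0 < τ) {g : Pt d → ℝ} (hg : g ∈ LipClass d L B) {x : Pt d} (hx : x ∈ cube d)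
    {X : Fin n → Pt d} (hX : ∀ i, X i ∈ cube d) (D : Data d n) (hD : ∀ i, (D i).1 = X i) :
    ENNReal.ofReal ((g x - ∑ i, blockWeight X (leafBlock T τ m D x) i * g (X i)) ^ 2
        + σ ^ 2 * ∑ i, blockWeight X (leafBlock T τ m D x) i ^ 2)
      ≤ errorBound L B σ m T τ x X := by
  set A := leafBlock T τ m D x with hA
  have hcell : ∀ i, SameCell T τ x (X i) → X i ∈ A := fun i h =>
    mem_leafBlock_of_sameCell (hX i) h
  have hcount := cellCount_le_ncard hcell
  have hor := leafBlock_small_or_sameCell T τ m D x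
  simp only [hD] at hor
  rw [← hA] at hor
  set N := {i | X i ∈ A}.ncard with hN
  have hK : 0 ≤ 4 * B ^ 2 + (σ : ℝ) ^ 2 := by positivity
  have hm : (0 : ℝ) ≤ m := Nat.cast_nonneg m
  have hB2 : ∀ y ∈ cube d, ∀ z ∈ cube d, |g y - g z| ≤ 2 * B := fun y hy z hz =>
    (abs_sub _ _).trans (by linarith [hg.2 y hy, hg.2 z hz])
  have hσ2 : (0 : ℝ) ≤ σ ^ 2 := by positivity
  by_cases hN0 : N = 0
  · refine le_trans ?_ le_add_self
    refine variance_part_le hcount hK ?_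
    have hW : ∀ i, blockWeight X A i = 0 := fun i => by
      rw [blockWeight, ← hN, hN0]; simp
    simp only [hW, zero_mul, Finset.sum_const_zero, sub_zero, ne_eq, OfNat.ofNat_ne_zero,
      not_false_eq_true, zero_pow, mul_zero, add_zero]
    have : g x ^ 2 ≤ B ^ 2 := sq_le_sq' (by linarith [(abs_le.1 (hg.2 x hx)).1])
      (abs_le.1 (hg.2 x hx)).2
    rw [hN0]
    push_cast
    nlinarith [sq_nonneg B, mul_nonneg hK hm]
  have hNpos : (1 : ℝ) ≤ N := by exact_mod_cast Nat.one_le_iff_ne_zero.2 hN0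
  have hvar := sum_sq_blockWeight hN0
  rw [← hN] at hvar
  rw [hvar]
  rcases hor with hsmall | hsame
  · refine le_trans ?_ le_add_self
    refine variance_part_le hcount hK ?_
    have h1 := sq_sub_weighted_le (X := X) (A := A) hN0 (a := fun i => g (X i)) (c := g x)
      (fun i _ => hB2 x hx (X i) (hX i))
    have h2 : σ ^ 2 * (1 / (N : ℝ)) ≤ σ ^ 2 := by
      refine mul_le_of_le_one_right hσ2 ?_
      rw [div_le_one (by linarith)]; exact hNpos
    have h3 : (N : ℝ) ≤ m := by exact_mod_cast hsmall
    calc _ ≤ (4 * B ^ 2 + (σ : ℝ) ^ 2) * (N + 1) := by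
          gcongr
          linarith
      _ ≤ _ := by gcongr; linarith
  · rw [ENNReal.ofReal_add (sq_nonneg _) (by positivity)]
    refine add_le_add ?_ ?_
    · have hne : {i | X i ∈ A}.Nonempty := nonempty_of_ncard_ne_zero hN0
      obtain ⟨i, hi, himax⟩ := (toFinite {i | X i ∈ A}).exists_maximalFor
        (fun i => supDist x (X i)) _ hne
      have hmax : ∀ j, X j ∈ A → supDist x (X j) ≤ supDist x (X i) := fun j hj => by
        rcases le_total (supDist x (X j)) (supDist x (X i)) with h | h
        · exact h
        · exact himax hj h
      have hS0 : 0 ≤ supDist x (X i) := dist_nonneg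
      have hbias : ∀ j, X j ∈ A → |g x - g (X j)| ≤ L * (Real.sqrt d * supDist x (X i)) := by
        intro j hj
        have h1 := hg.1.dist_le_mul x hx (X j) (hX j)
        rw [Real.dist_eq] at h1
        refine h1.trans (mul_le_mul_of_nonneg_left ?_ L.2)
        apply abs_le_of_sq_le_sq' _ (by positivity) |>.2
        rw [mul_pow, Real.sq_sqrt (Nat.cast_nonneg d)]
        refine (sq_dist_le x (X j)).trans ?_
        gcongr
        · exact dist_nonneg
        · exact hmax j hj
      have h1 := sq_sub_weighted_le (X := X) (A := A) hN0 (a := fun i => g (X i)) (c := g x) hbias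
      calc _ ≤ ENNReal.ofReal (L ^ 2 * d / τ ^ 2 * (τ * supDist x (X i)) ^ 2) := by
            apply ENNReal.ofReal_le_ofReal
            refine h1.trans (le_of_eq ?_)
            rw [mul_pow, mul_pow, Real.sq_sqrt (Nat.cast_nonneg d)]
            field_simp
        _ ≤ _ := by
            rw [ENNReal.ofReal_mul (by positivity)]
            gcongr
            exact sq_supDist_le_radiusBound hτ (hsame _ hi)
    · refine variance_part_le hcount hK ?_
      have h2 : σ ^ 2 * (1 / (N : ℝ)) * (N + 1) = σ ^ 2 + σ ^ 2 / N := by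
        field_simp
      have h3 : σ ^ 2 / (N : ℝ) ≤ σ ^ 2 := div_le_self hσ2 hNpos
      rw [h2]
      nlinarith [sq_nonneg B, mul_nonneg hK hm]

/-- The mean squared error of one tree at `x` given the features. -/
lemma lintegral_labels_le_errorBound {d n : ℕ} {L : ℝ≥0} {B : ℝ} {σ : ℝ≥0} {m : ℕ} {T : Tree d}
    {τ : ℝ} (hτ : 0 < τ) {g : Pt d → ℝ} (hg : g ∈ LipClass d L B) {μ : Measure (Pt d)}
    {κ : Kernel (Pt d) ℝ} (hκ : IsRegressionModel μ κ g σ) {x : Pt d} (hx : x ∈ cube d)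
    {X : Fin n → Pt d} (hX : ∀ i, X i ∈ cube d) :
    ∫⁻ Y, ENNReal.ofReal ((g x - labelMean (fun i => (X i, Y i))
        (leafBlock T τ m (fun i => (X i, Y i)) x)) ^ 2) ∂(Measure.pi fun i => κ (X i))
      ≤ errorBound L B σ m T τ x X := by
  have := hκ.isMarkovKernel
  -- The stopping rule looks at features only, so given the features the weights are constants and
  -- the labels are independent of them.
  have hnode : ∀ (Y : Fin n → ℝ) w, IsNode T τ m (fun i => (X i, Y i)) w
      ↔ IsNode T τ m (fun i => (X i, 0)) w := by
    intro Y w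
    induction w with
    | nil => exact Iff.rfl
    | cons b w ih => simp only [IsNode, ih]
  have hA : ∀ Y : Fin n → ℝ, leafBlock T τ m (fun i => (X i, Y i)) x
      = leafBlock T τ m (fun i => (X i, 0)) x := fun Y => by
    simp only [leafBlock, hnode Y]
  simp_rw [hA, labelMean_eq]
  refine (lintegral_sq_sub_weighted_sum_le (fun i => κ (X i)) (fun i => hκ.memLp _ (hX i))
    (fun i => hκ.mean _ (hX i)) (fun i => hκ.variance_le _ (hX i)) _ _).trans ?_
  exact bias_variance_le_errorBound hτ hg hx hX _ fun i => rfl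

end BSP

end

noncomputable section

namespace BSP

/-! ### Measurability of the estimator and of the error bound -/

open Classical in
lemma ncard_setOf_eq_sum {n : ℕ} (Q : Fin n → Prop) :
    ({i | Q i}.ncard : ℝ) = ∑ i, if Q i then 1 else 0 := by
  have : {i | Q i} = (Finset.univ.filter Q : Finset (Fin n)) := by
    ext; simp
  rw [this, ncard_coe_finset, Finset.card_filter]
  push_cast
  rfl

lemma measurable_ncard {α : Type*} [MeasurableSpace α] {n : ℕ} {Q : α → Fin n → Prop}
    (hQ : ∀ i, MeasurableSet {a | Q a i}) : Measurable fun a => ({i | Q a i}.ncard : ℝ) := by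
  classical
  simp_rw [ncard_setOf_eq_sum]
  exact Finset.measurable_fun_sum _ fun i _ =>
    Measurable.ite (hQ i) measurable_const measurable_const

lemma measurableSet_isNode {d n : ℕ} (T : Tree d) (τ : ℝ) (m : ℕ) :
    ∀ w, MeasurableSet {D : Data d n | IsNode T τ m D w}
  | [] => by simp [IsNode]
  | b :: w => by
    have h1 : MeasurableSet {D : Data d n | m < {i | (D i).1 ∈ block T w}.ncard} := by
      have := measurable_ncard (Q := fun (D : Data d n) i => (D i).1 ∈ block T w) fun i =>
        (measurableSet_block_right T w).preimage
          (by fun_prop : Measurable fun D : Data d n => (D i).1)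
      have h := measurableSet_lt (measurable_const (a := (m : ℝ))) this
      simpa only [Nat.cast_lt] using h
    have h2 : {D : Data d n | IsNode T τ m D (b :: w)} = {D | IsNode T τ m D w} ∩
        ({_D | birth T (b :: w) < τ} ∩ {D | m < {i | (D i).1 ∈ block T w}.ncard}) := rfl
    rw [h2]
    exact (measurableSet_isNode T τ m w).inter ((MeasurableSet.const _).inter h1)

lemma measurableSet_mem_leafBlock {d n : ℕ} (T : Tree d) (τ : ℝ) (m : ℕ) (x : Pt d) (i : Fin n) :
    MeasurableSet {D : Data d n | (D i).1 ∈ leafBlock T τ m D x} := by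
  have hi : Measurable fun D : Data d n => (D i).1 := by fun_prop
  have : {D : Data d n | (D i).1 ∈ leafBlock T τ m D x} = {D | (D i).1 ∈ cube d} ∩
      ⋂ w, ({D | IsNode T τ m D w}ᶜ ∪ ({_D | x ∈ block T w}ᶜ ∪ {D | (D i).1 ∈ block T w})) := by
    ext D
    simp only [leafBlock, mem_ofPred_eq, mem_inter_iff, mem_iInter, mem_union, mem_compl_iff,
      imp_iff_not_or]
  rw [this]
  refine ((measurableSet_cube d).preimage hi).inter (MeasurableSet.iInter fun w => ?_)
  exact (measurableSet_isNode T τ m w).compl.union ((MeasurableSet.const _).compl.union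
    ((measurableSet_block_right T w).preimage hi))

lemma measurable_labelMean {d n : ℕ} (T : Tree d) (τ : ℝ) (m : ℕ) (x : Pt d) :
    Measurable fun D : Data d n => labelMean D (leafBlock T τ m D x) := by
  classical
  unfold labelMean
  refine Measurable.div (Finset.measurable_fun_sum _ fun i _ => ?_)
    (measurable_ncard fun i => measurableSet_mem_leafBlock T τ m x i)
  exact Measurable.indicator (s := {D : Data d n | (D i).1 ∈ leafBlock T τ m D x})
    (by fun_prop : Measurable fun D : Data d n => (D i).2) (measurableSet_mem_leafBlock T τ m x i)

lemma measurableSet_sameCell_apply {d n : ℕ} (τ : ℝ) (i : Fin n) :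
    MeasurableSet {q : Tree d × Pt d × (Fin n → Pt d) | SameCell q.1 τ q.2.1 (q.2.2 i)} :=
  (measurableSet_sameCell τ).preimage
    (by fun_prop : Measurable fun q : Tree d × Pt d × (Fin n → Pt d) => (q.1, q.2.1, q.2.2 i))

lemma continuous_supDist {d : ℕ} : Continuous fun q : Pt d × Pt d => supDist q.1 q.2 := by
  unfold supDist; fun_prop

lemma measurable_supDist_comp {α : Type*} [MeasurableSpace α] {d : ℕ} {f g : α → Pt d}
    (hf : Measurable f) (hg : Measurable g) : Measurable fun a => supDist (f a) (g a) :=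
  (continuous_supDist (d := d)).measurable.comp (hf.prodMk hg)

lemma measurable_farInd {d n : ℕ} (τ r : ℝ) :
    Measurable fun q : Tree d × Pt d × (Fin n → Pt d) => farInd q.1 τ q.2.1 q.2.2 r := by
  classical
  refine Measurable.ite ?_ measurable_const measurable_const
  have : {q : Tree d × Pt d × (Fin n → Pt d) | FarInCell q.1 τ q.2.1 q.2.2 r}
      = ⋃ i, ({q | SameCell q.1 τ q.2.1 (q.2.2 i)} ∩ {q | r ≤ supDist q.2.1 (q.2.2 i)}) := by
    ext q; simp [FarInCell]
  rw [this]
  refine MeasurableSet.iUnion fun i => (measurableSet_sameCell_apply τ i).inter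
    (measurableSet_le measurable_const (measurable_supDist_comp (by fun_prop) (by fun_prop)))

lemma measurable_radiusBound {d n : ℕ} (τ : ℝ) :
    Measurable fun q : Tree d × Pt d × (Fin n → Pt d) => radiusBound q.1 τ q.2.1 q.2.2 :=
  Measurable.tsum fun _ => (measurable_farInd τ _).const_mul _

lemma measurable_cellCount {d n : ℕ} (τ : ℝ) :
    Measurable fun q : Tree d × Pt d × (Fin n → Pt d) =>
      cellCount q.1 τ Finset.univ q.2.2 q.2.1 := by
  refine Finset.measurable_fun_sum _ fun i _ => ?_
  exact (measurable_const (a := (1 : ℝ≥0∞))).indicator (measurableSet_sameCell_apply τ i)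

lemma measurable_cellCount_comp {α : Type*} [MeasurableSpace α] {d n : ℕ} (τ : ℝ)
    {T : α → Tree d} {x : α → Pt d} {X : α → Fin n → Pt d} (hT : Measurable T)
    (hx : Measurable x) (hX : Measurable X) :
    Measurable fun a => cellCount (T a) τ Finset.univ (X a) (x a) :=
  (measurable_cellCount τ).comp (hT.prodMk (hx.prodMk hX))

lemma measurable_inv_cellCount {d n : ℕ} (τ : ℝ) :
    Measurable fun q : Tree d × Pt d × (Fin n → Pt d) =>
      (cellCount q.1 τ Finset.univ q.2.2 q.2.1 + 1)⁻¹ :=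
  ((measurable_cellCount τ).add_const 1).inv

lemma measurable_errorBound {d n : ℕ} (L : ℝ≥0) (B : ℝ) (σ : ℝ≥0) (m : ℕ) (τ : ℝ) :
    Measurable fun q : Tree d × Pt d × (Fin n → Pt d) =>
      errorBound L B σ m q.1 τ q.2.1 q.2.2 :=
  ((measurable_radiusBound τ).const_mul _).add ((measurable_inv_cellCount τ).const_mul _)

/-! ### The risk of one tree -/

/-- A bound for the mean of `radiusBound`. -/
def radiusConst (d : ℕ) : ℝ := ∑' k : ℕ, (2 * (k : ℝ) + 1) * (2 * d * Real.exp (-(sepRate * k)))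

lemma summable_radiusConst (d : ℕ) :
    Summable fun k : ℕ => (2 * (k : ℝ) + 1) * (2 * d * Real.exp (-(sepRate * k))) := by
  have hr : ‖Real.exp (-sepRate)‖ < 1 := by
    rw [Real.norm_of_nonneg (Real.exp_pos _).le]
    exact Real.exp_lt_one_iff.2 (by linarith [sepRate_pos])
  have h1 := (summable_pow_mul_geometric_of_norm_lt_one 1 hr).mul_left (4 * (d : ℝ))
  have h2 := (summable_geometric_of_norm_lt_one hr).mul_left (2 * (d : ℝ))
  refine (h1.add h2).congr fun k => ?_
  have : Real.exp (-(sepRate * k)) = Real.exp (-sepRate) ^ k := by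
    rw [← Real.exp_nat_mul]; ring_nf
  rw [this]; ring

lemma radiusConst_nonneg (d : ℕ) : 0 ≤ radiusConst d := tsum_nonneg fun k => by positivity

/-- At radius `k / τ` the tail bound `2 * d * exp (-(sepRate * k))` no longer involves `τ` or `n`,
so the weighted sum over `k` is a constant. -/
lemma lintegral_radiusBound_le {d n : ℕ} (hd : 2 ≤ d) {ν : Measure (Tree d)} (hν : IsBSPLaw ν)
    {τ : ℝ} (hτ : 0 < τ) {x : Pt d} (hx : x ∈ cube d) (X : Fin n → Pt d) :
    ∫⁻ T, radiusBound T τ x X ∂ν ≤ ENNReal.ofReal (radiusConst d) := by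
  classical
  have hm : ∀ r, Measurable fun T : Tree d => farInd T τ x X r := fun r =>
    (measurable_farInd τ r).comp (by fun_prop : Measurable fun T : Tree d => (T, x, X))
  unfold radiusBound
  rw [lintegral_tsum fun k => ((hm _).const_mul _).aemeasurable, radiusConst,
    ENNReal.ofReal_tsum_of_nonneg (fun k => by positivity) (summable_radiusConst d)]
  refine ENNReal.tsum_le_tsum fun k => ?_
  rw [lintegral_const_mul _ (hm _), ENNReal.ofReal_mul (by positivity)]
  refine mul_le_mul' (le_of_eq ?_) ?_
  · rw [ENNReal.ofReal_add (by positivity) zero_le_one, ENNReal.ofReal_mul zero_le_two]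
    simp
  · have hms : MeasurableSet {T : Tree d | FarInCell T τ x X (k / τ)} := by
      have h := measurableSet_eq_fun (hm (k / τ)) (measurable_const (a := (1 : ℝ≥0∞)))
      convert h using 1
      ext T
      simp only [mem_ofPred_eq, farInd]
      split_ifs with h <;> simp [h]
    have e : (fun T : Tree d => farInd T τ x X (k / τ))
        = {T | FarInCell T τ x X (k / τ)}.indicator 1 := by
      ext T; simp [farInd, indicator]
    rw [e, lintegral_indicator_one hms]
    refine (measure_sameCell_far_le hd hν hτ.le X hx (r := k / τ) (by positivity)).trans
      (le_of_eq ?_)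
    rw [ENNReal.ofReal_mul (by positivity), ENNReal.ofReal_mul zero_le_two,
      ENNReal.ofReal_natCast, mul_assoc sepRate, div_mul_cancel₀ _ hτ.ne']
    simp

/-- Listed as point `0` of the enlarged sample, the test point counts itself; this is the `+ 1` in
the error bound. -/
lemma cellCount_succ {d n : ℕ} (T : Tree d) (τ : ℝ) (z : Fin (n + 1) → Pt d) :
    cellCount T τ Finset.univ z (z 0)
      = cellCount T τ Finset.univ (fun j : Fin n => z j.succ) (z 0) + 1 := by
  rw [cellCount, Fin.sum_univ_succ, add_comm]
  congr 1
  rw [indicator_of_mem (show z 0 ∈ {y | SameCell T τ (z 0) y} from sameCell_refl T τ (z 0))]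
  rfl

/-- By exchangeability, the mean of the inverse number of points in the cell of a test point is
governed by the number of occupied cells. -/
lemma lintegral_inv_cellCount_eq {d n : ℕ} (T : Tree d) (τ : ℝ) (μ : Measure (Pt d))
    [IsProbabilityMeasure μ] (i : Fin (n + 1)) :
    ∫⁻ x, ∫⁻ X, (cellCount T τ Finset.univ X x + 1)⁻¹ ∂(Measure.pi fun _ : Fin n => μ) ∂μ
      = ∫⁻ z, (cellCount T τ Finset.univ z (z i))⁻¹ ∂(Measure.pi fun _ : Fin (n + 1) => μ) := by
  have hmi : ∀ i, Measurable fun z : Fin (n + 1) → Pt d =>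
      (cellCount T τ Finset.univ z (z i))⁻¹ := fun i =>
    (measurable_cellCount_comp τ measurable_const (by fun_prop) measurable_id).inv
  have h0 : ∫⁻ x, ∫⁻ X, (cellCount T τ Finset.univ X x + 1)⁻¹ ∂(Measure.pi fun _ : Fin n => μ) ∂μ
      = ∫⁻ z, (cellCount T τ Finset.univ z (z 0))⁻¹ ∂(Measure.pi fun _ : Fin (n + 1) => μ) := by
    have hm2 : Measurable fun q : Pt d × (Fin n → Pt d) =>
        (cellCount T τ Finset.univ q.2 q.1 + 1)⁻¹ :=
      ((measurable_cellCount_comp τ measurable_const measurable_fst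
        measurable_snd).add_const 1).inv
    have hmp := measurePreserving_piFinSuccAbove (fun _ : Fin (n + 1) => μ) 0
    rw [← lintegral_prod _ hm2.aemeasurable, ← hmp.lintegral_comp hm2]
    refine lintegral_congr fun z => ?_
    rw [cellCount_succ]
    rfl
  rw [h0]
  -- Exchanging points `0` and `i` preserves the product law and permutes the terms of the count.
  have hmp := measurePreserving_piCongrLeft (fun _ : Fin (n + 1) => μ) (Equiv.swap 0 i)
  rw [← hmp.lintegral_comp (hmi i)]
  refine lintegral_congr fun z => ?_
  have e : ∀ j, (MeasurableEquiv.piCongrLeft (fun _ : Fin (n + 1) => Pt d) (Equiv.swap 0 i)) z j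
      = z (Equiv.swap 0 i j) := fun j => by
    have := Equiv.piCongrLeft_apply_apply (fun _ : Fin (n + 1) => Pt d) (Equiv.swap 0 i) z
      (Equiv.swap 0 i j)
    rw [Equiv.swap_apply_self] at this
    exact this
  simp only [cellCount, e, Equiv.swap_apply_right]
  congr 1
  exact (Equiv.sum_comp (Equiv.swap 0 i) fun j => {y | SameCell T τ (z 0) y}.indicator
    (1 : Pt d → ℝ≥0∞) (z j)).symm

lemma ae_pi_mem_cube {d n : ℕ} {μ : Measure (Pt d)} [IsProbabilityMeasure μ]
    (hμ : ∀ᵐ x ∂μ, x ∈ cube d) : ∀ᵐ X ∂(Measure.pi fun _ : Fin n => μ), ∀ i, X i ∈ cube d :=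
  ae_all_iff.2 fun i =>
    (measurePreserving_eval (fun _ : Fin n => μ) i).quasiMeasurePreserving.ae hμ

/-- All `n + 1` points may play the test point, with equal means. The sum of these means is the
expected number of occupied cells, which is bounded for every fixed configuration in the cube. -/
lemma lintegral_inv_cellCount_le {d n : ℕ} {ν : Measure (Tree d)} (hν : IsBSPLaw ν) {τ : ℝ}
    (hτ : 0 ≤ τ) {μ : Measure (Pt d)} [IsProbabilityMeasure μ] (hμ : ∀ᵐ x ∂μ, x ∈ cube d)
    {k : ℕ} (hk : 0 < k) (hτk : τ ≤ k) :
    ∫⁻ T, ∫⁻ x, ∫⁻ X, (cellCount T τ Finset.univ X x + 1)⁻¹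
        ∂(Measure.pi fun _ : Fin n => μ) ∂μ ∂ν
      ≤ (k ^ d * ENNReal.ofReal (Real.exp (hitRate d))) / (n + 1) := by
  have := hν.isProbabilityMeasure
  have hm : ∀ i, Measurable fun q : Tree d × (Fin (n + 1) → Pt d) =>
      (cellCount q.1 τ Finset.univ q.2 (q.2 i))⁻¹ := fun i =>
    (measurable_cellCount_comp τ measurable_fst (by fun_prop) measurable_snd).inv
  set I := ∫⁻ T, ∫⁻ x, ∫⁻ X, (cellCount T τ Finset.univ X x + 1)⁻¹
        ∂(Measure.pi fun _ : Fin n => μ) ∂μ ∂ν with hI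
  have hsum : (n + 1 : ℝ≥0∞) * I = ∫⁻ z, ∫⁻ T, ∑ i, (cellCount T τ Finset.univ z (z i))⁻¹ ∂ν
      ∂(Measure.pi fun _ : Fin (n + 1) => μ) := by
    calc (n + 1 : ℝ≥0∞) * I = ∑ _i : Fin (n + 1), I := by simp
      _ = ∑ i : Fin (n + 1), ∫⁻ z, ∫⁻ T, (cellCount T τ Finset.univ z (z i))⁻¹ ∂ν
            ∂(Measure.pi fun _ : Fin (n + 1) => μ) := by
          refine Finset.sum_congr rfl fun i _ => ?_
          rw [← lintegral_lintegral_swap (f := fun T z => (cellCount T τ Finset.univ z (z i))⁻¹)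
            (hm i).aemeasurable, hI]
          exact lintegral_congr fun T => lintegral_inv_cellCount_eq T τ μ i
      _ = ∫⁻ z, ∑ i, ∫⁻ T, (cellCount T τ Finset.univ z (z i))⁻¹ ∂ν
            ∂(Measure.pi fun _ : Fin (n + 1) => μ) :=
          (lintegral_finsetSum _ fun i _ => Measurable.lintegral_prod_left'
            (f := fun q : Tree d × (Fin (n + 1) → Pt d) =>
              (cellCount q.1 τ Finset.univ q.2 (q.2 i))⁻¹) (hm i)).symm
      _ = _ := by
          refine lintegral_congr fun z => (lintegral_finsetSum _ fun i _ => ?_).symm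
          exact (measurable_cellCount_comp τ measurable_id measurable_const
            measurable_const).inv
  rw [ENNReal.le_div_iff_mul_le (Or.inl (by simp)) (Or.inl (by simp)), mul_comm, hsum]
  calc _ ≤ ∫⁻ _z, (k ^ d * ENNReal.ofReal (Real.exp (hitRate d)))
        ∂(Measure.pi fun _ : Fin (n + 1) => μ) := by
        refine lintegral_mono_ae ?_
        filter_upwards [ae_pi_mem_cube hμ] with z hz
        exact lintegral_sum_inv_cellCount_le hν hτ hz hk hτk
    _ = _ := by simp

/-- The mean of the error bound over the tree, the test point and the features. -/
lemma lintegral_errorBound_le {d n : ℕ} (hd : 2 ≤ d) {ν : Measure (Tree d)} (hν : IsBSPLaw ν)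
    {τ : ℝ} (hτ : 0 < τ) {μ : Measure (Pt d)} [IsProbabilityMeasure μ]
    (hμ : ∀ᵐ x ∂μ, x ∈ cube d) {k : ℕ} (hk : 0 < k) (hτk : τ ≤ k) (L : ℝ≥0) (B : ℝ) (σ : ℝ≥0)
    (m : ℕ) :
    ∫⁻ T, ∫⁻ x, ∫⁻ X, errorBound L B σ m T τ x X ∂(Measure.pi fun _ : Fin n => μ) ∂μ ∂ν
      ≤ ENNReal.ofReal (L ^ 2 * d / τ ^ 2) * ENNReal.ofReal (radiusConst d)
        + ENNReal.ofReal ((4 * B ^ 2 + σ ^ 2) * (m + 2)) *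
          ((k ^ d * ENNReal.ofReal (Real.exp (hitRate d))) / (n + 1)) := by
  have := hν.isProbabilityMeasure
  set π := Measure.pi fun _ : Fin n => μ with hπ
  have hr := measurable_radiusBound (d := d) (n := n) τ
  have hc := measurable_inv_cellCount (d := d) (n := n) τ
  have e : ∀ (f : Tree d × Pt d × (Fin n → Pt d) → ℝ≥0∞), Measurable f →
      ∫⁻ T, ∫⁻ x, ∫⁻ X, f (T, x, X) ∂π ∂μ ∂ν = ∫⁻ q, f q ∂(ν.prod (μ.prod π)) := fun f hf => by
    rw [lintegral_prod _ hf.aemeasurable]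
    refine lintegral_congr fun T => ?_
    exact (lintegral_prod (fun p => f (T, p)) (hf.comp measurable_prodMk_left).aemeasurable).symm
  rw [e _ (measurable_errorBound L B σ m τ)]
  simp only [errorBound]
  rw [lintegral_add_left (hr.const_mul _), lintegral_const_mul _ hr, lintegral_const_mul _ hc]
  refine add_le_add (mul_le_mul_right ?_ _) (mul_le_mul_right ?_ _)
  · rw [lintegral_prod_symm _ hr.aemeasurable]
    have hcube : ∀ᵐ p ∂(μ.prod π), p.1 ∈ cube d :=
      measurePreserving_fst.quasiMeasurePreserving.ae hμ
    calc _ ≤ ∫⁻ _p, ENNReal.ofReal (radiusConst d) ∂(μ.prod π) := by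
          refine lintegral_mono_ae ?_
          filter_upwards [hcube] with p hp
          exact lintegral_radiusBound_le hd hν hτ hp p.2
      _ = _ := by simp
  · rw [← e _ hc]
    exact lintegral_inv_cellCount_le hν hτ.le hμ hk hτk

/-! ### The risk of a forest -/

/-- Convexity of the square. Beyond this point only the law of a single tree matters. -/
lemma sq_sub_forestEstimate_le {d n M : ℕ} (hM : 1 ≤ M) (T : Fin M → Tree d) (τ : ℝ) (m : ℕ)
    (D : Data d n) (x : Pt d) (c : ℝ) :
    ENNReal.ofReal ((c - forestEstimate T τ m D x) ^ 2)
      ≤ (M : ℝ≥0∞)⁻¹ * ∑ k, ENNReal.ofReal ((c - labelMean D (leafBlock (T k) τ m D x)) ^ 2) := by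
  have hM' : (0 : ℝ) < M := by exact_mod_cast hM
  have h1 := sq_sum_le_card_mul_sum_sq (s := (Finset.univ : Finset (Fin M)))
    (f := fun k => c - labelMean D (leafBlock (T k) τ m D x))
  rw [Finset.card_univ, Fintype.card_fin] at h1
  have h2 : c - forestEstimate T τ m D x
      = (∑ k, (c - labelMean D (leafBlock (T k) τ m D x))) / M := by
    rw [forestEstimate, Finset.sum_sub_distrib, Finset.sum_const, Finset.card_univ,
      Fintype.card_fin, nsmul_eq_mul]
    field_simp
  rw [← ENNReal.ofReal_sum_of_nonneg fun k _ => sq_nonneg _, ← ENNReal.ofReal_natCast,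
    ← ENNReal.ofReal_inv_of_pos hM', ← ENNReal.ofReal_mul (by positivity)]
  apply ENNReal.ofReal_le_ofReal
  rw [h2, div_pow, div_le_iff₀ (by positivity)]
  refine h1.trans (le_of_eq ?_)
  field_simp

lemma mse_forest_le {d n M : ℕ} (hM : 1 ≤ M) {L : ℝ≥0} {B : ℝ} {σ : ℝ≥0} {m : ℕ}
    (T : Fin M → Tree d) {τ : ℝ} (hτ : 0 < τ) {g : Pt d → ℝ} (hg : g ∈ LipClass d L B)
    {μ : Measure (Pt d)} {κ : Kernel (Pt d) ℝ} (hκ : IsRegressionModel μ κ g σ) :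
    mse (μ.compProd κ) g n (forestEstimate T τ m)
      ≤ (M : ℝ≥0∞)⁻¹ * ∑ k, ∫⁻ x, ∫⁻ X, errorBound L B σ m (T k) τ x X
          ∂(Measure.pi fun _ : Fin n => μ) ∂μ := by
  have := hκ.isProbabilityMeasure
  have := hκ.isMarkovKernel
  have hM0 : (M : ℝ≥0∞)⁻¹ ≠ ∞ := ENNReal.inv_ne_top.2 (by exact_mod_cast (by omega : M ≠ 0))
  have hfst : (μ.compProd κ).map Prod.fst = μ := Measure.fst_compProd μ κ
  have hX := ae_pi_mem_cube (n := n) hκ.mem_cube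
  have hR : ∀ k, Measurable fun x => ∫⁻ X, errorBound L B σ m (T k) τ x X
      ∂(Measure.pi fun _ : Fin n => μ) := fun k =>
    Measurable.lintegral_prod_right' (f := fun q : Pt d × (Fin n → Pt d) =>
        errorBound L B σ m (T k) τ q.1 q.2)
      ((measurable_errorBound L B σ m τ).comp
        (by fun_prop : Measurable fun p : Pt d × (Fin n → Pt d) => (T k, p.1, p.2)))
  rw [mse, hfst, ← lintegral_finsetSum _ fun k _ => hR k, ← lintegral_const_mul' _ _ hM0]
  refine lintegral_mono_ae ?_
  filter_upwards [hκ.mem_cube] with x hx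
  have hm : ∀ k, Measurable fun D : Data d n =>
      ENNReal.ofReal ((g x - labelMean D (leafBlock (T k) τ m D x)) ^ 2) := fun k =>
    ((measurable_const.sub (measurable_labelMean (T k) τ m x)).pow_const 2).ennreal_ofReal
  calc _ ≤ ∫⁻ D, (M : ℝ≥0∞)⁻¹ * ∑ k, ENNReal.ofReal
        ((g x - labelMean D (leafBlock (T k) τ m D x)) ^ 2)
        ∂(Measure.pi fun _ : Fin n => μ.compProd κ) :=
        lintegral_mono fun D => sq_sub_forestEstimate_le hM T τ m D x (g x)
    _ = (M : ℝ≥0∞)⁻¹ * ∑ k, ∫⁻ D, ENNReal.ofReal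
        ((g x - labelMean D (leafBlock (T k) τ m D x)) ^ 2)
        ∂(Measure.pi fun _ : Fin n => μ.compProd κ) := by
        rw [lintegral_const_mul' _ _ hM0, lintegral_finsetSum _ fun k _ => hm k]
    _ ≤ _ := by
        gcongr with k
        rw [lintegral_pi_compProd μ κ (hm k)]
        refine lintegral_mono_ae ?_
        filter_upwards [hX] with X hX'
        exact lintegral_labels_le_errorBound hτ hg hκ hx hX'

/-- A bound for the risk of a forest with budget `τ`. -/
theorem lintegral_mse_forest_le {d n M : ℕ} (hd : 2 ≤ d) (hM : 1 ≤ M) {L : ℝ≥0} {B : ℝ}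
    {σ : ℝ≥0} {m : ℕ} {τ : ℝ} (hτ : 0 < τ) {ν : Measure (Tree d)} (hν : IsBSPLaw ν)
    {g : Pt d → ℝ} (hg : g ∈ LipClass d L B) {μ : Measure (Pt d)} {κ : Kernel (Pt d) ℝ}
    (hκ : IsRegressionModel μ κ g σ) {k : ℕ} (hk : 0 < k) (hτk : τ ≤ k) :
    ∫⁻ T, mse (μ.compProd κ) g n (forestEstimate T τ m) ∂(Measure.pi fun _ : Fin M => ν)
      ≤ ENNReal.ofReal (L ^ 2 * d / τ ^ 2) * ENNReal.ofReal (radiusConst d)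
        + ENNReal.ofReal ((4 * B ^ 2 + σ ^ 2) * (m + 2)) *
          ((k ^ d * ENNReal.ofReal (Real.exp (hitRate d))) / (n + 1)) := by
  have := hκ.isProbabilityMeasure
  have := hν.isProbabilityMeasure
  have hM0 : (M : ℝ≥0∞) ≠ 0 := by exact_mod_cast (by omega : M ≠ 0)
  set R : Tree d → ℝ≥0∞ := fun T => ∫⁻ x, ∫⁻ X, errorBound L B σ m T τ x X
    ∂(Measure.pi fun _ : Fin n => μ) ∂μ with hR
  have hRm : Measurable R := by
    refine Measurable.lintegral_prod_right' (f := fun q : Tree d × Pt d =>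
      ∫⁻ X, errorBound L B σ m q.1 τ q.2 X ∂(Measure.pi fun _ : Fin n => μ)) ?_
    exact Measurable.lintegral_prod_right' (f := fun q : (Tree d × Pt d) × (Fin n → Pt d) =>
      errorBound L B σ m q.1.1 τ q.1.2 q.2) ((measurable_errorBound L B σ m τ).comp
        (by fun_prop : Measurable fun q : (Tree d × Pt d) × (Fin n → Pt d) =>
          (q.1.1, q.1.2, q.2)))
  calc _ ≤ ∫⁻ T, (M : ℝ≥0∞)⁻¹ * ∑ k, R (T k) ∂(Measure.pi fun _ : Fin M => ν) :=
        lintegral_mono fun T => mse_forest_le hM T hτ hg hκ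
    _ = (M : ℝ≥0∞)⁻¹ * ∑ k, ∫⁻ T, R (T k) ∂(Measure.pi fun _ : Fin M => ν) := by
        have hRk : ∀ k, Measurable fun T : Fin M → Tree d => R (T k) := fun k =>
          hRm.comp (measurable_pi_apply k)
        rw [lintegral_const_mul' _ _ (ENNReal.inv_ne_top.2 hM0),
          lintegral_finsetSum _ fun k _ => hRk k]
    _ = (M : ℝ≥0∞)⁻¹ * ∑ _k : Fin M, ∫⁻ T, R T ∂ν := by
        congr 1
        exact Finset.sum_congr rfl fun k _ =>
          (measurePreserving_eval (fun _ : Fin M => ν) k).lintegral_comp hRm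
    _ = ∫⁻ T, R T ∂ν := by
        rw [Finset.sum_const, Finset.card_univ, Fintype.card_fin, nsmul_eq_mul, ← mul_assoc,
          ENNReal.inv_mul_cancel hM0 (ENNReal.natCast_ne_top _), one_mul]
    _ ≤ _ := lintegral_errorBound_le hd hν hτ hκ.mem_cube hk hτk L B σ m

/-- The risk of the forest at budgets of order `n ^ (1 / (d + 2))`. -/
theorem forest_rate (d : ℕ) (hd : 2 ≤ d) (L : ℝ≥0) (B : ℝ) (σ : ℝ≥0) (m : ℕ) (τ : ℕ → ℝ)
    (hτ_nonneg : ∀ n, 0 ≤ τ n)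
    (hτ : τ =Θ[atTop] fun n : ℕ => (n : ℝ) ^ (1 / ((d : ℝ) + 2))) :
    ∃ (C : ℝ) (N : ℕ), ∀ n : ℕ, N ≤ n → ∀ M : ℕ, 1 ≤ M →
      ∀ ν : Measure (Tree d), IsBSPLaw ν →
      ∀ (g : Pt d → ℝ) (μ : Measure (Pt d)) (κ : Kernel (Pt d) ℝ),
        g ∈ LipClass d L B → IsRegressionModel μ κ g σ →
        ∫⁻ T, mse (μ.compProd κ) g n (forestEstimate T (τ n) m)
            ∂(Measure.pi fun _ : Fin M => ν)
          ≤ ENNReal.ofReal (C * (n : ℝ) ^ (-(2 / ((d : ℝ) + 2)))) := by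
  obtain ⟨c₂, hc₂, h₂⟩ := hτ.1.exists_pos
  obtain ⟨c₁, hc₁, h₁⟩ := hτ.2.exists_pos
  rw [isBigOWith_iff, eventually_atTop] at h₁ h₂
  obtain ⟨N₁, h₁⟩ := h₁
  obtain ⟨N₂, h₂⟩ := h₂
  obtain ⟨K, hK⟩ : ∃ K, K = (4 * B ^ 2 + (σ : ℝ) ^ 2) * (m + 2) := ⟨_, rfl⟩
  have hK0 : 0 ≤ K := by rw [hK]; positivity
  have hr0 := radiusConst_nonneg d
  -- With `a = n ^ (1 / (d + 2))`, the bias uses `a ≤ c₁ * τ n` and the variance uses `⌈τ n⌉₊ ≤ (c₂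
  -- + 1) * a`; the rounding is absorbed by `a ≥ 1`, which is why `N ≥ 1` is required.
  refine ⟨L ^ 2 * d * c₁ ^ 2 * radiusConst d + K * ((c₂ + 1) ^ d * Real.exp (hitRate d)),
    max 1 (max N₁ N₂), ?_⟩
  intro n hn M hM ν hν g μ κ hg hκ
  have hn1 : 1 ≤ n := (le_max_left _ _).trans hn
  have hnR : (1 : ℝ) ≤ n := by exact_mod_cast hn1
  have hn0 : (0 : ℝ) < n := by linarith
  set a := (n : ℝ) ^ (1 / ((d : ℝ) + 2)) with ha
  have ha1 : 1 ≤ a := Real.one_le_rpow hnR (by positivity)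
  have ha0 : 0 < a := by linarith
  have hlow := h₁ n ((le_max_left _ _).trans ((le_max_right _ _).trans hn))
  have hup := h₂ n ((le_max_right _ _).trans ((le_max_right _ _).trans hn))
  rw [Real.norm_of_nonneg (hτ_nonneg n), Real.norm_of_nonneg ha0.le] at hlow hup
  have hτ0 : 0 < τ n := by
    by_contra! h
    nlinarith
  have hapow : (n : ℝ) ^ (-(2 / ((d : ℝ) + 2))) = (a ^ 2)⁻¹ := by
    rw [ha, ← Real.rpow_natCast, ← Real.rpow_mul hn0.le, ← Real.rpow_neg hn0.le]
    congr 1; push_cast; ring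
  -- This is the balance between variance and squared bias that singles out the exponent `1 / (d +
  -- 2)`.
  have hadn : a ^ d / n = (a ^ 2)⁻¹ := by
    have h1 : a ^ (d + 2) = n := by
      rw [ha, ← Real.rpow_natCast, ← Real.rpow_mul hn0.le]
      push_cast
      rw [one_div_mul_cancel (by positivity), Real.rpow_one]
    rw [pow_add] at h1
    rw [← h1]; field_simp
  have hk : 0 < ⌈τ n⌉₊ := Nat.ceil_pos.2 hτ0
  refine (lintegral_mse_forest_le hd hM hτ0 hν hg hκ hk (Nat.le_ceil _)).trans ?_
  rw [← hK]
  have hkle : ((⌈τ n⌉₊ : ℕ) : ℝ) ≤ (c₂ + 1) * a := by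
    have := (Nat.ceil_lt_add_one (hτ_nonneg n)).le
    nlinarith
  have e : ENNReal.ofReal K * ((⌈τ n⌉₊ ^ d * ENNReal.ofReal (Real.exp (hitRate d))) / (n + 1))
      = ENNReal.ofReal (K * ((⌈τ n⌉₊ ^ d * Real.exp (hitRate d)) / (n + 1))) := by
    rw [ENNReal.ofReal_mul (q := _ / _) hK0, ENNReal.ofReal_div_of_pos (by positivity),
      ENNReal.ofReal_mul (p := _ ^ d) (by positivity), ENNReal.ofReal_pow (by positivity),
      ENNReal.ofReal_add (by positivity) zero_le_one]
    simp
  rw [e, ← ENNReal.ofReal_mul (by positivity), ← ENNReal.ofReal_add (by positivity)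
    (by positivity)]
  apply ENNReal.ofReal_le_ofReal
  rw [hapow, add_mul]
  refine add_le_add ?_ ?_
  · have h3 : 1 / τ n ^ 2 ≤ c₁ ^ 2 * (a ^ 2)⁻¹ := by
      rw [← div_eq_mul_inv, div_le_div_iff₀ (by positivity) (by positivity), one_mul, ← mul_pow]
      exact pow_le_pow_left₀ ha0.le hlow 2
    calc L ^ 2 * d / τ n ^ 2 * radiusConst d = L ^ 2 * d * radiusConst d * (1 / τ n ^ 2) := by ring
      _ ≤ L ^ 2 * d * radiusConst d * (c₁ ^ 2 * (a ^ 2)⁻¹) := by gcongr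
      _ = _ := by ring
  · rw [mul_assoc]
    refine mul_le_mul_of_nonneg_left ?_ hK0
    calc _ ≤ (((c₂ + 1) * a) ^ d * Real.exp (hitRate d)) / n := by
          gcongr
          linarith
      _ = (c₂ + 1) ^ d * Real.exp (hitRate d) * (a ^ d / n) := by rw [mul_pow]; ring
      _ = _ := by rw [hadn]

end BSP

end

/-! ### Hellinger affinity of Gaussian data and the two-point method. -/

noncomputable section

namespace BSP

/-- The square root of the density of `N(a, v)` with respect to `N(0, v)`. -/
def rootDensity (v : ℝ≥0) (a y : ℝ) : ℝ := Real.exp ((2 * a * y - a ^ 2) / (4 * v))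

lemma rootDensity_pos (v : ℝ≥0) (a y : ℝ) : 0 < rootDensity v a y := Real.exp_pos _

lemma measurable_rootDensity {Ω : Type*} [MeasurableSpace Ω] (v : ℝ≥0) {a y : Ω → ℝ}
    (ha : Measurable a) (hy : Measurable y) : Measurable fun z => rootDensity v (a z) (y z) := by
  unfold rootDensity
  fun_prop

lemma gaussianReal_eq_withDensity_rootDensity {v : ℝ≥0} (hv : v ≠ 0) (a : ℝ) :
    gaussianReal a v
      = (gaussianReal 0 v).withDensity fun y => ENNReal.ofReal (rootDensity v a y ^ 2) := by
  have hm : Measurable fun y => ENNReal.ofReal (rootDensity v a y ^ 2) :=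
    ((measurable_rootDensity v measurable_const measurable_id).pow_const 2).ennreal_ofReal
  have hv' : (v : ℝ) ≠ 0 := by exact_mod_cast hv
  rw [gaussianReal_of_var_ne_zero _ hv, gaussianReal_of_var_ne_zero _ hv,
    ← withDensity_mul _ (measurable_gaussianPDF 0 v) hm]
  congr 1
  funext y
  rw [Pi.mul_apply, gaussianPDF_def, gaussianPDF_def]
  dsimp only
  rw [← ENNReal.ofReal_mul (gaussianPDFReal_nonneg 0 v y), gaussianPDFReal_def,
    gaussianPDFReal_def]
  dsimp only
  rw [rootDensity, ← Real.exp_nat_mul, mul_assoc (√(2 * Real.pi * v))⁻¹,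
    ← Real.exp_add]
  congr 3
  push_cast
  field_simp
  ring

/-- The Hellinger affinity of two Gaussians with equal variance, read off from the moment generating
function of `N(0, v)`. -/
lemma lintegral_rootDensity_mul {v : ℝ≥0} (hv : v ≠ 0) (a b : ℝ) :
    ∫⁻ y, ENNReal.ofReal (rootDensity v a y * rootDensity v b y) ∂(gaussianReal 0 v)
      = ENNReal.ofReal (Real.exp (-(a - b) ^ 2 / (8 * v))) := by
  have hv' : (v : ℝ) ≠ 0 := by exact_mod_cast hv
  have e : ∀ y, rootDensity v a y * rootDensity v b y
      = Real.exp (-(a ^ 2 + b ^ 2) / (4 * v)) * Real.exp ((a + b) / (2 * v) * y) := fun y => by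
    rw [rootDensity, rootDensity, ← Real.exp_add, ← Real.exp_add]
    congr 1
    field_simp
    ring
  have hi := integrable_exp_mul_gaussianReal (μ := 0) (v := v) ((a + b) / (2 * v))
  have hm := congrFun (mgf_id_gaussianReal (μ := 0) (v := v)) ((a + b) / (2 * v))
  simp_rw [e]
  rw [← ofReal_integral_eq_lintegral_ofReal (hi.const_mul _) (ae_of_all _ fun y => by positivity),
    integral_const_mul]
  simp only [mgf, id] at hm
  rw [hm, ← Real.exp_add]
  congr 2
  field_simp
  ring

/-- The density root of the law of labelled data. -/
def dataRoot {Ω : Type*} {n : ℕ} (v : ℝ≥0) (g : Ω → ℝ) (D : Fin n → Ω × ℝ) : ℝ :=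
  ∏ i, rootDensity v (g (D i).1) (D i).2

lemma dataRoot_nonneg {Ω : Type*} {n : ℕ} (v : ℝ≥0) (g : Ω → ℝ) (D : Fin n → Ω × ℝ) :
    0 ≤ dataRoot v g D :=
  Finset.prod_nonneg fun _ _ => (rootDensity_pos _ _ _).le

section Model

variable {Ω : Type*} [MeasurableSpace Ω]

lemma map_prod_gaussianReal_eq_withDensity (μ : Measure Ω) [SFinite μ] {v : ℝ≥0} (hv : v ≠ 0)
    {g : Ω → ℝ} (hg : Measurable g) :
    (μ.prod (gaussianReal 0 v)).map (fun z => (z.1, g z.1 + z.2))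
      = (μ.prod (gaussianReal 0 v)).withDensity
          fun z => ENNReal.ofReal (rootDensity v (g z.1) z.2 ^ 2) := by
  have hS : Measurable fun z : Ω × ℝ => ENNReal.ofReal (rootDensity v (g z.1) z.2 ^ 2) :=
    ((measurable_rootDensity v (hg.comp measurable_fst) measurable_snd).pow_const 2).ennreal_ofReal
  have hf : Measurable fun z : Ω × ℝ => (z.1, g z.1 + z.2) := by fun_prop
  ext s hs
  rw [Measure.map_apply hf hs, Measure.prod_apply (hf hs), withDensity_apply _ hs,
    ← lintegral_indicator hs, lintegral_prod _ (hS.indicator hs).aemeasurable]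
  refine lintegral_congr fun x => ?_
  have hx : MeasurableSet (Prod.mk x ⁻¹' s) := measurable_prodMk_left hs
  have e := gaussianReal_map_const_add (μ := 0) (v := v) (g x)
  rw [zero_add, gaussianReal_eq_withDensity_rootDensity hv (g x)] at e
  have e2 := congrArg (fun ρ => ρ (Prod.mk x ⁻¹' s)) e
  rw [Measure.map_apply (measurable_const_add _) hx, withDensity_apply _ hx,
    ← lintegral_indicator hx] at e2
  exact e2

lemma lintegral_pi_withDensity {n : ℕ} (R : Measure Ω) [IsProbabilityMeasure R] {p : Ω → ℝ≥0∞}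
    (hp : Measurable p) [IsProbabilityMeasure (R.withDensity p)] {F : (Fin n → Ω) → ℝ≥0∞}
    (hF : Measurable F) :
    ∫⁻ D, F D ∂(Measure.pi fun _ : Fin n => R.withDensity p)
      = ∫⁻ D, (∏ i, p (D i)) * F D ∂(Measure.pi fun _ : Fin n => R) := by
  have hprod : Measurable fun D : Fin n → Ω => ∏ i, p (D i) :=
    Finset.measurable_fun_prod _ fun i _ => hp.comp (measurable_pi_apply i)
  have e : (Measure.pi fun _ : Fin n => R.withDensity p)
      = (Measure.pi fun _ : Fin n => R).withDensity fun D => ∏ i, p (D i) := by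
    refine Measure.pi_eq fun s hs => ?_
    rw [withDensity_apply _ (MeasurableSet.univ_pi hs),
      ← lintegral_indicator (MeasurableSet.univ_pi hs)]
    have h1 : ∀ D : Fin n → Ω, (univ.pi s).indicator (fun D => ∏ i, p (D i)) D
        = ∏ i, (s i).indicator p (D i) := fun D => by
      by_cases h : D ∈ univ.pi s
      · rw [indicator_of_mem h]
        exact Finset.prod_congr rfl fun i _ => (indicator_of_mem (h i (mem_univ i)) _).symm
      · rw [indicator_of_notMem h]
        simp only [mem_univ_pi, not_forall] at h
        obtain ⟨i, hi⟩ := h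
        exact (Finset.prod_eq_zero (Finset.mem_univ i) (indicator_of_notMem hi _)).symm
    simp_rw [h1]
    rw [lintegral_pi_prod R (fun i => (s i).indicator p) fun i => hp.indicator (hs i)]
    refine Finset.prod_congr rfl fun i _ => ?_
    rw [withDensity_apply _ (hs i), ← lintegral_indicator (hs i)]
  rw [e, lintegral_withDensity_eq_lintegral_mul _ hprod hF]
  rfl

/-- The two-point method: densities with affinity at least `1 / 2` cannot be distinguished. -/
lemma two_point_le {ρ : Measure Ω} {S T φ : Ω → ℝ} (hS : Measurable S) (hT : Measurable T)
    (hφ : Measurable φ) (hS0 : ∀ z, 0 ≤ S z) (hT0 : ∀ z, 0 ≤ T z)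
    (hS1 : ∫⁻ z, ENNReal.ofReal (S z ^ 2) ∂ρ = 1) (hT1 : ∫⁻ z, ENNReal.ofReal (T z ^ 2) ∂ρ = 1)
    (hST : ENNReal.ofReal (1 / 2) ≤ ∫⁻ z, ENNReal.ofReal (S z * T z) ∂ρ) (f : ℝ) :
    ENNReal.ofReal (f ^ 2 / 2)
      ≤ (∫⁻ z, ENNReal.ofReal (S z ^ 2) * ENNReal.ofReal ((f - φ z) ^ 2) ∂ρ)
        + ∫⁻ z, ENNReal.ofReal (T z ^ 2) * ENNReal.ofReal ((-f - φ z) ^ 2) ∂ρ := by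
  have mS : Measurable fun z => ENNReal.ofReal (S z ^ 2) := (hS.pow_const 2).ennreal_ofReal
  have mT : Measurable fun z => ENNReal.ofReal (T z ^ 2) := (hT.pow_const 2).ennreal_ofReal
  have mA : Measurable fun z => ENNReal.ofReal (S z ^ 2) * ENNReal.ofReal ((f - φ z) ^ 2) :=
    mS.mul ((hφ.const_sub f).pow_const 2).ennreal_ofReal
  have mB : Measurable fun z => ENNReal.ofReal (T z ^ 2) * ENNReal.ofReal ((-f - φ z) ^ 2) :=
    mT.mul ((hφ.const_sub (-f)).pow_const 2).ennreal_ofReal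
  -- Since `2 * f = (f - φ) + (f + φ)`, the left side is `f * S * T * (f - φ) + f * S * T * (f +
  -- φ)`. Each summand is split by `u * w ≤ u ^ 2 + w ^ 2 / 4`, with the error term as `u`. After
  -- integration the quarter terms total `f ^ 2 / 2`, against at least `f ^ 2` on the left.
  have key : ∀ z, ENNReal.ofReal (2 * f ^ 2) * ENNReal.ofReal (S z * T z)
      ≤ (ENNReal.ofReal (S z ^ 2) * ENNReal.ofReal ((f - φ z) ^ 2)
          + ENNReal.ofReal (T z ^ 2) * ENNReal.ofReal ((-f - φ z) ^ 2))
        + ENNReal.ofReal (f ^ 2 / 4) * (ENNReal.ofReal (S z ^ 2) + ENNReal.ofReal (T z ^ 2)) := by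
    intro z
    have := mul_nonneg (hS0 z) (hT0 z)
    rw [← ENNReal.ofReal_mul (by positivity), ← ENNReal.ofReal_mul (by positivity),
      ← ENNReal.ofReal_mul (by positivity), ← ENNReal.ofReal_add (by positivity) (by positivity),
      ← ENNReal.ofReal_add (by positivity) (by positivity), ← ENNReal.ofReal_mul (by positivity),
      ← ENNReal.ofReal_add (by positivity) (by positivity)]
    apply ENNReal.ofReal_le_ofReal
    nlinarith [sq_nonneg ((f - φ z) * S z - f * T z / 2), sq_nonneg ((f + φ z) * T z - f * S z / 2)]
  have mST : Measurable fun z => ENNReal.ofReal (S z * T z) := (hS.mul hT).ennreal_ofReal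
  have mAB := mA.add mB
  have mSS := mS.add mT
  simp only [Pi.add_def] at mAB mSS
  have hint := lintegral_mono (μ := ρ) key
  rw [lintegral_const_mul _ mST, lintegral_add_left mAB,
    lintegral_add_left mA, lintegral_const_mul _ mSS, lintegral_add_left mS, hS1,
    hT1] at hint
  have h1 : ENNReal.ofReal (f ^ 2) ≤ ENNReal.ofReal (2 * f ^ 2)
      * ∫⁻ z, ENNReal.ofReal (S z * T z) ∂ρ := by
    calc ENNReal.ofReal (f ^ 2) = ENNReal.ofReal (2 * f ^ 2) * ENNReal.ofReal (1 / 2) := by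
          rw [← ENNReal.ofReal_mul (by positivity)]
          congr 1
          ring
      _ ≤ _ := by gcongr
  have h2 : ENNReal.ofReal (f ^ 2 / 4) * (1 + 1) = ENNReal.ofReal (f ^ 2 / 2) := by
    rw [one_add_one_eq_two, ← ENNReal.ofReal_ofNat, ← ENNReal.ofReal_mul (by positivity)]
    congr 1
    ring
  have h3 := h1.trans hint
  have h4 : ENNReal.ofReal (f ^ 2) = ENNReal.ofReal (f ^ 2 / 2) + ENNReal.ofReal (f ^ 2 / 2) := by
    rw [← ENNReal.ofReal_add (by positivity) (by positivity), add_halves]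
  rw [h2, h4] at h3
  exact (ENNReal.add_le_add_iff_right ENNReal.ofReal_ne_top).1 h3

lemma measurable_dataRoot {n : ℕ} (v : ℝ≥0) {g : Ω → ℝ} (hg : Measurable g) :
    Measurable fun D : Fin n → Ω × ℝ => dataRoot v g D :=
  Finset.measurable_fun_prod _ fun i _ =>
    (measurable_rootDensity v (hg.comp measurable_fst) measurable_snd).comp (measurable_pi_apply i)

/-- The affinity is multiplicative over independent observations, and for one observation it is the
mean over `x` of the Gaussian affinities. -/
lemma lintegral_dataRoot_mul {n : ℕ} (μ : Measure Ω) [IsProbabilityMeasure μ] {v : ℝ≥0}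
    (hv : v ≠ 0) {g h : Ω → ℝ} (hg : Measurable g) (hh : Measurable h) :
    ∫⁻ D : Fin n → Ω × ℝ, ENNReal.ofReal (dataRoot v g D * dataRoot v h D)
        ∂(Measure.pi fun _ => μ.prod (gaussianReal 0 v))
      = (∫⁻ x, ENNReal.ofReal (Real.exp (-(g x - h x) ^ 2 / (8 * v))) ∂μ) ^ n := by
  obtain ⟨p, hp⟩ : ∃ p : Ω × ℝ → ℝ≥0∞, p = fun z =>
    ENNReal.ofReal (rootDensity v (g z.1) z.2 * rootDensity v (h z.1) z.2) := ⟨_, rfl⟩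
  have hm : Measurable p := by
    rw [hp]
    exact ((measurable_rootDensity v (hg.comp measurable_fst) measurable_snd).mul
      (measurable_rootDensity v (hh.comp measurable_fst) measurable_snd)).ennreal_ofReal
  have e : ∀ D : Fin n → Ω × ℝ, ENNReal.ofReal (dataRoot v g D * dataRoot v h D)
      = ∏ i, p (D i) := fun D => by
    rw [dataRoot, dataRoot, ← Finset.prod_mul_distrib, ENNReal.ofReal_prod_of_nonneg, hp]
    exact fun i _ => (mul_pos (rootDensity_pos _ _ _) (rootDensity_pos _ _ _)).le
  simp_rw [e]
  have e2 : ∫⁻ D : Fin n → Ω × ℝ, ∏ i, p (D i) ∂(Measure.pi fun _ => μ.prod (gaussianReal 0 v))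
      = (∫⁻ z, p z ∂(μ.prod (gaussianReal 0 v))) ^ n := by
    rw [lintegral_pi_prod (μ.prod (gaussianReal 0 v)) (fun _ : Fin n => p) fun _ => hm,
      Finset.prod_const, Finset.card_univ, Fintype.card_fin]
  rw [e2, lintegral_prod _ hm.aemeasurable]
  refine congrArg (· ^ n) (lintegral_congr fun x => ?_)
  rw [hp]
  exact lintegral_rootDensity_mul hv (g x) (h x)

lemma lintegral_pi_gaussian {n : ℕ} (μ : Measure Ω) [IsProbabilityMeasure μ] {v : ℝ≥0}
    (hv : v ≠ 0) {g : Ω → ℝ} (hg : Measurable g) {F : (Fin n → Ω × ℝ) → ℝ≥0∞}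
    (hF : Measurable F) :
    ∫⁻ D, F D
        ∂(Measure.pi fun _ => (μ.prod (gaussianReal 0 v)).map fun z => (z.1, g z.1 + z.2))
      = ∫⁻ D, ENNReal.ofReal (dataRoot v g D ^ 2) * F D
        ∂(Measure.pi fun _ => μ.prod (gaussianReal 0 v)) := by
  have hS : Measurable fun z : Ω × ℝ => ENNReal.ofReal (rootDensity v (g z.1) z.2 ^ 2) :=
    ((measurable_rootDensity v (hg.comp measurable_fst) measurable_snd).pow_const 2).ennreal_ofReal
  have hP : IsProbabilityMeasure ((μ.prod (gaussianReal 0 v)).withDensity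
      fun z => ENNReal.ofReal (rootDensity v (g z.1) z.2 ^ 2)) := by
    rw [← map_prod_gaussianReal_eq_withDensity μ hv hg]
    exact Measure.isProbabilityMeasure_map (by fun_prop)
  rw [map_prod_gaussianReal_eq_withDensity μ hv hg, lintegral_pi_withDensity _ hS hF]
  refine lintegral_congr fun D => ?_
  rw [dataRoot, ← Finset.prod_pow, ENNReal.ofReal_prod_of_nonneg fun i _ => sq_nonneg _]

/-- Two regression functions that are close in mean square cannot be distinguished from Gaussian
data. -/
lemma two_point_gaussian_le {n : ℕ} (μ : Measure Ω) [IsProbabilityMeasure μ] {v : ℝ≥0}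
    (hv : v ≠ 0) {g h : Ω → ℝ} (hg : Measurable g) (hh : Measurable h) {δ : ℝ} (hδ0 : 0 ≤ δ)
    (hδ : n * δ ≤ 1 / 2)
    (hgh : ∫⁻ x, ENNReal.ofReal ((g x - h x) ^ 2 / (8 * v)) ∂μ ≤ ENNReal.ofReal δ)
    {φ : (Fin n → Ω × ℝ) → ℝ} (hφ : Measurable φ) (f : ℝ) :
    ENNReal.ofReal (f ^ 2 / 2)
      ≤ (∫⁻ D, ENNReal.ofReal ((f - φ D) ^ 2)
          ∂(Measure.pi fun _ => (μ.prod (gaussianReal 0 v)).map fun z => (z.1, g z.1 + z.2)))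
        + ∫⁻ D, ENNReal.ofReal ((-f - φ D) ^ 2)
          ∂(Measure.pi fun _ => (μ.prod (gaussianReal 0 v)).map fun z => (z.1, h z.1 + z.2)) := by
  have hone : ∀ g : Ω → ℝ, Measurable g →
      ∫⁻ D : Fin n → Ω × ℝ, ENNReal.ofReal (dataRoot v g D ^ 2)
        ∂(Measure.pi fun _ => μ.prod (gaussianReal 0 v)) = 1 := fun g hg => by
    simp_rw [sq]
    rw [lintegral_dataRoot_mul μ hv hg hg]
    simp
  have hhalf : ENNReal.ofReal (1 / 2)
      ≤ (∫⁻ x, ENNReal.ofReal (Real.exp (-(g x - h x) ^ 2 / (8 * v))) ∂μ) ^ n := by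
    -- One observation has affinity at least `1 - δ`, by `exp (-t) ≥ 1 - t`. Bernoulli's inequality
    -- then gives `(1 - δ) ^ n ≥ 1 - n * δ ≥ 1 / 2`.
    have hlow : ENNReal.ofReal (1 - δ)
        ≤ ∫⁻ x, ENNReal.ofReal (Real.exp (-(g x - h x) ^ 2 / (8 * v))) ∂μ := by
      rw [ENNReal.ofReal_sub _ hδ0, ENNReal.ofReal_one]
      refine tsub_le_iff_right.2 (le_trans ?_ (add_le_add le_rfl hgh))
      have hmd : Measurable fun x => ENNReal.ofReal ((g x - h x) ^ 2 / (8 * v)) := by fun_prop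
      rw [← lintegral_add_right _ hmd]
      calc (1 : ℝ≥0∞) = ∫⁻ _x, 1 ∂μ := by simp
        _ ≤ _ := by
          refine lintegral_mono fun x => ?_
          rw [← ENNReal.ofReal_add (Real.exp_pos _).le (by positivity), ← ENNReal.ofReal_one]
          apply ENNReal.ofReal_le_ofReal
          have := Real.add_one_le_exp (-(g x - h x) ^ 2 / (8 * v))
          rw [neg_div] at this ⊢
          linarith
    rcases Nat.eq_zero_or_pos n with rfl | hn
    · rw [pow_zero, ← ENNReal.ofReal_one]
      exact ENNReal.ofReal_le_ofReal (by norm_num)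
    have hn1 : (1 : ℝ) ≤ n := by exact_mod_cast hn
    have hδ1 : δ ≤ 1 / 2 := by nlinarith
    calc ENNReal.ofReal (1 / 2) ≤ ENNReal.ofReal ((1 - δ) ^ n) := by
          apply ENNReal.ofReal_le_ofReal
          have := one_add_mul_le_pow (a := -δ) (by linarith) n
          rw [← sub_eq_add_neg] at this
          linarith
      _ = ENNReal.ofReal (1 - δ) ^ n := ENNReal.ofReal_pow (by linarith) n
      _ ≤ _ := by gcongr
  rw [lintegral_pi_gaussian μ hv hg ((hφ.const_sub f).pow_const 2).ennreal_ofReal,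
    lintegral_pi_gaussian μ hv hh ((hφ.const_sub (-f)).pow_const 2).ennreal_ofReal]
  exact two_point_le (measurable_dataRoot v hg) (measurable_dataRoot v hh) hφ
    (dataRoot_nonneg v g) (dataRoot_nonneg v h) (hone g hg) (hone h hh)
    (by rw [lintegral_dataRoot_mul μ hv hg hh]; exact hhalf) f

end Model

end BSP

end

/-! ### Signed bumps on a grid. -/

noncomputable section

namespace BSP

lemma volume_setOf_forall_mem {d : ℕ} {s : Fin d → Set ℝ} (hs : ∀ i, MeasurableSet (s i)) :
    volume {x : Pt d | ∀ i, x i ∈ s i} = ∏ i, volume (s i) := by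
  have e : {x : Pt d | ∀ i, x i ∈ s i} = WithLp.ofLp ⁻¹' (univ.pi s) := by
    ext x
    simp
  rw [e, (PiLp.volume_preserving_ofLp (Fin d)).measure_preimage
    (MeasurableSet.univ_pi hs).nullMeasurableSet, volume_pi_pi]

instance isProbabilityMeasure_restrict_cube (d : ℕ) :
    IsProbabilityMeasure ((volume : Measure (Pt d)).restrict (cube d)) := by
  constructor
  rw [Measure.restrict_apply_univ, cube, volume_setOf_forall_mem fun _ => measurableSet_Icc]
  simp

section Grid

variable {d : ℕ}

/-- The walls between the cubes of side `1 / k`. -/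
def walls (d k : ℕ) : Set (Pt d) := {x | ∃ i, ∃ N : ℤ, (k : ℝ) * x i = N}

/-- The distance to the walls, scaled by `a`. -/
def bump (a : ℝ) (k : ℕ) (x : Pt d) : ℝ := a * Metric.infDist x (walls d k)

lemma bump_nonneg {a : ℝ} (ha : 0 ≤ a) (k : ℕ) (x : Pt d) : 0 ≤ bump a k x :=
  mul_nonneg ha Metric.infDist_nonneg

lemma measurable_bump (a : ℝ) (k : ℕ) : Measurable (bump (d := d) a k) :=
  (measurable_const.mul (Metric.continuous_infDist_pt _).measurable)

lemma abs_bump_sub_le {a : ℝ} (ha : 0 ≤ a) (k : ℕ) (x y : Pt d) :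
    |bump a k x - bump a k y| ≤ a * dist x y := by
  have := (Metric.lipschitz_infDist_pt (walls d k)).dist_le_mul x y
  rw [Real.dist_eq, NNReal.coe_one, one_mul] at this
  rw [bump, bump, ← mul_sub, abs_mul, abs_of_nonneg ha]
  gcongr

/-- Lowering the first coordinate to the nearest multiple of `1 / k` below it reaches a wall within
distance `1 / k`. -/
lemma bump_le {a : ℝ} (ha : 0 ≤ a) {k : ℕ} (hk : 0 < k) (hd : 0 < d) (x : Pt d) :
    bump a k x ≤ a / k := by
  have hk' : (0 : ℝ) < k := by exact_mod_cast hk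
  set i : Fin d := ⟨0, hd⟩
  set t : ℝ := (⌊(k : ℝ) * x i⌋ : ℝ) / k - x i with ht
  have hz : x + EuclideanSpace.single i t ∈ walls d k := by
    refine ⟨i, ⌊(k : ℝ) * x i⌋, ?_⟩
    simp [ht]
    field_simp
  have h1 := Metric.infDist_le_dist_of_mem (x := x) hz
  rw [dist_self_add_right, PiLp.norm_single, Real.norm_eq_abs] at h1
  have h2 : |t| ≤ 1 / k := by
    have h3 := Int.floor_le ((k : ℝ) * x i)
    have h4 := Int.lt_floor_add_one ((k : ℝ) * x i)
    have e : t = (⌊(k : ℝ) * x i⌋ - k * x i) / k := by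
      rw [ht]
      field_simp
    rw [e, abs_div, abs_of_pos hk']
    gcongr
    rw [abs_le]
    constructor <;> linarith
  calc bump a k x ≤ a * (1 / k) := mul_le_mul_of_nonneg_left (h1.trans h2) ha
    _ = a / k := by ring

/-- The points of the unit interval away from the multiples of `1 / k`. -/
def middle (k : ℕ) : Set ℝ :=
  ⋃ j : Fin k, Icc (((j : ℕ) + 1 / 4 : ℝ) / k) (((j : ℕ) + 3 / 4 : ℝ) / k)

lemma measurableSet_middle (k : ℕ) : MeasurableSet (middle k) :=
  MeasurableSet.iUnion fun _ => measurableSet_Icc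

lemma middle_subset (k : ℕ) : middle k ⊆ Icc 0 1 := by
  intro t ht
  obtain ⟨j, h1, h2⟩ := mem_iUnion.1 ht
  have hk : (0 : ℝ) < k := by exact_mod_cast j.pos
  have hj : ((j : ℕ) : ℝ) + 1 ≤ k := by exact_mod_cast j.2
  refine ⟨le_trans (by positivity) h1, h2.trans ?_⟩
  rw [div_le_one hk]
  linarith

lemma volume_middle {k : ℕ} (hk : 0 < k) : volume (middle k) = ENNReal.ofReal (1 / 2) := by
  have hk' : (0 : ℝ) < k := by exact_mod_cast hk
  rw [middle, measure_iUnion]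
  · have e : ∀ j : Fin k, volume (Icc (((j : ℕ) + 1 / 4 : ℝ) / k) (((j : ℕ) + 3 / 4 : ℝ) / k))
        = ENNReal.ofReal (1 / (2 * k)) := fun j => by
      rw [Real.volume_Icc]
      congr 1
      field_simp
      ring
    simp_rw [e]
    rw [tsum_fintype, Finset.sum_const, Finset.card_univ, Fintype.card_fin, nsmul_eq_mul,
      ← ENNReal.ofReal_natCast, ← ENNReal.ofReal_mul hk'.le]
    congr 1
    field_simp
  · intro i j hij
    refine Set.disjoint_left.2 fun t hi hj => hij ?_
    have h1 := (div_le_iff₀ hk').1 hi.1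
    have h2 := (le_div_iff₀ hk').1 hi.2
    have h3 := (div_le_iff₀ hk').1 hj.1
    have h4 := (le_div_iff₀ hk').1 hj.2
    have h5 : ((i : ℕ) : ℝ) < (j : ℕ) + 1 := by linarith
    have h6 : ((j : ℕ) : ℝ) < (i : ℕ) + 1 := by linarith
    have h7 : (i : ℕ) < j + 1 := by exact_mod_cast h5
    have h8 : (j : ℕ) < i + 1 := by exact_mod_cast h6
    exact Fin.ext (by omega)
  · exact fun _ => measurableSet_Icc

/-- Each `k * x i` is at least `1 / 4` away from every integer, so no wall is closer than `1 / (4 *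
k)`. -/
lemma le_bump {a : ℝ} (ha : 0 ≤ a) {k : ℕ} (hk : 0 < k) (hd : 0 < d) {x : Pt d}
    (hx : ∀ i, x i ∈ middle k) : a / (4 * k) ≤ bump a k x := by
  have hk' : (0 : ℝ) < k := by exact_mod_cast hk
  have hne : (walls d k).Nonempty := ⟨0, ⟨0, hd⟩, 0, by simp⟩
  have h : 1 / (4 * k : ℝ) ≤ Metric.infDist x (walls d k) := by
    refine (Metric.le_infDist hne).2 fun z ⟨i, N, hN⟩ => ?_
    obtain ⟨j, h1, h2⟩ := mem_iUnion.1 (hx i)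
    have h1' := (div_le_iff₀ hk').1 h1
    have h2' := (le_div_iff₀ hk').1 h2
    have h3 : |x i - z i| ≤ dist x z := by
      have := PiLp.norm_apply_le (x - z) i
      rwa [PiLp.sub_apply, Real.norm_eq_abs, ← dist_eq_norm] at this
    refine le_trans ?_ h3
    rw [div_le_iff₀ (by positivity)]
    have h4 : (1 : ℝ) / 4 ≤ |k * x i - N| := by
      rcases le_or_gt N (j : ℕ) with hNj | hNj
      · have : (N : ℝ) ≤ (j : ℕ) := by exact_mod_cast hNj
        exact le_trans (by linarith) (le_abs_self _)
      · have : ((j : ℕ) : ℝ) + 1 ≤ N := by exact_mod_cast hNj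
        exact le_trans (by linarith) (neg_le_abs _)
    rw [← hN, ← mul_sub, abs_mul, abs_of_pos hk'] at h4
    linarith
  calc a / (4 * k) = a * (1 / (4 * k)) := by ring
    _ ≤ _ := mul_le_mul_of_nonneg_left h ha

/-- The index of the cube of side `1 / k` that contains a point. -/
def gridIndex (k : ℕ) (x : Pt d) : Fin d → Fin (k + 1) :=
  fun i => Fin.ofNat (k + 1) ⌊(k : ℝ) * x i⌋₊

lemma measurable_gridIndex (k : ℕ) : Measurable (gridIndex (d := d) k) :=
  measurable_pi_lambda _ fun i => (Measurable.of_discrete (f := Fin.ofNat (k + 1))).comp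
    (Nat.measurable_floor.comp (by fun_prop))

/-- The segment between points of different grid cells crosses a wall, and the crossing point splits
its length into two parts that bound the two distances to the walls. Hence opposite signs in
neighbouring cells do not worsen the Lipschitz constant. -/
lemma bump_add_bump_le {a : ℝ} (ha : 0 ≤ a) {k : ℕ} {x y : Pt d} (hx : x ∈ cube d)
    (hy : y ∈ cube d) (h : gridIndex k x ≠ gridIndex k y) :
    bump a k x + bump a k y ≤ a * dist x y := by
  obtain ⟨i, hi⟩ := Function.ne_iff.1 h
  have hfl : ⌊(k : ℝ) * x i⌋₊ ≠ ⌊(k : ℝ) * y i⌋₊ := fun e => hi (by simp only [gridIndex, e])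
  clear h hi
  wlog hlt : ⌊(k : ℝ) * x i⌋₊ < ⌊(k : ℝ) * y i⌋₊ generalizing x y
  · rw [add_comm, dist_comm]
    exact this hy hx hfl.symm (lt_of_le_of_ne (not_lt.1 hlt) hfl.symm)
  set N := ⌊(k : ℝ) * y i⌋₊
  have h1 : (k : ℝ) * x i < N := (Nat.floor_lt (mul_nonneg (Nat.cast_nonneg k) (hx i).1)).1 hlt
  have h2 : (N : ℝ) ≤ k * y i := Nat.floor_le (mul_nonneg (Nat.cast_nonneg k) (hy i).1)
  have h3 : (0 : ℝ) < k * y i - k * x i := by linarith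
  set t : ℝ := (N - k * x i) / (k * y i - k * x i) with ht
  have ht0 : 0 ≤ t := div_nonneg (by linarith) h3.le
  have ht1 : t ≤ 1 := (div_le_one h3).2 (by linarith)
  have hte : t * (k * y i - k * x i) = N - k * x i := div_mul_cancel₀ _ h3.ne'
  have hz : AffineMap.lineMap x y t ∈ walls d k := by
    refine ⟨i, N, ?_⟩
    rw [AffineMap.lineMap_apply_module]
    simp only [PiLp.add_apply, PiLp.smul_apply, smul_eq_mul, Int.cast_natCast]
    linear_combination hte
  have hseg : AffineMap.lineMap x y t ∈ _root_.segment ℝ x y := by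
    rw [segment_eq_image_lineMap]
    exact ⟨t, ⟨ht0, ht1⟩, rfl⟩
  have hd := dist_add_dist_of_mem_segment hseg
  have hx' := Metric.infDist_le_dist_of_mem (x := x) hz
  have hy' := Metric.infDist_le_dist_of_mem (x := y) hz
  rw [dist_comm y] at hy'
  rw [bump, bump, ← mul_add]
  exact mul_le_mul_of_nonneg_left (by linarith) ha

lemma volume_gridCell_le {k : ℕ} (hk : 0 < k) (j : Fin d → Fin (k + 1)) :
    (volume.restrict (cube d)) {x | gridIndex k x = j} ≤ ENNReal.ofReal (1 / k) ^ d := by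
  have hk' : (0 : ℝ) < k := by exact_mod_cast hk
  have hm : MeasurableSet {x : Pt d | gridIndex k x = j} :=
    measurable_gridIndex k (measurableSet_singleton j)
  rw [Measure.restrict_apply hm]
  have hsub : {x : Pt d | gridIndex k x = j} ∩ cube d
      ⊆ {x | ∀ i, x i ∈ Icc (((j i : ℕ) : ℝ) / k) (((j i : ℕ) + 1 : ℝ) / k)} := by
    intro x hx i
    obtain ⟨hxj, hxc⟩ := hx
    have h0 : 0 ≤ (k : ℝ) * x i := mul_nonneg hk'.le (hxc i).1
    -- On the cube the reduction modulo `k + 1` in `gridIndex` does nothing; the extra index `k`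
    -- occurs only at `x i = 1`.
    have hfl : ⌊(k : ℝ) * x i⌋₊ ≤ k :=
      Nat.floor_le_of_le (mul_le_of_le_one_right hk'.le (hxc i).2)
    have e : (j i : ℕ) = ⌊(k : ℝ) * x i⌋₊ := by
      rw [← congrFun (hxj : gridIndex k x = j) i, gridIndex]
      exact Nat.mod_eq_of_lt (by omega)
    rw [e, mem_Icc, div_le_iff₀ hk', le_div_iff₀ hk', mul_comm (x i)]
    exact ⟨Nat.floor_le h0, (Nat.lt_floor_add_one _).le⟩
  refine (measure_mono hsub).trans ?_
  rw [volume_setOf_forall_mem fun _ => measurableSet_Icc]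
  have e : ∀ i, volume (Icc (((j i : ℕ) : ℝ) / k) (((j i : ℕ) + 1 : ℝ) / k))
      = ENNReal.ofReal (1 / k) := fun i => by
    rw [Real.volume_Icc]
    congr 1
    ring
  simp [e]

/-- The bumps on the grid, with signs. -/
def signedBump (a : ℝ) (k : ℕ) (ω : (Fin d → Fin (k + 1)) → Bool) (x : Pt d) : ℝ :=
  bif ω (gridIndex k x) then bump a k x else -bump a k x

lemma sq_signedBump (a : ℝ) (k : ℕ) (ω : (Fin d → Fin (k + 1)) → Bool) (x : Pt d) :
    signedBump a k ω x ^ 2 = bump a k x ^ 2 := by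
  unfold signedBump
  cases ω (gridIndex k x) <;> simp

lemma abs_signedBump {a : ℝ} (ha : 0 ≤ a) (k : ℕ) (ω : (Fin d → Fin (k + 1)) → Bool) (x : Pt d) :
    |signedBump a k ω x| = bump a k x := by
  rw [← abs_of_nonneg (bump_nonneg ha k x)]
  exact sq_eq_sq_iff_abs_eq_abs _ _ |>.1 (sq_signedBump a k ω x)

lemma measurable_signedBump (a : ℝ) (k : ℕ) (ω : (Fin d → Fin (k + 1)) → Bool) :
    Measurable (signedBump a k ω) := by
  have hω : MeasurableSet {x : Pt d | ω (gridIndex k x) = true} :=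
    measurable_gridIndex k (MeasurableSet.of_discrete (s := {j | ω j = true}))
  have e : signedBump a k ω = fun x => if ω (gridIndex k x) = true then bump a k x
      else -bump a k x := by
    funext x
    unfold signedBump
    cases ω (gridIndex k x) <;> rfl
  rw [e]
  exact Measurable.ite hω (measurable_bump a k) (measurable_bump a k).neg

lemma abs_signedBump_sub_le {a : ℝ} (ha : 0 ≤ a) {k : ℕ} (ω : (Fin d → Fin (k + 1)) → Bool)
    {x y : Pt d} (hx : x ∈ cube d) (hy : y ∈ cube d) :
    |signedBump a k ω x - signedBump a k ω y| ≤ a * dist x y := by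
  by_cases h : gridIndex k x = gridIndex k y
  · have := abs_bump_sub_le ha k x y
    unfold signedBump
    rw [h]
    cases ω (gridIndex k y)
    · rw [cond_false, cond_false, neg_sub_neg, abs_sub_comm]
      exact this
    · exact this
  · calc |signedBump a k ω x - signedBump a k ω y|
        ≤ |signedBump a k ω x| + |signedBump a k ω y| := abs_sub _ _
      _ ≤ a * dist x y := by
        rw [abs_signedBump ha, abs_signedBump ha]
        exact bump_add_bump_le ha hx hy h

lemma signedBump_mem_lipClass {L : ℝ≥0} {B a : ℝ} (ha : 0 ≤ a) (haL : a ≤ L) (haB : a ≤ B)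
    {k : ℕ} (hk : 0 < k) (hd : 0 < d) (ω : (Fin d → Fin (k + 1)) → Bool) :
    signedBump a k ω ∈ LipClass d L B := by
  refine ⟨LipschitzOnWith.of_dist_le_mul fun x hx y hy => ?_, fun x _ => ?_⟩
  · rw [Real.dist_eq]
    exact (abs_signedBump_sub_le ha ω hx hy).trans (mul_le_mul_of_nonneg_right haL dist_nonneg)
  · rw [abs_signedBump ha]
    have hk' : (1 : ℝ) ≤ k := by exact_mod_cast hk
    exact (bump_le ha hk hd x).trans ((div_le_self ha hk').trans haB)

/-- Changing the sign of one bump. -/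
def flip {k : ℕ} (j : Fin d → Fin (k + 1)) (ω : (Fin d → Fin (k + 1)) → Bool) :
    (Fin d → Fin (k + 1)) → Bool := Function.update ω j (!ω j)

lemma flip_involutive {k : ℕ} (j : Fin d → Fin (k + 1)) : Function.Involutive (flip j) := by
  intro ω
  funext i
  by_cases h : i = j
  · subst h
    simp [flip]
  · simp [flip, h]

lemma signedBump_flip (a : ℝ) (k : ℕ) (ω : (Fin d → Fin (k + 1)) → Bool) (x : Pt d) :
    signedBump a k (flip (gridIndex k x) ω) x = -signedBump a k ω x := by
  unfold signedBump flip
  rw [Function.update_self]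
  cases ω (gridIndex k x) <;> simp

lemma signedBump_flip_of_ne (a : ℝ) {k : ℕ} {j : Fin d → Fin (k + 1)}
    (ω : (Fin d → Fin (k + 1)) → Bool) {x : Pt d} (h : gridIndex k x ≠ j) :
    signedBump a k (flip j ω) x = signedBump a k ω x := by
  unfold signedBump flip
  rw [Function.update_of_ne h]

/-- The two functions differ only on one grid cell, of volume at most `(1 / k) ^ d`, and there by
twice the bump, which is at most `2 * a / k`. -/
lemma lintegral_signedBump_flip_le {a : ℝ} (ha : 0 ≤ a) {k : ℕ} (hk : 0 < k) (hd : 0 < d)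
    {v : ℝ≥0} (ω : (Fin d → Fin (k + 1)) → Bool) (j : Fin d → Fin (k + 1)) :
    ∫⁻ x in cube d,
        ENNReal.ofReal ((signedBump a k ω x - signedBump a k (flip j ω) x) ^ 2 / (8 * v))
      ≤ ENNReal.ofReal ((a / k) ^ 2 / (2 * v) * (1 / k) ^ d) := by
  have hm : MeasurableSet {x : Pt d | gridIndex k x = j} :=
    measurable_gridIndex k (measurableSet_singleton j)
  calc _ ≤ ∫⁻ x in cube d, {x | gridIndex k x = j}.indicator
          (fun _ => ENNReal.ofReal ((a / k) ^ 2 / (2 * v))) x := by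
        refine lintegral_mono fun x => ?_
        by_cases h : gridIndex k x = j
        · rw [indicator_of_mem (show x ∈ {x | gridIndex k x = j} from h)]
          apply ENNReal.ofReal_le_ofReal
          rw [← h, signedBump_flip, sub_neg_eq_add, ← two_mul, mul_pow, sq_signedBump]
          have h1 := pow_le_pow_left₀ (bump_nonneg ha k x) (bump_le ha hk hd x) 2
          calc 2 ^ 2 * bump a k x ^ 2 / (8 * v) ≤ 2 ^ 2 * (a / k) ^ 2 / (8 * v) := by gcongr
            _ = 4 * (a / k) ^ 2 / (4 * (2 * v)) := by ring
            _ = _ := mul_div_mul_left _ _ (by norm_num)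
        · rw [signedBump_flip_of_ne a ω h]
          simp
    _ = ENNReal.ofReal ((a / k) ^ 2 / (2 * v))
          * (volume.restrict (cube d)) {x | gridIndex k x = j} := lintegral_indicator_const hm _
    _ ≤ ENNReal.ofReal ((a / k) ^ 2 / (2 * v)) * ENNReal.ofReal (1 / k) ^ d := by
        gcongr
        exact volume_gridCell_le hk j
    _ = _ := by
        rw [← ENNReal.ofReal_pow (by positivity), ← ENNReal.ofReal_mul (by positivity)]

/-- On the product of the middle sets, which has volume `(1 / 2) ^ d`, the bump is at least `a / (4
* k)`. -/
lemma le_lintegral_sq_bump {a : ℝ} (ha : 0 ≤ a) {k : ℕ} (hk : 0 < k) (hd : 0 < d) :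
    ENNReal.ofReal ((a / (4 * k)) ^ 2 / 2 * (1 / 2) ^ d)
      ≤ ∫⁻ x in cube d, ENNReal.ofReal (bump a k x ^ 2 / 2) := by
  have hm : MeasurableSet {x : Pt d | ∀ i, x i ∈ middle k} := by
    rw [show {x : Pt d | ∀ i, x i ∈ middle k} = ⋂ i, (fun x : Pt d => x i) ⁻¹' middle k by
      ext; simp]
    exact MeasurableSet.iInter fun i => (measurableSet_middle k).preimage (by fun_prop)
  have hsub : {x : Pt d | ∀ i, x i ∈ middle k} ⊆ cube d := fun x hx i => middle_subset k (hx i)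
  calc _ = ENNReal.ofReal ((a / (4 * k)) ^ 2 / 2) * volume {x : Pt d | ∀ i, x i ∈ middle k} := by
        rw [volume_setOf_forall_mem fun _ => measurableSet_middle k]
        simp only [volume_middle hk, Finset.prod_const, Finset.card_univ, Fintype.card_fin]
        rw [← ENNReal.ofReal_pow (by positivity), ← ENNReal.ofReal_mul (by positivity)]
    _ = ∫⁻ _x in {x : Pt d | ∀ i, x i ∈ middle k}, ENNReal.ofReal ((a / (4 * k)) ^ 2 / 2) := by
        rw [setLIntegral_const]
    _ ≤ ∫⁻ x in {x : Pt d | ∀ i, x i ∈ middle k}, ENNReal.ofReal (bump a k x ^ 2 / 2) := by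
        refine setLIntegral_mono' hm fun x hx => ENNReal.ofReal_le_ofReal ?_
        have := le_bump ha hk hd hx
        gcongr
    _ ≤ _ := lintegral_mono_set hsub

end Grid

end BSP

end

/-! ### The minimax bound by averaging over signs. -/

noncomputable section

namespace BSP

section Minimax

variable {d n : ℕ}

lemma gaussianModel_map_fst {g : Pt d → ℝ} (hg : Measurable g) (σ : ℝ≥0) :
    (gaussianModel g σ).map Prod.fst = volume.restrict (cube d) := by
  rw [gaussianModel, Measure.map_map measurable_fst (by fun_prop)]
  exact measurePreserving_fst.map_eq

lemma isProbabilityMeasure_gaussianModel {g : Pt d → ℝ} (hg : Measurable g) (σ : ℝ≥0) :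
    IsProbabilityMeasure (gaussianModel g σ) :=
  Measure.isProbabilityMeasure_map (by fun_prop)

lemma measurable_sq_error {φ : Data d n → Pt d → ℝ} (hφ : Measurable (Function.uncurry φ))
    {g : Pt d → ℝ} (hg : Measurable g) :
    Measurable fun z : Pt d × Data d n => ENNReal.ofReal ((g z.1 - φ z.2 z.1) ^ 2) :=
  (((hg.comp measurable_fst).sub (hφ.comp measurable_swap)).pow_const 2).ennreal_ofReal

/-- For a fixed test point `x`, each sign pattern is paired with the one flipped at the cell of `x`.
Their values at `x` are opposite and their data cannot be told apart, so the two errors sum to at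
least `bump a k x ^ 2 / 2`. Flipping is an involution, so summing over patterns counts each error
twice, whence the factor `2`. -/
lemma le_sum_mse {a : ℝ} (ha : 0 ≤ a) {k : ℕ} (hk : 0 < k) (hd : 0 < d) {σ : ℝ≥0} (hσ : σ ≠ 0)
    (haσ : a ≤ σ) (hnk : (n : ℝ) ≤ k ^ (d + 2)) {φ : Data d n → Pt d → ℝ}
    (hφ : Measurable (Function.uncurry φ)) :
    ∑ _ω : (Fin d → Fin (k + 1)) → Bool, ENNReal.ofReal ((a / (4 * k)) ^ 2 / 2 * (1 / 2) ^ d)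
      ≤ 2 * ∑ ω, mse (gaussianModel (signedBump a k ω) σ) (signedBump a k ω) n φ := by
  have hk' : (0 : ℝ) < k := by exact_mod_cast hk
  have hσ' : (0 : ℝ) < σ := by exact_mod_cast pos_iff_ne_zero.2 hσ
  obtain ⟨I, hI⟩ : ∃ I : ((Fin d → Fin (k + 1)) → Bool) → Pt d → ℝ≥0∞, I = fun ω x =>
    ∫⁻ D, ENNReal.ofReal ((signedBump a k ω x - φ D x) ^ 2)
      ∂(Measure.pi fun _ : Fin n => gaussianModel (signedBump a k ω) σ) := ⟨_, rfl⟩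
  have hmI : ∀ ω, Measurable (I ω) := fun ω => by
    have := isProbabilityMeasure_gaussianModel (measurable_signedBump a k ω) σ
    rw [hI]
    exact (measurable_sq_error hφ (measurable_signedBump a k ω)).lintegral_prod_right'
  have hmse : ∀ ω, mse (gaussianModel (signedBump a k ω) σ) (signedBump a k ω) n φ
      = ∫⁻ x in cube d, I ω x := fun ω => by
    rw [mse, gaussianModel_map_fst (measurable_signedBump a k ω), hI]
  have hpair : ∀ ω x, ENNReal.ofReal (bump a k x ^ 2 / 2)
      ≤ I ω x + I (flip (gridIndex k x) ω) x := by
    intro ω x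
    -- The grid is fine enough, `n ≤ k ^ (d + 2)`, and the bumps are small against the noise, `a ≤
    -- σ`.
    have hδ : n * ((a / k) ^ 2 / (2 * ((σ ^ 2 : ℝ≥0) : ℝ)) * (1 / k : ℝ) ^ d) ≤ 1 / 2 := by
      have h1 : a ^ 2 ≤ (σ : ℝ) ^ 2 := pow_le_pow_left₀ ha haσ 2
      have e : n * ((a / k) ^ 2 / (2 * ((σ ^ 2 : ℝ≥0) : ℝ)) * (1 / k : ℝ) ^ d)
          = (n / k ^ (d + 2)) * (a ^ 2 / σ ^ 2) / 2 := by
        push_cast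
        rw [pow_add, one_div, inv_pow]
        field_simp
      rw [e]
      have h2 : n / (k : ℝ) ^ (d + 2) ≤ 1 := (div_le_one (by positivity)).2 hnk
      have h3 : a ^ 2 / (σ : ℝ) ^ 2 ≤ 1 := (div_le_one (by positivity)).2 h1
      have h4 := mul_le_one₀ h2 (by positivity) h3
      linarith
    have h := two_point_gaussian_le (n := n) (volume.restrict (cube d)) (v := σ ^ 2)
      (pow_ne_zero 2 hσ) (measurable_signedBump a k ω)
      (measurable_signedBump a k (flip (gridIndex k x) ω)) (by positivity) hδ
      (lintegral_signedBump_flip_le ha hk hd ω (gridIndex k x))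
      (φ := fun D => φ D x) (hφ.comp measurable_prodMk_right) (signedBump a k ω x)
    rw [sq_signedBump] at h
    rw [hI]
    simp only [signedBump_flip]
    exact h
  have hsum : ∀ x, ∑ _ω : (Fin d → Fin (k + 1)) → Bool, ENNReal.ofReal (bump a k x ^ 2 / 2)
      ≤ 2 * ∑ ω, I ω x := by
    intro x
    refine (Finset.sum_le_sum fun ω _ => hpair ω x).trans ?_
    rw [Finset.sum_add_distrib,
      Function.Bijective.sum_comp (flip_involutive (gridIndex k x)).bijective fun ω => I ω x,
    two_mul]
  have hmB : Measurable fun x : Pt d => ENNReal.ofReal (bump a k x ^ 2 / 2) :=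
    (((measurable_bump a k).pow_const 2).div_const 2).ennreal_ofReal
  simp_rw [hmse]
  rw [← lintegral_finsetSum _ fun ω _ => hmI ω,
    ← lintegral_const_mul _ (Finset.measurable_fun_sum _ fun ω _ => hmI ω)]
  refine (Finset.sum_le_sum fun ω _ => le_lintegral_sq_bump ha hk hd).trans ?_
  rw [← lintegral_finsetSum _ fun ω _ => hmB]
  exact lintegral_mono hsum

/-- Some sign pattern does at least as badly as the average. The constant is `4 ^ 2 * 2` from the
bump, doubled by the pairing. -/
lemma exists_signedBump_le_mse {a : ℝ} (ha : 0 ≤ a) {k : ℕ} (hk : 0 < k) (hd : 0 < d) {σ : ℝ≥0}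
    (hσ : σ ≠ 0) (haσ : a ≤ σ) (hnk : (n : ℝ) ≤ k ^ (d + 2)) {φ : Data d n → Pt d → ℝ}
    (hφ : Measurable (Function.uncurry φ)) :
    ∃ ω, ENNReal.ofReal (a ^ 2 / (64 * 2 ^ d * k ^ 2))
      ≤ mse (gaussianModel (signedBump a k ω) σ) (signedBump a k ω) n φ := by
  by_contra! h
  have h1 := le_sum_mse ha hk hd hσ haσ hnk hφ
  have h2 := ENNReal.sum_lt_sum_of_nonempty (s := Finset.univ) Finset.univ_nonempty
    fun ω _ => h ω
  have e : ENNReal.ofReal ((a / (4 * k)) ^ 2 / 2 * (1 / 2) ^ d)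
      = 2 * ENNReal.ofReal (a ^ 2 / (64 * 2 ^ d * k ^ 2)) := by
    rw [← ENNReal.ofReal_ofNat, ← ENNReal.ofReal_mul (by positivity)]
    congr 1
    rw [div_pow, div_pow, mul_pow, one_pow]
    ring
  rw [e, ← Finset.mul_sum] at h1
  exact absurd ((ENNReal.mul_le_mul_iff_right two_ne_zero ENNReal.ofNat_ne_top).1 h1) (not_le.2 h2)

/-- The minimax lower bound over Lipschitz functions. -/
theorem minimax_lower_bound (hd : 0 < d) {L σ : ℝ≥0} {B : ℝ} (hL : 0 < L) (hB : 0 < B)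
    (hσ : 0 < σ) :
    ∃ c : ℝ, 0 < c ∧ ∀ n : ℕ, 1 ≤ n →
      ∀ φ : Data d n → Pt d → ℝ, Measurable (Function.uncurry φ) →
        ∃ g ∈ LipClass d L B,
          ENNReal.ofReal (c * (n : ℝ) ^ (-(2 / ((d : ℝ) + 2))))
            ≤ mse (gaussianModel g σ) g n φ := by
  have hL' : (0 : ℝ) < L := by exact_mod_cast hL
  have hσ' : (0 : ℝ) < σ := by exact_mod_cast hσ
  -- The slope `a` of the bumps must respect the Lipschitz constant, the bound on the values and the
  -- noise level.
  obtain ⟨a, hadef⟩ : ∃ a : ℝ, a = min (L : ℝ) (min B σ) := ⟨_, rfl⟩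
  have ha : 0 < a := hadef ▸ lt_min hL' (lt_min hB hσ')
  have haL : a ≤ L := hadef ▸ min_le_left _ _
  have haB : a ≤ B := hadef ▸ (min_le_right _ _).trans (min_le_left _ _)
  have haσ : a ≤ σ := hadef ▸ (min_le_right _ _).trans (min_le_right _ _)
  -- The constant `64` grows by a factor `4` because `k = ⌈r⌉₊ ≤ 2 * r` for `r = n ^ (1 / (d + 2)) ≥
  -- 1`.
  refine ⟨a ^ 2 / (256 * 2 ^ d), by positivity, fun n hn φ hφ => ?_⟩
  have hn' : (1 : ℝ) ≤ n := by exact_mod_cast hn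
  have hn0 : (0 : ℝ) < n := by linarith
  obtain ⟨r, hr⟩ : ∃ r : ℝ, r = (n : ℝ) ^ (1 / ((d : ℝ) + 2)) := ⟨_, rfl⟩
  have hr1 : 1 ≤ r := hr ▸ Real.one_le_rpow hn' (by positivity)
  have hrn : r ^ (d + 2) = n := by
    rw [hr, ← Real.rpow_natCast, ← Real.rpow_mul hn0.le]
    push_cast
    rw [one_div, inv_mul_cancel₀ (by positivity), Real.rpow_one]
  have hr2 : (n : ℝ) ^ (-(2 / ((d : ℝ) + 2))) = 1 / r ^ 2 := by
    rw [hr, Real.rpow_neg hn0.le, ← Real.rpow_natCast, ← Real.rpow_mul hn0.le, one_div]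
    congr 2
    push_cast
    ring
  have hkr := Nat.le_ceil r
  have hkr2 := Nat.ceil_lt_add_one (zero_le_one.trans hr1)
  obtain ⟨k, hkdef⟩ : ∃ k : ℕ, k = ⌈r⌉₊ := ⟨_, rfl⟩
  rw [← hkdef] at hkr hkr2
  have hk1 : (1 : ℝ) ≤ k := hr1.trans hkr
  have hk : 0 < k := by exact_mod_cast (zero_lt_one.trans_le hk1)
  obtain ⟨ω, hω⟩ := exists_signedBump_le_mse ha.le hk hd hσ.ne' haσ
    (hrn ▸ pow_le_pow_left₀ (zero_le_one.trans hr1) hkr (d + 2)) hφ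
  refine ⟨_, signedBump_mem_lipClass ha.le haL haB hk hd ω, le_trans ?_ hω⟩
  apply ENNReal.ofReal_le_ofReal
  rw [hr2, div_mul_div_comm, mul_one]
  have hk2 : (k : ℝ) ^ 2 ≤ 4 * r ^ 2 := by nlinarith
  apply div_le_div_of_nonneg_left (by positivity) (by positivity)
  calc 64 * 2 ^ d * (k : ℝ) ^ 2 ≤ 64 * 2 ^ d * (4 * r ^ 2) := by gcongr
    _ = 256 * 2 ^ d * r ^ 2 := by ring

end Minimax

end BSP

end

theorem theorem3 (d : ℕ) (hd : 2 ≤ d) (L : ℝ≥0) (B : ℝ) (σ : ℝ≥0) (m : ℕ) (τ : ℕ → ℝ)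
    (hτ_nonneg : ∀ n, 0 ≤ τ n)
    (hτ : τ =Θ[atTop] fun n : ℕ => (n : ℝ) ^ (1 / ((d : ℝ) + 2))) :
    (∃ (C : ℝ) (N : ℕ), ∀ n : ℕ, N ≤ n → ∀ M : ℕ, 1 ≤ M →
      ∀ ν : Measure (BSP.Tree d), BSP.IsBSPLaw ν →
      ∀ (g : BSP.Pt d → ℝ) (μ : Measure (BSP.Pt d)) (κ : Kernel (BSP.Pt d) ℝ),
        g ∈ BSP.LipClass d L B → BSP.IsRegressionModel μ κ g σ →
        ∫⁻ T, BSP.mse (μ.compProd κ) g n (BSP.forestEstimate T (τ n) m)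
            ∂(Measure.pi fun _ : Fin M => ν)
          ≤ ENNReal.ofReal (C * (n : ℝ) ^ (-(2 / ((d : ℝ) + 2))))) ∧
    (0 < L → 0 < B → 0 < σ →
      ∃ c : ℝ, 0 < c ∧ ∀ n : ℕ, 1 ≤ n →
        ∀ φ : BSP.Data d n → BSP.Pt d → ℝ, Measurable (Function.uncurry φ) →
          ∃ g ∈ BSP.LipClass d L B,
            ENNReal.ofReal (c * (n : ℝ) ^ (-(2 / ((d : ℝ) + 2))))
              ≤ BSP.mse (BSP.gaussianModel g σ) g n φ) :=
  ⟨BSP.forest_rate d hd L B σ m τ hτ_nonneg hτ,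
    fun hL hB hσ => BSP.minimax_lower_bound (by omega) hL hB hσ⟩
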